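/- **Theorem (weak completeness of IPDEL with respect to APE-models).** Every IPDEL-formula that is valid in all APE-models is a theorem of IPDEL. The notions are as follows. Fix a set $\mathsf{AtProp}$ of proposition letters and a set $\mathsf{Ag}$ of agents. **Syntax.** Formulas, event structures and theorems ($\vdash$) are defined by simultaneous induction. Formulas: $$\varphi ::= p\mid\bot\mid\varphi\wedge\varphi\mid\varphi\vee\varphi\mid\varphi\to\varphi\mid\lozenge_i\varphi\mid\Box_i\varphi\mid\langle\mathcal E,e\rangle\varphi\mid[\mathcal E,e]\varphi\mid\textstyle\sum_{k=1}^n\alpha_k\mu_i(\varphi_k)\ge\beta$$ with $n\ge 0$, $\alpha_k,\beta\in\mathbb Q$; $\top,\neg,\leftrightarrow$ are the usual abbreviations. For terms $t=\sum_k\alpha_k\mu_i(\varphi_k)$ and $t'$ of the same agent: $t\le\beta$ is $-t\ge-\beta$; $t>\beta$ is $\neg(t\le\beta)$; $t=\beta$ is $(t\ge\beta)\wedge(t\le\beta)$; $t\ge t'$ is $t-t'\ge 0$; $t=t'$ is $(t\geq t')\wedge(t'\ge t)$. An event structure $\mathcal E=(E,(\sim_i),(P_i),\Phi,\prec,\mathsf{pre},\mathbf{sub})$,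 with an event $e\in E$, consists of: a finite non-empty set $E$; equivalence relations $\sim_i$ on $E$; maps $P_i:E\to\mathbb Q\cap\,]0,1]$ with $\sum_{e'\sim_i e}P_i(e')=1$ for all $e$; a finite set $\Phi$ of formulas with a strict partial order $\prec$ such that $\phi\prec\psi$ implies $\vdash\phi\to\psi$, and distinct $\prec$-incomparable $\phi,\psi$ contradict each other, $\vdash\neg(\phi\wedge\psi)$; for every $\phi\in\Phi$ a rational probability distribution $\mathsf{pre}(\bullet\mid\phi)$ on $E$, such that $\phi\prec\psi$ and $\mathsf{pre}(e\mid\phi)=0$ imply $\mathsf{pre}(e\mid\psi)=0$; for every $e$ a map $\mathbf{sub}(e)$ from $\mathsf{AtProp}$ to formulas with $\mathbf{sub}(e)(p)=p$ for all but finitely many $p$. Let $\mathsf{pre}(e)$ be the formula $\bigvee\{\phi\in\Phi\mid\mathsf{pre}(e\mid\phi)\ne0\}$, and let $\mathrm{mb}(\phi)$ be the set of $\prec$-maximal elements of $\{\psi\in\Phi\mid\psi\prec\phi\}$. **Axioms of IPDEL** (schemes for arbitrary formulas). *Intuitionistic logic:* $A\to(B\to A)$; $(A\to(B\to C))\to((A\to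 B)\to(A\to C))$; $A\to(B\to A\wedge B)$; $(A\to C)\to((B\to C)\to(A\vee B\to C))$; $A\wedge B\to A$; $A\wedge B\to B$; $A\to A\vee B$; $B\to A\vee B$; $\bot\to A$. *Modalities:* $A\to\lozenge_iA$; $\Box_iA\to A$; $\lozenge_i(A\vee B)\to\lozenge_iA\vee\lozenge_iB$; $\Box_i(A\to B)\to(\Box_iA\to\Box_iB)$; $\lozenge_iA\to\Box_i\lozenge_iA$; $\lozenge_i\Box_iA\to\Box_iA$; $\Box_i(A\to B)\to(\lozenge_iA\to\lozenge_iB)$; $\lozenge_iA\vee\neg\lozenge_iA$. *Inequalities:* $t\ge t$; $(t\ge\beta)\leftrightarrow(t+0\cdot\mu_i(\varphi)\ge\beta)$; $(t\ge\beta)\to(t'\ge\beta)$ if $t'$ is a permutation of the summands of $t$; $(\sum_k\alpha_k\mu_i(\varphi_k)\ge\beta)\wedge(\sum_k\alpha'_k\mu_i(\varphi_k)\ge\beta')\to(\sum_k(\alpha_k+\alpha'_k)\mu_i(\varphi_k)\ge\beta+\beta')$; $(t\ge\beta)\to(d\,t\ge d\beta)$ for rational $d\ge0$; $(t\ge\beta)\vee(t\le\beta)$;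 $(t\ge\beta)\to(t>\gamma)$ for $\gamma<\beta$. *Probabilities:* $\mu_i(\bot)=0$; $\mu_i(\top)=1$; $\mu_i(\varphi)+\mu_i(\psi)=\mu_i(\varphi\vee\psi)+\mu_i(\varphi\wedge\psi)$; $[\Box_i(\varphi\to\psi)\wedge(\mu_i(\varphi)=\mu_i(\psi))]\leftrightarrow\Box_i(\psi\leftrightarrow\varphi)$; $(t\ge\beta)\to\Box_i(t\ge\beta)$. *Reduction:* - $[\mathcal E,e]p\leftrightarrow(\mathsf{pre}(e)\to\mathbf{sub}(e)(p))$; $\langle\mathcal E,e\rangle p\leftrightarrow\mathsf{pre}(e)\wedge\mathbf{sub}(e)(p)$; - $[\mathcal E,e]\top\leftrightarrow\top$; $\langle\mathcal E,e\rangle\top\leftrightarrow\mathsf{pre}(e)$; $[\mathcal E,e]\bot\leftrightarrow\neg\mathsf{pre}(e)$; $\langle\mathcal E,e\rangle\bot\leftrightarrow\bot$; - $[\mathcal E,e](\varphi\wedge\psi)\leftrightarrow[\mathcal E,e]\varphi\wedge[\mathcal E,e]\psi$; $\langle\mathcal E,e\rangle(\varphi\wedge\psi)\leftrightarrow\langle\mathcal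 E,e\rangle\varphi\wedge\langle\mathcal E,e\rangle\psi$; - $[\mathcal E,e](\varphi\vee\psi)\leftrightarrow(\mathsf{pre}(e)\to\langle\mathcal E,e\rangle\varphi\vee\langle\mathcal E,e\rangle\psi)$; $\langle\mathcal E,e\rangle(\varphi\vee\psi)\leftrightarrow\langle\mathcal E,e\rangle\varphi\vee\langle\mathcal E,e\rangle\psi$; - $[\mathcal E,e](\varphi\to\psi)\leftrightarrow(\langle\mathcal E,e\rangle\varphi\to\langle\mathcal E,e\rangle\psi)$; $\langle\mathcal E,e\rangle(\varphi\to\psi)\leftrightarrow\mathsf{pre}(e)\wedge(\langle\mathcal E,e\rangle\varphi\to\langle\mathcal E,e\rangle\psi)$; - $[\mathcal E,e]\lozenge_i\varphi\leftrightarrow(\mathsf{pre}(e)\to\bigvee_{e'\sim_ie}\lozenge_i\langle\mathcal E,e'\rangle\varphi)$; $\langle\mathcal E,e\rangle\lozenge_i\varphi\leftrightarrow\mathsf{pre}(e)\wedge\bigvee_{e'\sim_ie}\lozenge_i\langle\mathcal E,e'\rangle\varphi$; - $[\mathcal E,e]\Box_i\varphi\leftrightarrow(\mathsf{pre}(e)\to\bigwedge_{e'\sim_ie}\Box_i[\mathcal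 E,e']\varphi)$; $\langle\mathcal E,e\rangle\Box_i\varphi\leftrightarrow\mathsf{pre}(e)\wedge\bigwedge_{e'\sim_ie}\Box_i[\mathcal E,e']\varphi$; - $[\mathcal E,e](\sum_k\alpha_k\mu_i(\psi_k)\ge\beta)\leftrightarrow(\mathsf{pre}(e)\to(C+D\ge0))$ and $\langle\mathcal E,e\rangle(\sum_k\alpha_k\mu_i(\psi_k)\ge\beta)\leftrightarrow\mathsf{pre}(e)\wedge(C+D\ge0)$, where $C=\sum_k\sum_{e'\sim_ie,\,\phi\in\Phi}\alpha_kP_i(e')\,\mathsf{pre}(e'\mid\phi)\,\mu_i^\phi([\mathcal E,e']\psi_k)$, $D=\sum_{e'\sim_ie,\,\phi\in\Phi}-\beta P_i(e')\,\mathsf{pre}(e'\mid\phi)\,\mu_i^\phi(\top)$ and $\mu_i^\phi(\chi)=\mu_i(\chi\wedge\phi)-\sum_{\sigma\in\mathrm{mb}(\phi)}\mu_i(\chi\wedge\sigma)$. *Rules:* modus ponens; from $A$ infer $\Box_iA$; from $A$ infer $[\mathcal E,e]A$; from $A\to B$ infer $\mu_i(A)\le\mu_i(B)$; from $A\leftrightarrow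 B$ infer $\varphi\leftrightarrow\varphi'$ whenever $\varphi'$ arises from $\varphi$ by replacing occurrences of $A$ by $B$. **APE-models.** An epistemic Heyting algebra is a finite Heyting algebra $\mathbb A$ with monotone operations $\lozenge_i,\Box_i$ such that $a\le\lozenge_ia$, $\Box_ia\le a$, $\lozenge_i(a\vee b)\le\lozenge_ia\vee\lozenge_ib$, $\Box_i(a\to b)\le\Box_ia\to\Box_ib$, $\lozenge_ia\le\Box_i\lozenge_ia$, $\lozenge_i\Box_ia\le\Box_ia$, $\Box_i(a\to b)\le\lozenge_ia\to\lozenge_ib$, $\lozenge_i\bot\le\bot$, $\top\le\Box_i\top$ and $\lozenge_ia\vee\neg\lozenge_ia=\top$. Let $\mathsf{Min}_i(\mathbb A)$ be the set of the minimal elements among the $a\ne\bot$ with $\lozenge_ia=a$. An $i$-measure is a partial function $\mu:\mathbb A\to\mathbb R_{\ge0}$ with domain $\mathsf{Min}_i(\mathbb A){\downarrow}$ that is order-preserving, with $\mu(\bot)=0$ (if the domain is non-empty) and such that for all $a\in\mathsf{Min}_i(\mathbb A)$ and $b,c\le a$: $\mu(b\vee c)=\mu(b)+\mu(c)-\mu(b\wedge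 c)$, $\mu(b)<\mu(c)$ if $b<c$, and $\mu(a)=1$. An APE-model $\mathcal M$ is an epistemic Heyting algebra $\mathbb A$ with an $i$-measure $\mu_i$ for each agent and a map $v:\mathsf{AtProp}\to\mathbb A$. **Updates.** For $\mathcal M$ and $\mathcal E$ let $\overline{\mathsf{pre}}\in\mathbb A^E$, $\overline{\mathsf{pre}}(e)=\bigvee\{\llbracket\phi\rrbracket_{\mathcal M}\mid\mathsf{pre}(e\mid\phi)\ne0\}$. On $\mathbb A^E$ put $(\lozenge_i'f)(e)=\bigvee_{e'\sim_ie}\lozenge_if(e')$, $(\Box_i'f)(e)=\bigwedge_{e'\sim_ie}\Box_if(e')$ and $\mu'_i(f)=\sum_{e\in E}\sum_{\phi\in\Phi}P_i(e)\,\mu_i^{\phi}(f(e))\,\mathsf{pre}(e\mid\phi)$, with $\mu_i^\phi(x)=\mu_i(x\wedge\llbracket\phi\rrbracket)-\sum_{\sigma\in\mathrm{mb}(\phi)}\mu_i(x\wedge\llbracket\sigma\rrbracket)$. The algebra of $\mathcal M^{\mathcal E}$ is the quotient of $\mathbb A^E$ by $f\cong g\iff f\wedge\overline{\mathsf{pre}}=g\wedge\overline{\mathsf{pre}}$,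 with $\lozenge_i[f]=[\lozenge_i'(f\wedge\overline{\mathsf{pre}})]$ and $\Box_i[f]=[\Box_i'(\overline{\mathsf{pre}}\to f)]$; its measures are $\mu_i(\bot)=0$ and $\mu_i([g])=\mu_i'(g\wedge\overline{\mathsf{pre}})/\mu_i'(f\wedge\overline{\mathsf{pre}})$ for $[g]\ne\bot$, where $[f]$ is the $i$-minimal element above $[g]$; its valuation is $p\mapsto[e\mapsto\llbracket\mathbf{sub}(e)(p)\rrbracket_{\mathcal M}]$. **Semantics.** $\llbracket p\rrbracket_{\mathcal M}=v(p)$; $\bot,\wedge,\vee,\to,\lozenge_i,\Box_i$ are interpreted by the operations of $\mathbb A$; $\llbracket\langle\mathcal E,e\rangle\varphi\rrbracket_{\mathcal M}=\overline{\mathsf{pre}}(e)\wedge\iota(\llbracket\varphi\rrbracket_{\mathcal M^{\mathcal E}})(e)$ and $\llbracket[\mathcal E,e]\varphi\rrbracket_{\mathcal M}=\overline{\mathsf{pre}}(e)\to\iota(\llbracket\varphi\rrbracket_{\mathcal M^{\mathcal E}})(e)$, where $\iota[g]=g\wedge\overline{\mathsf{pre}}$; and $\llbracket\sum_k\alpha_k\mu_i(\varphi_k)\ge\beta\rrbracket_{\mathcal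 M}=\bigvee\{a\in\mathsf{Min}_i(\mathbb A)\mid\sum_k\alpha_k\mu_i(\llbracket\varphi_k\rrbracket_{\mathcal M}\wedge a)\ge\beta\}$. A formula $\varphi$ is valid if $\llbracket\varphi\rrbracket_{\mathcal M}=\top$ for every APE-model $\mathcal M$. **Claim.** If $\varphi$ is a valid formula, then $\vdash\varphi$. -/

import Mathlib

namespace IPDEL

universe u v

noncomputable section

/-! ### Syntax -/

/-- The non-logical part of an event structure, for agents `Ag`: events `Fin nE`, preconditions
indexed by `Fin nPhi`, indistinguishability relations, subjective probabilities of events, the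
strict order `lt` carried by the preconditions, and the prior probabilities `pre k e`, i.e.
`pre(e | φ_k)`. The probabilities are rational, since they occur as coefficients of formulas. -/
structure EventFrame (Ag : Type v) where
  nE : ℕ
  nE_pos : 0 < nE
  sim : Ag → Setoid (Fin nE)
  P : Ag → Fin nE → ℚ
  P_pos : ∀ i e, 0 < P i e
  P_sum : ∀ i e, (open scoped Classical in
    ∑ e' ∈ Finset.univ.filter (fun e' => (sim i).r e' e), P i e') = 1
  nPhi : ℕ
  lt : Fin nPhi → Fin nPhi → Prop
  lt_irrefl : ∀ k, ¬ lt k k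
  lt_trans : ∀ k l m, lt k l → lt l m → lt k m
  pre : Fin nPhi → Fin nE → ℚ
  pre_nonneg : ∀ k e, 0 ≤ pre k e
  pre_sum : ∀ k, ∑ e, pre k e = 1
  pre_compat : ∀ k l e, lt k l → pre k e = 0 → pre l e = 0

/-- `l` is a maximal element among the preconditions strictly below `k`. -/
def EventFrame.IsMb {Ag : Type v} (F : EventFrame Ag) (k l : Fin F.nPhi) : Prop :=
  F.lt l k ∧ ∀ m, F.lt m k → ¬ F.lt l m

/-- Raw formulas. An event structure over the language is a triple `F, Φ, sub`: an event frame,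
the precondition formulas, and a substitution for every event. The formula
`prob i n α φ β` is `∑ k, α k * μ_i (φ k) ≥ β`. The formulas of the language are the raw formulas
that satisfy `WF` below. -/
inductive Fml (AtProp : Type u) (Ag : Type v) : Type (max u v) where
  | atom (p : AtProp) : Fml AtProp Ag
  | bot : Fml AtProp Ag
  | conj (φ ψ : Fml AtProp Ag) : Fml AtProp Ag
  | disj (φ ψ : Fml AtProp Ag) : Fml AtProp Ag
  | impl (φ ψ : Fml AtProp Ag) : Fml AtProp Ag
  | dia (i : Ag) (φ : Fml AtProp Ag) : Fml AtProp Ag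
  | box (i : Ag) (φ : Fml AtProp Ag) : Fml AtProp Ag
  | upDia (F : EventFrame Ag) (Φ : Fin F.nPhi → Fml AtProp Ag)
      (sub : Fin F.nE → AtProp → Fml AtProp Ag) (e : Fin F.nE) (φ : Fml AtProp Ag) :
      Fml AtProp Ag
  | upBox (F : EventFrame Ag) (Φ : Fin F.nPhi → Fml AtProp Ag)
      (sub : Fin F.nE → AtProp → Fml AtProp Ag) (e : Fin F.nE) (φ : Fml AtProp Ag) :
      Fml AtProp Ag
  | prob (i : Ag) (n : ℕ) (α : Fin n → ℚ) (φ : Fin n → Fml AtProp Ag) (β : ℚ) : Fml AtProp Ag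

namespace Fml

variable {AtProp : Type u} {Ag : Type v}

def top : Fml AtProp Ag := impl bot bot

def neg (φ : Fml AtProp Ag) : Fml AtProp Ag := impl φ bot

def iff (φ ψ : Fml AtProp Ag) : Fml AtProp Ag := conj (impl φ ψ) (impl ψ φ)

def bigOr : List (Fml AtProp Ag) → Fml AtProp Ag
  | [] => bot
  | φ :: l => disj φ (bigOr l)

def bigAnd : List (Fml AtProp Ag) → Fml AtProp Ag
  | [] => top
  | φ :: l => conj φ (bigAnd l)

/-! A list `[(α₁, φ₁), …, (αₙ, φₙ)]` stands for the term `α₁ μ_i(φ₁) + … + αₙ μ_i(φₙ)`. -/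

/-- `t ≥ β`. -/
def ge (i : Ag) (t : List (ℚ × Fml AtProp Ag)) (β : ℚ) : Fml AtProp Ag :=
  prob i t.length (fun k => (t.get k).1) (fun k => (t.get k).2) β

/-- The term `d · t`. -/
def smulTerm (d : ℚ) (t : List (ℚ × Fml AtProp Ag)) : List (ℚ × Fml AtProp Ag) :=
  t.map fun x => (d * x.1, x.2)

/-- `t ≤ β`, i.e. `-t ≥ -β`. -/
def le (i : Ag) (t : List (ℚ × Fml AtProp Ag)) (β : ℚ) : Fml AtProp Ag :=
  ge i (smulTerm (-1) t) (-β)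

/-- `t > β`. -/
def gt (i : Ag) (t : List (ℚ × Fml AtProp Ag)) (β : ℚ) : Fml AtProp Ag :=
  neg (le i t β)

/-- `t = β`. -/
def eq (i : Ag) (t : List (ℚ × Fml AtProp Ag)) (β : ℚ) : Fml AtProp Ag :=
  conj (ge i t β) (le i t β)

/-- `t ≥ t'`, i.e. `t - t' ≥ 0`. -/
def geTerm (i : Ag) (t t' : List (ℚ × Fml AtProp Ag)) : Fml AtProp Ag :=
  ge i (t ++ smulTerm (-1) t') 0

/-- `t = t'`. -/
def eqTerm (i : Ag) (t t' : List (ℚ × Fml AtProp Ag)) : Fml AtProp Ag :=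
  conj (geTerm i t t') (geTerm i t' t)

/-- Every probability formula is of the form `t ≥ β` for a list `t`. -/
theorem prob_eq_ge (i : Ag) (n : ℕ) (α : Fin n → ℚ) (φ : Fin n → Fml AtProp Ag) (β : ℚ) :
    prob i n α φ β = ge i (List.ofFn fun k => (α k, φ k)) β := by
  have key : ∀ (m : ℕ) (a : Fin m → ℚ) (f : Fin m → Fml AtProp Ag) (h : m = n),
      (∀ k : Fin m, a k = α (Fin.cast h k)) → (∀ k : Fin m, f k = φ (Fin.cast h k)) →
      prob i n α φ β = prob i m a f β := by
    intro m a f h ha hf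
    subst h
    have h1 : a = α := funext ha
    have h2 : f = φ := funext hf
    rw [h1, h2]
  apply key _ _ _ (List.length_ofFn)
  · intro k; simp [Fin.cast]
  · intro k; simp [Fin.cast]

/-- The formula `pre(e)`: the disjunction of the preconditions `φ_k` with `pre(e | φ_k) ≠ 0`. -/
def preFml (F : EventFrame Ag) (Φ : Fin F.nPhi → Fml AtProp Ag) (e : Fin F.nE) :
    Fml AtProp Ag :=
  bigOr (((List.finRange F.nPhi).filter fun k => decide (F.pre k e ≠ 0)).map Φ)

/-- The events that agent `i` cannot distinguish from `e`. -/
def simList (F : EventFrame Ag) (i : Ag) (e : Fin F.nE) : List (Fin F.nE) :=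
  open scoped Classical in (List.finRange F.nE).filter fun e' => decide ((F.sim i).r e' e)

def mbList (F : EventFrame Ag) (k : Fin F.nPhi) : List (Fin F.nPhi) :=
  open scoped Classical in (List.finRange F.nPhi).filter fun l => decide (F.IsMb k l)

/-- The term `c · μ_i^{φ_k}(χ)`, where
`μ_i^{φ_k}(χ) = μ_i(χ ∧ φ_k) - ∑_{φ_l ∈ mb(φ_k)} μ_i(χ ∧ φ_l)`. -/
def muPhiTerm (F : EventFrame Ag) (Φ : Fin F.nPhi → Fml AtProp Ag) (k : Fin F.nPhi) (c : ℚ)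
    (χ : Fml AtProp Ag) : List (ℚ × Fml AtProp Ag) :=
  (c, conj χ (Φ k)) :: (mbList F k).map fun l => (-c, conj χ (Φ l))

/-- The term `∑_{e' ∼_i e} ∑_{φ_k} c · P_i(e') · pre(e' | φ_k) · μ_i^{φ_k}(χ e')`. -/
def updTerm (F : EventFrame Ag) (Φ : Fin F.nPhi → Fml AtProp Ag) (i : Ag) (e : Fin F.nE)
    (c : ℚ) (χ : Fin F.nE → Fml AtProp Ag) : List (ℚ × Fml AtProp Ag) :=
  (simList F i e).flatMap fun e' => (List.finRange F.nPhi).flatMap fun k =>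
    muPhiTerm F Φ k (c * F.P i e' * F.pre k e') (χ e')

/-- The inequality `C + D ≥ 0` that reduces `t ≥ β` after the event `e`. -/
def updIneq (F : EventFrame Ag) (Φ : Fin F.nPhi → Fml AtProp Ag)
    (sub : Fin F.nE → AtProp → Fml AtProp Ag) (i : Ag) (e : Fin F.nE)
    (t : List (ℚ × Fml AtProp Ag)) (β : ℚ) : Fml AtProp Ag :=
  ge i ((t.flatMap fun x => updTerm F Φ i e x.1 fun e' => upBox F Φ sub e' x.2) ++
    updTerm F Φ i e (-β) fun _ => top) 0

end Fml

open Fml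

/-- `Repl A B φ φ'`: `φ'` arises from `φ` by replacing some occurrences of `A` by `B`. -/
inductive Repl {AtProp : Type u} {Ag : Type v} (A B : Fml AtProp Ag) :
    Fml AtProp Ag → Fml AtProp Ag → Prop where
  | here : Repl A B A B
  | refl (φ) : Repl A B φ φ
  | conj {φ φ' ψ ψ'} : Repl A B φ φ' → Repl A B ψ ψ' → Repl A B (conj φ ψ) (conj φ' ψ')
  | disj {φ φ' ψ ψ'} : Repl A B φ φ' → Repl A B ψ ψ' → Repl A B (disj φ ψ) (disj φ' ψ')
  | impl {φ φ' ψ ψ'} : Repl A B φ φ' → Repl A B ψ ψ' → Repl A B (impl φ ψ) (impl φ' ψ')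
  | dia {i φ φ'} : Repl A B φ φ' → Repl A B (dia i φ) (dia i φ')
  | box {i φ φ'} : Repl A B φ φ' → Repl A B (box i φ) (box i φ')
  | upDia {F Φ Φ' sub sub' e φ φ'} : (∀ k, Repl A B (Φ k) (Φ' k)) →
      (∀ f p, Repl A B (sub f p) (sub' f p)) → Repl A B φ φ' →
      Repl A B (upDia F Φ sub e φ) (upDia F Φ' sub' e φ')
  | upBox {F Φ Φ' sub sub' e φ φ'} : (∀ k, Repl A B (Φ k) (Φ' k)) →
      (∀ f p, Repl A B (sub f p) (sub' f p)) → Repl A B φ φ' →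
      Repl A B (upBox F Φ sub e φ) (upBox F Φ' sub' e φ')
  | prob {i n α φ φ' β} : (∀ k, Repl A B (φ k) (φ' k)) →
      Repl A B (prob i n α φ β) (prob i n α φ' β)

/-! ### Axioms and derivations -/

inductive Ax {AtProp : Type u} {Ag : Type v} : Fml AtProp Ag → Prop where
  -- intuitionistic propositional logic
  | H1 (A B) : Ax (impl A (impl B A))
  | H2 (A B C) : Ax (impl (impl A (impl B C)) (impl (impl A B) (impl A C)))
  | H3 (A B) : Ax (impl A (impl B (conj A B)))
  | H4 (A B C) : Ax (impl (impl A C) (impl (impl B C) (impl (disj A B) C)))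
  | H5 (A B) : Ax (impl (conj A B) A)
  | H6 (A B) : Ax (impl (conj A B) B)
  | H7 (A B) : Ax (impl A (disj A B))
  | H8 (A B) : Ax (impl B (disj A B))
  | H9 (A) : Ax (impl bot A)
  -- static modalities
  | M1 (i A) : Ax (impl A (dia i A))
  | M2 (i A) : Ax (impl (box i A) A)
  | M3 (i A B) : Ax (impl (dia i (disj A B)) (disj (dia i A) (dia i B)))
  | M4 (i A B) : Ax (impl (box i (impl A B)) (impl (box i A) (box i B)))
  | M5 (i A) : Ax (impl (dia i A) (box i (dia i A)))
  | M6 (i A) : Ax (impl (dia i (box i A)) (box i A))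
  | M7 (i A B) : Ax (impl (box i (impl A B)) (impl (dia i A) (dia i B)))
  | E (i A) : Ax (disj (dia i A) (neg (dia i A)))
  -- inequalities
  | N0 (i t) : Ax (geTerm i t t)
  | N1 (i t β φ) : Ax (iff (ge i t β) (ge i (t ++ [(0, φ)]) β))
  | N2 (i t t' β) : List.Perm t t' → Ax (impl (ge i t β) (ge i t' β))
  -- an entry `(α, α', φ)` of `l` carries the two coefficients of `μ_i(φ)`
  | N3 (i) (l : List (ℚ × ℚ × Fml AtProp Ag)) (β β') :
      Ax (impl (conj (ge i (l.map fun x => (x.1, x.2.2)) β)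
        (ge i (l.map fun x => (x.2.1, x.2.2)) β'))
        (ge i (l.map fun x => (x.1 + x.2.1, x.2.2)) (β + β')))
  | N4 (i t β) (d : ℚ) : 0 ≤ d → Ax (impl (ge i t β) (ge i (smulTerm d t) (d * β)))
  | N5 (i t β) : Ax (disj (ge i t β) (le i t β))
  | N6 (i t) (β γ : ℚ) : γ < β → Ax (impl (ge i t β) (gt i t γ))
  -- intuitionistic probabilities
  | P1 (i) : Ax (eq i [(1, bot)] 0)
  | P2 (i) : Ax (eq i [(1, top)] 1)
  | P3 (i φ ψ) : Ax (eqTerm i [(1, φ), (1, ψ)] [(1, disj φ ψ), (1, conj φ ψ)])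
  | P4 (i φ ψ) : Ax (iff (conj (box i (impl φ ψ)) (eqTerm i [(1, φ)] [(1, ψ)]))
      (box i (iff ψ φ)))
  | P5 (i t β) : Ax (impl (ge i t β) (box i (ge i t β)))
  -- reduction
  | I1 (F Φ sub e p) : Ax (iff (upBox F Φ sub e (atom p)) (impl (preFml F Φ e) (sub e p)))
  | I2 (F Φ sub e p) : Ax (iff (upDia F Φ sub e (atom p)) (conj (preFml F Φ e) (sub e p)))
  | I3 (F Φ sub e) : Ax (iff (upBox F Φ sub e top) top)
  | I4 (F Φ sub e) : Ax (iff (upDia F Φ sub e top) (preFml F Φ e))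
  | I5 (F Φ sub e) : Ax (iff (upBox F Φ sub e bot) (neg (preFml F Φ e)))
  | I6 (F Φ sub e) : Ax (iff (upDia F Φ sub e bot) bot)
  | I7 (F Φ sub e φ ψ) : Ax (iff (upBox F Φ sub e (conj φ ψ))
      (conj (upBox F Φ sub e φ) (upBox F Φ sub e ψ)))
  | I8 (F Φ sub e φ ψ) : Ax (iff (upDia F Φ sub e (conj φ ψ))
      (conj (upDia F Φ sub e φ) (upDia F Φ sub e ψ)))
  | I9 (F Φ sub e φ ψ) : Ax (iff (upBox F Φ sub e (disj φ ψ))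
      (impl (preFml F Φ e) (disj (upDia F Φ sub e φ) (upDia F Φ sub e ψ))))
  | I10 (F Φ sub e φ ψ) : Ax (iff (upDia F Φ sub e (disj φ ψ))
      (disj (upDia F Φ sub e φ) (upDia F Φ sub e ψ)))
  | I11 (F Φ sub e φ ψ) : Ax (iff (upBox F Φ sub e (impl φ ψ))
      (impl (upDia F Φ sub e φ) (upDia F Φ sub e ψ)))
  | I12 (F Φ sub e φ ψ) : Ax (iff (upDia F Φ sub e (impl φ ψ))
      (conj (preFml F Φ e) (impl (upDia F Φ sub e φ) (upDia F Φ sub e ψ))))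
  | I13 (F Φ sub e i φ) : Ax (iff (upBox F Φ sub e (dia i φ))
      (impl (preFml F Φ e)
        (bigOr ((simList F i e).map fun e' => dia i (upDia F Φ sub e' φ)))))
  | I14 (F Φ sub e i φ) : Ax (iff (upDia F Φ sub e (dia i φ))
      (conj (preFml F Φ e)
        (bigOr ((simList F i e).map fun e' => dia i (upDia F Φ sub e' φ)))))
  | I15 (F Φ sub e i φ) : Ax (iff (upBox F Φ sub e (box i φ))
      (impl (preFml F Φ e)
        (bigAnd ((simList F i e).map fun e' => box i (upBox F Φ sub e' φ)))))
  | I16 (F Φ sub e i φ) : Ax (iff (upDia F Φ sub e (box i φ))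
      (conj (preFml F Φ e)
        (bigAnd ((simList F i e).map fun e' => box i (upBox F Φ sub e' φ)))))
  | I17 (F Φ sub e i t β) : Ax (iff (upBox F Φ sub e (ge i t β))
      (impl (preFml F Φ e) (updIneq F Φ sub i e t β)))
  | I18 (F Φ sub e i t β) : Ax (iff (upDia F Φ sub e (ge i t β))
      (conj (preFml F Φ e) (updIneq F Φ sub i e t β)))

/-! Formulas, event structures and derivability are defined by simultaneous induction. -/

mutual

/-- The formulas of the language. -/
inductive WF {AtProp : Type u} {Ag : Type v} : Fml AtProp Ag → Prop where
  | atom (p) : WF (atom p)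
  | bot : WF bot
  | conj {φ ψ} : WF φ → WF ψ → WF (conj φ ψ)
  | disj {φ ψ} : WF φ → WF ψ → WF (disj φ ψ)
  | impl {φ ψ} : WF φ → WF ψ → WF (impl φ ψ)
  | dia {i φ} : WF φ → WF (dia i φ)
  | box {i φ} : WF φ → WF (box i φ)
  | upDia {F Φ sub e φ} : WFEvent F Φ sub → WF φ → WF (upDia F Φ sub e φ)
  | upBox {F Φ sub e φ} : WFEvent F Φ sub → WF φ → WF (upBox F Φ sub e φ)
  | prob {i} {n : ℕ} {α : Fin n → ℚ} {φ : Fin n → Fml AtProp Ag} {β} :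
      (∀ k, WF (φ k)) → WF (prob i n α φ β)

/-- The event structures over the language: the preconditions are pairwise distinct formulas, a
precondition below another one provably implies it, incomparable ones contradict each other, and
every substitution moves only finitely many letters. -/
inductive WFEvent {AtProp : Type u} {Ag : Type v} : (F : EventFrame Ag) →
    (Fin F.nPhi → Fml AtProp Ag) → (Fin F.nE → AtProp → Fml AtProp Ag) → Prop where
  | mk {F : EventFrame Ag} {Φ : Fin F.nPhi → Fml AtProp Ag}
      {sub : Fin F.nE → AtProp → Fml AtProp Ag} : (∀ k, WF (Φ k)) → (∀ e p, WF (sub e p)) →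
      (∀ e, {p | sub e p ≠ Fml.atom p}.Finite) →
      Function.Injective Φ →
      (∀ k l, F.lt k l → Provable (Fml.impl (Φ k) (Φ l))) →
      (∀ k l, k ≠ l → ¬ F.lt k l → ¬ F.lt l k → Provable (neg (Fml.conj (Φ k) (Φ l)))) →
      WFEvent F Φ sub

/-- The theorems of IPDEL. -/
inductive Provable {AtProp : Type u} {Ag : Type v} : Fml AtProp Ag → Prop where
  | ax {φ} : WF φ → Ax φ → Provable φ
  | mp {A B} : Provable (Fml.impl A B) → Provable A → Provable B
  | nec (i) {A} : Provable A → Provable (Fml.box i A)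
  | necUp {F Φ sub} (e) {A} : WFEvent F Φ sub → Provable A → Provable (Fml.upBox F Φ sub e A)
  | subMu (i) {A B} : Provable (Fml.impl A B) → Provable (geTerm i [(1, B)] [(1, A)])
  | subEq {A B φ φ'} : Provable (iff A B) → WF φ → WF φ' → Repl A B φ φ' →
      Provable (iff φ φ')

end

/-! ### Algebras -/

section Algebra

variable {A : Type} [HeytingAlgebra A]

structure IsMonadic (dia box : A → A) : Prop where
  dia_mono : Monotone dia
  box_mono : Monotone box
  M1 : ∀ a, a ≤ dia a
  M2 : ∀ a, box a ≤ a
  M3 : ∀ a b, dia (a ⊔ b) ≤ dia a ⊔ dia b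
  M4 : ∀ a b, box (a ⇨ b) ≤ box a ⇨ box b
  M5 : ∀ a, dia a ≤ box (dia a)
  M6 : ∀ a, dia (box a) ≤ box a
  M7 : ∀ a b, box (a ⇨ b) ≤ dia a ⇨ dia b
  M8 : dia ⊥ ≤ ⊥
  M9 : ⊤ ≤ box ⊤

/-- The `i`-minimal elements, for `dia = ◇_i`. -/
def IsIMin (dia : A → A) (a : A) : Prop :=
  a ≠ ⊥ ∧ dia a = a ∧ ∀ b, b < a → dia b = b → b = ⊥

/-- The `i`-measures, for `dia = ◇_i`. An `i`-measure is a partial function with domain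
`Min_i(A)↓`; it is represented by a total function whose values off this domain do not matter. -/
structure IsIMeasure (dia : A → A) (μ : A → ℝ) : Prop where
  nonneg : ∀ a b, IsIMin dia a → b ≤ a → 0 ≤ μ b
  mono : ∀ a b c, IsIMin dia a → b ≤ c → c ≤ a → μ b ≤ μ c
  modular : ∀ a b c, IsIMin dia a → b ≤ a → c ≤ a → μ (b ⊔ c) = μ b + μ c - μ (b ⊓ c)
  bot : ∀ a, IsIMin dia a → μ ⊥ = 0
  strict : ∀ a b c, IsIMin dia a → b < c → c ≤ a → μ b < μ c
  one : ∀ a, IsIMin dia a → μ a = 1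

/-- The congruence `b ≅_a c` iff `b ∧ a = c ∧ a`. -/
def pqSetoid (a : A) : Setoid A where
  r b c := b ⊓ a = c ⊓ a
  iseqv := ⟨fun _ => rfl, fun h => h.symm, fun h h' => h.trans h'⟩

/-- The carrier of the pseudo-quotient by `a`. -/
def PseudoQuot (a : A) : Type := Quotient (pqSetoid a)

namespace PseudoQuot

variable {a : A}

/-- The class `[b]`. -/
def mk (a b : A) : PseudoQuot a := Quotient.mk (pqSetoid a) b

/-- The map `[b] ↦ b ∧ a`. -/
def iota : PseudoQuot a → A := Quotient.lift (fun b => b ⊓ a) fun _ _ h => h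

theorem iota_injective : Function.Injective (iota (a := a)) := by
  intro x y
  induction x using Quotient.inductionOn
  induction y using Quotient.inductionOn
  intro h
  exact Quotient.sound h

theorem inf_himp_inf (b c : A) : (b ⇨ c) ⊓ a = ((b ⊓ a) ⇨ (c ⊓ a)) ⊓ a := by
  apply le_antisymm
  · apply le_inf _ inf_le_right
    rw [le_himp_iff]
    apply le_inf
    · calc (b ⇨ c) ⊓ a ⊓ (b ⊓ a) ≤ (b ⇨ c) ⊓ b := by
            apply le_inf
            · exact inf_le_left.trans inf_le_left
            · exact inf_le_right.trans inf_le_left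
        _ ≤ c := himp_inf_le
    · exact inf_le_right.trans inf_le_right
  · apply le_inf _ inf_le_right
    rw [le_himp_iff]
    calc ((b ⊓ a) ⇨ (c ⊓ a)) ⊓ a ⊓ b ≤ ((b ⊓ a) ⇨ (c ⊓ a)) ⊓ (b ⊓ a) := by
          apply le_inf
          · exact inf_le_left.trans inf_le_left
          · exact le_inf inf_le_right (inf_le_left.trans inf_le_right)
      _ ≤ c ⊓ a := himp_inf_le
      _ ≤ c := inf_le_left

instance : Max (PseudoQuot a) :=
  ⟨Quotient.map₂ (· ⊔ ·) (by
    intro b b' (h : b ⊓ a = b' ⊓ a) c c' (h' : c ⊓ a = c' ⊓ a)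
    show (b ⊔ c) ⊓ a = (b' ⊔ c') ⊓ a
    rw [inf_sup_right, inf_sup_right, h, h'])⟩

instance : Min (PseudoQuot a) :=
  ⟨Quotient.map₂ (· ⊓ ·) (by
    intro b b' (h : b ⊓ a = b' ⊓ a) c c' (h' : c ⊓ a = c' ⊓ a)
    show (b ⊓ c) ⊓ a = (b' ⊓ c') ⊓ a
    rw [inf_inf_distrib_right, inf_inf_distrib_right b', h, h'])⟩

instance : HImp (PseudoQuot a) :=
  ⟨Quotient.map₂ (· ⇨ ·) (by
    intro b b' (h : b ⊓ a = b' ⊓ a) c c' (h' : c ⊓ a = c' ⊓ a)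
    show (b ⇨ c) ⊓ a = (b' ⇨ c') ⊓ a
    rw [inf_himp_inf b, inf_himp_inf b', h, h'])⟩

theorem iota_sup (x y : PseudoQuot a) : iota (x ⊔ y) = iota x ⊔ iota y := by
  induction x using Quotient.inductionOn
  induction y using Quotient.inductionOn
  exact inf_sup_right _ _ _

theorem iota_inf (x y : PseudoQuot a) : iota (x ⊓ y) = iota x ⊓ iota y := by
  induction x using Quotient.inductionOn
  induction y using Quotient.inductionOn
  exact inf_inf_distrib_right _ _ _

theorem iota_himp (x y : PseudoQuot a) : iota (x ⇨ y) = (iota x ⇨ iota y) ⊓ a := by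
  induction x using Quotient.inductionOn
  induction y using Quotient.inductionOn
  exact inf_himp_inf _ _

theorem iota_le (x : PseudoQuot a) : iota x ≤ a := by
  induction x using Quotient.inductionOn
  exact inf_le_right

instance : PartialOrder (PseudoQuot a) := PartialOrder.lift iota iota_injective

theorem le_iff_iota (x y : PseudoQuot a) : x ≤ y ↔ iota x ≤ iota y := Iff.rfl

/-- The quotient Heyting algebra; `[b] ≤ [c]` iff `b ∧ a ≤ c ∧ a`. -/
instance : HeytingAlgebra (PseudoQuot a) where
  sup x y := x ⊔ y
  inf x y := x ⊓ y
  top := mk a ⊤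
  bot := mk a ⊥
  compl x := x ⇨ mk a ⊥
  le_sup_left x y := by rw [le_iff_iota, iota_sup]; exact le_sup_left
  le_sup_right x y := by rw [le_iff_iota, iota_sup]; exact le_sup_right
  sup_le x y z h h' := by rw [le_iff_iota] at *; rw [iota_sup]; exact sup_le h h'
  inf_le_left x y := by rw [le_iff_iota, iota_inf]; exact inf_le_left
  inf_le_right x y := by rw [le_iff_iota, iota_inf]; exact inf_le_right
  le_inf x y z h h' := by rw [le_iff_iota] at *; rw [iota_inf]; exact le_inf h h'
  le_top x := by
    rw [le_iff_iota]
    exact (iota_le x).trans (le_inf le_top le_rfl)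
  bot_le x := by
    rw [le_iff_iota]
    exact inf_le_left.trans bot_le
  le_himp_iff x y z := by
    have h : iota (x ⊓ y) = iota x ⊓ iota y := iota_inf x y
    rw [le_iff_iota, iota_himp, le_inf_iff, le_himp_iff, ← h]
    exact ⟨fun h => h.1, fun h => ⟨h, iota_le x⟩⟩
  himp_bot x := rfl

instance [Finite A] : Finite (PseudoQuot a) := Quotient.finite _

/-- `[b] ↦ [◇(b ∧ a)]`. -/
def dia (d : A → A) : PseudoQuot a → PseudoQuot a :=
  Quotient.lift (fun b => mk a (d (b ⊓ a))) fun b c (h : b ⊓ a = c ⊓ a) =>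
    congrArg (fun x => mk a (d x)) h

/-- `[b] ↦ [□(a → b)]`. -/
def box (d : A → A) : PseudoQuot a → PseudoQuot a :=
  Quotient.lift (fun b => mk a (d (a ⇨ b))) fun b c (h : b ⊓ a = c ⊓ a) => by
    have key : ∀ x : A, a ⇨ x = a ⇨ (x ⊓ a) := fun x => by
      rw [himp_inf_distrib, himp_self, inf_top_eq]
    show mk a (d (a ⇨ b)) = mk a (d (a ⇨ c))
    rw [key b, key c, h]

end PseudoQuot

end Algebra

/-! ### Models and updates -/

/-- The data of an algebraic model, without its laws. -/
structure PreModel (AtProp : Type u) (Ag : Type v) where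
  carrier : Type
  [heyting : HeytingAlgebra carrier]
  [finite : Finite carrier]
  dia : Ag → carrier → carrier
  box : Ag → carrier → carrier
  mu : Ag → carrier → ℝ
  val : AtProp → carrier

attribute [instance] PreModel.heyting PreModel.finite

/-- APE-models: the carrier is an epistemic Heyting algebra (finite, monadic, and with
`◇_i a ∨ ¬ ◇_i a = ⊤`), and every `μ_i` is an `i`-measure. -/
structure PreModel.IsAPE {AtProp : Type u} {Ag : Type v} (M : PreModel AtProp Ag) : Prop where
  monadic : ∀ i, IsMonadic (M.dia i) (M.box i)
  epistemic : ∀ i a, M.dia i a ⊔ (M.dia i a)ᶜ = ⊤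
  measure : ∀ i, IsIMeasure (M.dia i) (M.mu i)

/-- The join of a set of elements of a finite algebra. -/
def finSup {A : Type} [HeytingAlgebra A] [Finite A] (S : Set A) : A :=
  (Set.toFinite S).toFinset.sup id

section Update

variable {AtProp : Type u} {Ag : Type v} (M : PreModel AtProp Ag) (F : EventFrame Ag)

/-- `◇'_i` on the product algebra. -/
def prodDia (i : Ag) (f : Fin F.nE → M.carrier) : Fin F.nE → M.carrier :=
  open scoped Classical in fun e =>
    (Finset.univ.filter fun e' => (F.sim i).r e' e).sup fun e' => M.dia i (f e')

/-- `□'_i` on the product algebra. -/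
def prodBox (i : Ag) (f : Fin F.nE → M.carrier) : Fin F.nE → M.carrier :=
  open scoped Classical in fun e =>
    (Finset.univ.filter fun e' => (F.sim i).r e' e).inf fun e' => M.box i (f e')

/-- The element `e ↦ ⋁ {a_k | pre(e | a_k) ≠ 0}` of the product algebra, where `a` is the family
of the values of the preconditions. -/
def preBar (a : Fin F.nPhi → M.carrier) : Fin F.nE → M.carrier := fun e =>
  (Finset.univ.filter fun k => F.pre k e ≠ 0).sup a

/-- `μ_i^{a_k}(x) = μ_i(x ∧ a_k) - ∑_{a_l ∈ mb(a_k)} μ_i(x ∧ a_l)`. -/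
def muPhi (a : Fin F.nPhi → M.carrier) (i : Ag) (k : Fin F.nPhi) (x : M.carrier) : ℝ :=
  open scoped Classical in
    M.mu i (x ⊓ a k) - ∑ l ∈ Finset.univ.filter (fun l => F.IsMb k l), M.mu i (x ⊓ a l)

/-- The premeasure `μ'_i` of the product algebra. -/
def prodMu (a : Fin F.nPhi → M.carrier) (i : Ag) (f : Fin F.nE → M.carrier) : ℝ :=
  ∑ e, ∑ k, (F.P i e : ℝ) * muPhi M F a i k (f e) * (F.pre k e : ℝ)

/-- The measure of the updated algebra: `⊥ ↦ 0`, and `[g] ↦ μ'_i(g) / μ'_i(f)` for `[g] ≠ ⊥`,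
where `[f]` is the `i`-minimal element above `[g]`. The representatives are `g ∧ pre` and
`f ∧ pre`, on which `μ'_i` takes the same values as on `g` and `f`. -/
def updMu (a : Fin F.nPhi → M.carrier) (i : Ag) (x : PseudoQuot (preBar M F a)) : ℝ :=
  open scoped Classical in
    if x = ⊥ then 0
    else if h : ∃ y, IsIMin (PseudoQuot.dia (prodDia M F i)) y ∧ x ≤ y then
      prodMu M F a i (PseudoQuot.iota x) / prodMu M F a i (PseudoQuot.iota h.choose)
    else 0

/-- The updated model, where `a` and `s` are the values in `M` of the preconditions and of the
substitutions. -/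
def update (a : Fin F.nPhi → M.carrier) (s : Fin F.nE → AtProp → M.carrier) :
    PreModel AtProp Ag where
  carrier := PseudoQuot (preBar M F a)
  dia i := PseudoQuot.dia (prodDia M F i)
  box i := PseudoQuot.box (prodBox M F i)
  mu i := updMu M F a i
  val p := PseudoQuot.mk (preBar M F a) fun e => s e p

end Update

/-- The interpretation `⟦φ⟧_M`. -/
def eval {AtProp : Type u} {Ag : Type v} :
    Fml AtProp Ag → (M : PreModel AtProp Ag) → M.carrier
  | atom p, M => M.val p
  | bot, _ => ⊥
  | conj φ ψ, M => eval φ M ⊓ eval ψ M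
  | disj φ ψ, M => eval φ M ⊔ eval ψ M
  | impl φ ψ, M => eval φ M ⇨ eval ψ M
  | dia i φ, M => M.dia i (eval φ M)
  | box i φ, M => M.box i (eval φ M)
  | upDia F Φ sub e φ, M =>
      preBar M F (fun k => eval (Φ k) M) e ⊓
        PseudoQuot.iota (a := preBar M F fun k => eval (Φ k) M)
          (eval φ (update M F (fun k => eval (Φ k) M) fun f p => eval (sub f p) M)) e
  | upBox F Φ sub e φ, M =>
      preBar M F (fun k => eval (Φ k) M) e ⇨
        PseudoQuot.iota (a := preBar M F fun k => eval (Φ k) M)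
          (eval φ (update M F (fun k => eval (Φ k) M) fun f p => eval (sub f p) M)) e
  | prob i n α φ β, M =>
      finSup {a | IsIMin (M.dia i) a ∧ (β : ℝ) ≤ ∑ k : Fin n, (α k : ℝ) * M.mu i (eval (φ k) M ⊓ a)}

/-- `φ` is valid: `⟦φ⟧_M = ⊤` in every APE-model `M`. -/
def Valid {AtProp : Type u} {Ag : Type v} (φ : Fml AtProp Ag) : Prop :=
  ∀ M : PreModel AtProp Ag, M.IsAPE → eval φ M = ⊤

end

end IPDEL

namespace IPDEL

universe u v

noncomputable section

open Fml

/-! ### Blocks of an epistemic Heyting algebra -/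

section Blocks

variable {A : Type} [HeytingAlgebra A] {d bx : A → A}

-- The updates are eliminated first, and completeness is then proved for static formulas, those
-- without updates. For the elimination, the reduction axioms push an update through a static
-- formula (`HasStatic.update_of_static`). Working from the innermost update outwards with the
-- replacement rule, every formula becomes provably equivalent to a static one (`HasStatic.of_wf`).
-- The static formula inherits validity from the original only because the equivalence is itself
-- valid, so soundness is needed (`Provable.sound`). Its hard points are that the update of an
-- APE-model is again one (`update_isAPE`) and that the reduction axioms for inequalities hold
-- (`updVal_ge`). Both rest on the `i`-minimal elements, called blocks: they are pairwise disjoint,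
-- they join to `⊤`, and inequalities can be tested on them. The blocks of an update are given by a
-- block of the model and a class of events. On each of them the new measure is the premeasure
-- divided by a positive constant, so clearing the denominator turns an inequality after the update
-- into one before it. For static formulas, take the prime filters of the Lindenbaum algebra and
-- keep only their traces on a finite closed set of formulas. Traces are ordered by reverse
-- inclusion and are `i`-related when they agree on the modal formulas of agent `i`; the lower sets
-- of this finite order form the model. What remains is to find weights. A prime filter `T` declares
-- formal rational combinations of Lindenbaum elements to be nonnegative or not, totally and
-- compatibly with the linear structure. This preorder need not be Archimedean, but the signs of
-- finitely many vectors are realised by one rational functional (`exists_functional_sign`).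
-- Restricted to lower sets the functional is a valuation, hence a sum of point masses
-- (`valuation_eq_sum`). The axiom that combines `□_i` with equality of measures makes the masses
-- vanish off the class of `T` and makes the mass at the trace of `T` positive (`exists_isWeight`).
-- Averaging these masses over a class makes every point positive; the inequalities survive because
-- they are linear and the points of a class agree on them. The truth lemma is `truth_eq_hold`.

theorem IsMonadic.dia_bot (hm : IsMonadic d bx) : d ⊥ = ⊥ := le_bot_iff.1 hm.M8

theorem IsMonadic.box_dia (hm : IsMonadic d bx) (a : A) : bx (d a) = d a :=
  le_antisymm (hm.M2 _) (hm.M5 _)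

theorem IsMonadic.dia_box (hm : IsMonadic d bx) (a : A) : d (bx a) = bx a :=
  le_antisymm (hm.M6 _) (hm.M1 _)

theorem IsMonadic.dia_dia (hm : IsMonadic d bx) (a : A) : d (d a) = d a := by
  have h := hm.dia_box (d a)
  rwa [hm.box_dia] at h

theorem IsMonadic.dia_le_iff (hm : IsMonadic d bx) {a b : A} (hb : d b = b) :
    d a ≤ b ↔ a ≤ b :=
  ⟨fun h => (hm.M1 a).trans h, fun h => (hm.dia_mono h).trans hb.le⟩

theorem IsMonadic.le_box_iff (hm : IsMonadic d bx) {a b : A} (ha : d a = a) :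
    a ≤ bx b ↔ a ≤ b :=
  ⟨fun h => h.trans (hm.M2 b), fun h => by
    have := hm.box_mono h
    rwa [← ha, hm.box_dia, ha] at this⟩

theorem IsMonadic.dia_sup (hm : IsMonadic d bx) {a b : A} (ha : d a = a) (hb : d b = b) :
    d (a ⊔ b) = a ⊔ b :=
  le_antisymm ((hm.M3 a b).trans (by rw [ha, hb])) (hm.M1 _)

theorem IsMonadic.dia_inf (hm : IsMonadic d bx) {a b : A} (ha : d a = a) (hb : d b = b) :
    d (a ⊓ b) = a ⊓ b :=
  le_antisymm (le_inf ((hm.dia_le_iff ha).2 inf_le_left) ((hm.dia_le_iff hb).2 inf_le_right))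
    (hm.M1 _)

/-- Since `a` is fixed, `a ≤ aᶜᶜ` lifts to `a ≤ □(aᶜ → ⊥)`, and M7 with `◇⊥ = ⊥` turns this into `a
≤ (◇aᶜ)ᶜ`. -/
theorem IsMonadic.dia_compl (hm : IsMonadic d bx) {a : A} (ha : d a = a) : d aᶜ = aᶜ := by
  refine le_antisymm ?_ (hm.M1 _)
  have h1 : a ≤ bx (aᶜ ⇨ ⊥) := (hm.le_box_iff ha).2 (by rw [himp_bot]; exact le_compl_compl)
  have h2 := h1.trans (hm.M7 _ _)
  rw [hm.dia_bot, himp_bot] at h2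
  exact le_compl_comm.1 h2

/-- The meet `b ⊓ f` is fixed and lies below `b`, so minimality leaves only `b` and `⊥`. -/
theorem IsIMin.eq_or_disjoint (hm : IsMonadic d bx) {b f : A} (hb : IsIMin d b) (hf : d f = f) :
    b ≤ f ∨ b ⊓ f = ⊥ := by
  by_cases h : b ≤ f
  · exact Or.inl h
  · refine Or.inr (hb.2.2 _ (lt_of_le_of_ne inf_le_left fun h' => h (inf_eq_left.1 h')) ?_)
    exact hm.dia_inf hb.2.1 hf

theorem IsIMin.le_of_inf_ne (hm : IsMonadic d bx) {b f : A} (hb : IsIMin d b) (hf : d f = f)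
    (h : b ⊓ f ≠ ⊥) : b ≤ f :=
  (hb.eq_or_disjoint hm hf).resolve_right h

theorem IsIMin.eq_of_inf_ne (hm : IsMonadic d bx) {b c : A} (hb : IsIMin d b) (hc : IsIMin d c)
    (h : b ⊓ c ≠ ⊥) : b = c :=
  le_antisymm (hb.le_of_inf_ne hm hc.2.1 h) (hc.le_of_inf_ne hm hb.2.1 (by rwa [inf_comm]))

theorem IsIMin.le_dia (hm : IsMonadic d bx) {b x : A} (hb : IsIMin d b)
    (h : b ⊓ x ≠ ⊥) : b ≤ d x :=
  hb.le_of_inf_ne hm (hm.dia_dia x) fun h' => h (le_bot_iff.1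
    ((inf_le_inf_left b (hm.M1 x)).trans h'.le))

theorem IsIMin.le_box_iff (hm : IsMonadic d bx) {b x : A} (hb : IsIMin d b) :
    b ≤ bx x ↔ b ≤ x := hm.le_box_iff hb.2.1

theorem IsIMin.le_sup_iff (hm : IsMonadic d bx) {b f g : A} (hb : IsIMin d b) (hf : d f = f) :
    b ≤ f ⊔ g ↔ b ≤ f ∨ b ≤ g := by
  refine ⟨fun h => ?_, fun h => h.elim le_sup_of_le_left le_sup_of_le_right⟩
  rcases hb.eq_or_disjoint hm hf with h' | h'
  · exact Or.inl h'
  · right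
    have : b = b ⊓ (f ⊔ g) := (inf_eq_left.2 h).symm
    rw [inf_sup_left, h', bot_sup_eq] at this
    exact inf_eq_left.1 this.symm

variable [Finite A]

theorem exists_iMin_le {f : A} (h0 : f ≠ ⊥) (hf : d f = f) : ∃ b, b ≤ f ∧ IsIMin d b := by
  obtain ⟨b, hb, hmin⟩ := exists_minimal_le_of_wellFoundedLT
    (fun x : A => x ≠ ⊥ ∧ d x = x) f ⟨h0, hf⟩
  refine ⟨b, hb, hmin.prop.1, hmin.prop.2, fun c hc hdc => ?_⟩
  by_contra hne
  exact not_le_of_gt hc (hmin.le_of_le ⟨hne, hdc⟩ hc.le)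

/-- Take a block `b` below `◇x`. If it were disjoint from `x`, the fixed element `bᶜ` would lie
above `x`, hence above `◇x`, hence above `b`. -/
theorem exists_iMin_inf_ne (hm : IsMonadic d bx) {x : A} (hx : x ≠ ⊥) :
    ∃ b, IsIMin d b ∧ b ⊓ x ≠ ⊥ := by
  have h0 : d x ≠ ⊥ := fun h => hx (le_bot_iff.1 ((hm.M1 x).trans h.le))
  obtain ⟨b, hbx, hb⟩ := exists_iMin_le h0 (hm.dia_dia x)
  refine ⟨b, hb, fun h => hb.1 ?_⟩
  have h1 : d x ≤ bᶜ := (hm.dia_le_iff (hm.dia_compl hb.2.1)).2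
    (le_compl_iff_disjoint_left.2 (disjoint_iff.2 h))
  have h2 := le_inf le_rfl (hbx.trans h1)
  rw [inf_compl_self] at h2
  exact le_bot_iff.1 h2

/-- The join of the blocks with the property `c`. -/
def blockSup (d : A → A) (c : A → Prop) : A := finSup {b | IsIMin d b ∧ c b}

theorem le_finSup {S : Set A} {a : A} (h : a ∈ S) : a ≤ finSup S :=
  Finset.le_sup (f := id) ((Set.toFinite S).mem_toFinset.2 h)

theorem finSup_le {S : Set A} {a : A} (h : ∀ b ∈ S, b ≤ a) : finSup S ≤ a :=
  Finset.sup_le fun b hb => h b ((Set.toFinite S).mem_toFinset.1 hb)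

theorem inf_finSup_le {S : Set A} {a c : A} (h : ∀ b ∈ S, a ⊓ b ≤ c) : a ⊓ finSup S ≤ c := by
  rw [inf_comm, ← le_himp_iff]
  exact finSup_le fun b hb => le_himp_iff.2 (by rw [inf_comm]; exact h b hb)

theorem dia_blockSup (hm : IsMonadic d bx) (c : A → Prop) :
    d (blockSup d c) = blockSup d c :=
  Finset.sup_induction (p := fun x => d x = x) hm.dia_bot (fun _ h _ h' => hm.dia_sup h h')
    fun _ hb => ((Set.toFinite _).mem_toFinset.1 hb).1.2.1

/-- Distinct blocks are disjoint, so a join of blocks has no blocks below it other than those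
joined. -/
theorem IsIMin.le_blockSup_iff (hm : IsMonadic d bx) {b : A} (hb : IsIMin d b)
    {c : A → Prop} : b ≤ blockSup d c ↔ c b := by
  refine ⟨fun h => ?_, fun h => le_finSup (S := {b | IsIMin d b ∧ c b}) ⟨hb, h⟩⟩
  by_contra hc
  apply hb.1
  rw [← inf_eq_left.2 h, ← le_bot_iff]
  refine inf_finSup_le fun b' hb' => ?_
  by_contra h'
  rw [le_bot_iff] at h'
  exact hc (hb.eq_of_inf_ne hm hb'.1 h' ▸ hb'.2)

/-- This is where `◇a ∨ ¬◇a = ⊤` enters. The join `s` of all blocks is fixed, hence complemented,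
and a nonzero `sᶜ` would meet some block although every block is below `s`. -/
theorem blockSup_true (hm : IsMonadic d bx) (he : ∀ a, d a ⊔ (d a)ᶜ = ⊤) :
    blockSup d (fun _ => True) = ⊤ := by
  have h := he (blockSup d fun _ => True)
  rw [dia_blockSup hm] at h
  have h0 : (blockSup d fun _ => True)ᶜ = ⊥ := by
    by_contra hne
    obtain ⟨b, hb, hb'⟩ := exists_iMin_inf_ne hm hne
    apply hb'
    have := (hb.le_blockSup_iff hm (c := fun _ => True)).2 trivial
    exact disjoint_iff.1 (Disjoint.mono_left this disjoint_compl_right)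
  rwa [h0, sup_bot_eq] at h

/-- Inequalities can be tested on blocks. -/
theorem le_of_blocks (hm : IsMonadic d bx) (he : ∀ a, d a ⊔ (d a)ᶜ = ⊤) {x y : A}
    (h : ∀ b, IsIMin d b → b ⊓ x ≤ y) : x ≤ y := by
  rw [← inf_top_eq x, ← blockSup_true hm he]
  exact inf_finSup_le fun b hb => by rw [inf_comm]; exact h b hb.1

/-- For fixed `x`, blocks not below `x` are disjoint from it and impose no condition. -/
theorem le_of_blocks_of_fixed (hm : IsMonadic d bx) (he : ∀ a, d a ⊔ (d a)ᶜ = ⊤) {x y : A}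
    (hx : d x = x) (h : ∀ b, IsIMin d b → b ≤ x → b ≤ y) : x ≤ y := by
  refine le_of_blocks hm he fun b hb => ?_
  rcases hb.eq_or_disjoint hm hx with h' | h'
  · exact inf_le_left.trans (h b hb h')
  · rw [h']; exact bot_le

theorem eq_top_of_blocks (hm : IsMonadic d bx) (he : ∀ a, d a ⊔ (d a)ᶜ = ⊤) {y : A}
    (h : ∀ b, IsIMin d b → b ≤ y) : y = ⊤ :=
  top_le_iff.1 (le_of_blocks hm he fun b hb => inf_le_left.trans (h b hb))

end Blocks

/-! ### Measures -/

section Measure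

variable {A : Type} [HeytingAlgebra A] {d : A → A} {m : A → ℝ} {b : A}

theorem IsIMeasure.sum_eq (h : IsIMeasure d m) (hb : IsIMin d b) {ι : Type*} (S : Finset ι)
    (a : ι → A) (ha : ∀ k ∈ S, ∀ l ∈ S, k ≠ l → a k ⊓ a l = ⊥) {x : A} (hx : x ≤ b) :
    ∑ l ∈ S, m (x ⊓ a l) = m (x ⊓ S.sup a) := by
  classical
  induction S using Finset.induction_on with
  | empty => simp [h.bot b hb]
  | insert k S hk ih =>
    rw [Finset.sum_insert hk, Finset.sup_insert, inf_sup_left,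
      h.modular b _ _ hb (inf_le_left.trans hx) (inf_le_left.trans hx),
      ih fun k' hk' l hl => ha k' (Finset.mem_insert_of_mem hk') l (Finset.mem_insert_of_mem hl)]
    have : x ⊓ a k ⊓ (x ⊓ S.sup a) = ⊥ := by
      rw [← le_bot_iff]
      refine (inf_le_inf inf_le_right inf_le_right).trans ?_
      rw [Finset.sup_inf_distrib_left]
      refine Finset.sup_le fun l hl => (ha k (Finset.mem_insert_self _ _) l
        (Finset.mem_insert_of_mem hl) ?_).le
      rintro rfl
      exact hk hl
    rw [this, h.bot b hb, sub_zero]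

/-- Apply modularity to `x ⊓ t` and `y ⊓ s`: their meet is `x ⊓ s` and their join is below `y ⊓ t`.
This says that the mass of the layer between `s` and `t` is monotone, which makes each `muPhi`
monotone although it is a difference. -/
theorem IsIMeasure.sub_mono (h : IsIMeasure d m) (hb : IsIMin d b) {s t x y : A} (hst : s ≤ t)
    (hxy : x ≤ y) (hy : y ≤ b) : m (x ⊓ t) - m (x ⊓ s) ≤ m (y ⊓ t) - m (y ⊓ s) := by
  have h1 := h.modular b (x ⊓ t) (y ⊓ s) hb (inf_le_left.trans (hxy.trans hy))
    (inf_le_left.trans hy)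
  have h2 : x ⊓ t ⊓ (y ⊓ s) = x ⊓ s := by
    apply le_antisymm
    · exact inf_le_inf inf_le_left inf_le_right
    · exact le_inf (inf_le_inf_left _ hst) (inf_le_inf_right _ hxy)
  have h3 : m (x ⊓ t ⊔ y ⊓ s) ≤ m (y ⊓ t) :=
    h.mono b _ _ hb (sup_le (inf_le_inf_right _ hxy) (inf_le_inf_left _ hst))
      (inf_le_left.trans hy)
  rw [h2] at h1
  linarith

theorem IsIMeasure.modular_inf (h : IsIMeasure d m) (hb : IsIMin d b) (t : A) {x y : A}
    (hx : x ≤ b) (hy : y ≤ b) : m ((x ⊔ y) ⊓ t) = m (x ⊓ t) + m (y ⊓ t) - m (x ⊓ y ⊓ t) := by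
  rw [inf_sup_right, h.modular b _ _ hb (inf_le_left.trans hx) (inf_le_left.trans hy),
    ← inf_inf_distrib_right]

end Measure

/-! ### The premeasure of an update -/

/-- The semantic conditions on the values of the preconditions of an event structure. -/
structure PreGood {Ag : Type v} (F : EventFrame Ag) {A : Type} [HeytingAlgebra A]
    (a : Fin F.nPhi → A) : Prop where
  mono : ∀ k l, F.lt k l → a k ≤ a l
  disj : ∀ k l, k ≠ l → ¬ F.lt k l → ¬ F.lt l k → a k ⊓ a l = ⊥

section Premeasure

variable {AtProp : Type u} {Ag : Type v} {M : PreModel AtProp Ag} {F : EventFrame Ag}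
  {a : Fin F.nPhi → M.carrier} {i : Ag} {b : M.carrier}

open scoped Classical in
/-- The join of the values of the maximal preconditions below `k`. -/
def mbSup (M : PreModel AtProp Ag) (F : EventFrame Ag) (a : Fin F.nPhi → M.carrier)
    (k : Fin F.nPhi) : M.carrier :=
  (Finset.univ.filter fun l => F.IsMb k l).sup a

theorem mbSup_le (ha : PreGood F a) (k : Fin F.nPhi) : mbSup M F a k ≤ a k := by
  classical
  exact Finset.sup_le fun l hl => ha.mono _ _ (Finset.mem_filter.1 hl).2.1

/-- The elements of `mb(k)` are pairwise incomparable, so their values are disjoint and the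
subtracted sum is the measure of one join. -/
theorem muPhi_eq (hM : M.IsAPE) (ha : PreGood F a) (hb : IsIMin (M.dia i) b) (k : Fin F.nPhi)
    {x : M.carrier} (hx : x ≤ b) :
    muPhi M F a i k x = M.mu i (x ⊓ a k) - M.mu i (x ⊓ mbSup M F a k) := by
  classical
  unfold muPhi mbSup
  rw [← (hM.measure i).sum_eq hb _ _ _ hx]
  · intro l hl l' hl' hne
    simp only [Finset.mem_filter, Finset.mem_univ, true_and] at hl hl'
    exact ha.disj _ _ hne (hl.2 _ hl'.1) (hl'.2 _ hl.1)

theorem muPhi_bot (hM : M.IsAPE) (ha : PreGood F a) (hb : IsIMin (M.dia i) b) (k : Fin F.nPhi) :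
    muPhi M F a i k ⊥ = 0 := by
  rw [muPhi_eq hM ha hb k bot_le]
  simp

theorem muPhi_mono (hM : M.IsAPE) (ha : PreGood F a) (hb : IsIMin (M.dia i) b) (k : Fin F.nPhi)
    {x y : M.carrier} (hxy : x ≤ y) (hy : y ≤ b) : muPhi M F a i k x ≤ muPhi M F a i k y := by
  rw [muPhi_eq hM ha hb k hy, muPhi_eq hM ha hb k (hxy.trans hy)]
  exact (hM.measure i).sub_mono hb (mbSup_le ha k) hxy hy

theorem muPhi_modular (hM : M.IsAPE) (ha : PreGood F a) (hb : IsIMin (M.dia i) b)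
    (k : Fin F.nPhi) {x y : M.carrier} (hx : x ≤ b) (hy : y ≤ b) :
    muPhi M F a i k (x ⊔ y) =
      muPhi M F a i k x + muPhi M F a i k y - muPhi M F a i k (x ⊓ y) := by
  rw [muPhi_eq hM ha hb k hx, muPhi_eq hM ha hb k hy, muPhi_eq hM ha hb k (sup_le hx hy),
    muPhi_eq hM ha hb k (inf_le_left.trans hx), (hM.measure i).modular_inf hb _ hx hy,
    (hM.measure i).modular_inf hb _ hx hy]
  ring

/-- As `y` is covered by the preconditions relevant to `e`, one of them separates `x` from `y`.
Choose a `lt`-minimal such `k`: everything in `mb(k)` cuts `x` and `y` equally, so the subtracted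
parts coincide and strictness of the measure decides. -/
theorem exists_muPhi_lt (hM : M.IsAPE) (ha : PreGood F a) (hb : IsIMin (M.dia i) b)
    {e : Fin F.nE} {x y : M.carrier} (hxy : x < y) (hy : y ≤ b) (hye : y ≤ preBar M F a e) :
    ∃ k, F.pre k e ≠ 0 ∧ muPhi M F a i k x < muPhi M F a i k y := by
  classical
  let S : Set (Fin F.nPhi) := {k | F.pre k e ≠ 0 ∧ x ⊓ a k ≠ y ⊓ a k}
  have hS : S.Nonempty := by
    by_contra hne
    apply not_le_of_gt hxy
    rw [← inf_eq_left.2 hye, preBar, Finset.sup_inf_distrib_left]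
    refine Finset.sup_le fun k hk => ?_
    have : x ⊓ a k = y ⊓ a k := by
      by_contra h
      exact hne ⟨k, (Finset.mem_filter.1 hk).2, h⟩
    rw [← this]
    exact inf_le_left
  have : IsTrans _ F.lt := ⟨F.lt_trans⟩
  have : Std.Irrefl F.lt := ⟨F.lt_irrefl⟩
  have wf : WellFounded F.lt := Finite.wellFounded_of_trans_of_irrefl F.lt
  obtain ⟨k, hk, hmin⟩ := wf.has_min S hS
  refine ⟨k, hk.1, ?_⟩
  rw [muPhi_eq hM ha hb k hy, muPhi_eq hM ha hb k (hxy.le.trans hy)]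
  have h1 : x ⊓ mbSup M F a k = y ⊓ mbSup M F a k := by
    unfold mbSup
    rw [Finset.sup_inf_distrib_left, Finset.sup_inf_distrib_left]
    refine Finset.sup_congr rfl fun l hl => ?_
    have hlk := (Finset.mem_filter.1 hl).2.1
    by_contra h
    -- `pre_compat` keeps `l` relevant to `e`: if `pre(e | l)` vanished, so would `pre(e | k)`.
    exact hmin l ⟨fun h0 => hk.1 (F.pre_compat _ _ _ hlk h0), h⟩ hlk
  have h2 : M.mu i (x ⊓ a k) < M.mu i (y ⊓ a k) :=
    (hM.measure i).strict b _ _ hb (lt_of_le_of_ne (inf_le_inf_right _ hxy.le) hk.2)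
      (inf_le_left.trans hy)
  rw [h1]
  linarith

theorem prodMu_bot (hM : M.IsAPE) (ha : PreGood F a) (hb : IsIMin (M.dia i) b) :
    prodMu M F a i ⊥ = 0 := by
  simp [prodMu, muPhi_bot hM ha hb]

theorem prodMu_mono (hM : M.IsAPE) (ha : PreGood F a) (hb : IsIMin (M.dia i) b)
    {f g : Fin F.nE → M.carrier} (hfg : f ≤ g) (hg : ∀ e, g e ≤ b) :
    prodMu M F a i f ≤ prodMu M F a i g := by
  unfold prodMu
  refine Finset.sum_le_sum fun e _ => Finset.sum_le_sum fun k _ => ?_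
  have h1 : (0 : ℝ) ≤ F.P i e := by exact_mod_cast (F.P_pos i e).le
  have h2 : (0 : ℝ) ≤ F.pre k e := by exact_mod_cast F.pre_nonneg k e
  have := muPhi_mono hM ha hb k (hfg e) (hg e)
  gcongr

theorem prodMu_nonneg (hM : M.IsAPE) (ha : PreGood F a) (hb : IsIMin (M.dia i) b)
    {f : Fin F.nE → M.carrier} (hf : ∀ e, f e ≤ b) : 0 ≤ prodMu M F a i f := by
  rw [← prodMu_bot hM ha hb]
  exact prodMu_mono hM ha hb bot_le hf

theorem prodMu_modular (hM : M.IsAPE) (ha : PreGood F a) (hb : IsIMin (M.dia i) b)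
    {f g : Fin F.nE → M.carrier} (hf : ∀ e, f e ≤ b) (hg : ∀ e, g e ≤ b) :
    prodMu M F a i (f ⊔ g) =
      prodMu M F a i f + prodMu M F a i g - prodMu M F a i (f ⊓ g) := by
  unfold prodMu
  simp only [← Finset.sum_add_distrib, ← Finset.sum_sub_distrib]
  refine Finset.sum_congr rfl fun e _ => Finset.sum_congr rfl fun k _ => ?_
  rw [Pi.sup_apply, Pi.inf_apply, muPhi_modular hM ha hb k (hf e) (hg e)]
  ring

/-- All summands grow weakly, and the one supplied by `exists_muPhi_lt` grows strictly because its
factors `P` and `pre` are positive. The bound by `preBar` is needed: `prodMu` cannot see what lies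
outside it. -/
theorem prodMu_strict (hM : M.IsAPE) (ha : PreGood F a) (hb : IsIMin (M.dia i) b)
    {f g : Fin F.nE → M.carrier} (hfg : f < g) (hg : ∀ e, g e ≤ b) (hge : g ≤ preBar M F a) :
    prodMu M F a i f < prodMu M F a i g := by
  obtain ⟨hle, e, he⟩ := Pi.lt_def.1 hfg
  obtain ⟨k, hk, hlt⟩ := exists_muPhi_lt hM ha hb he (hg e) (hge e)
  have hterm : ∀ e k, (F.P i e : ℝ) * muPhi M F a i k (f e) * (F.pre k e : ℝ) ≤
      (F.P i e : ℝ) * muPhi M F a i k (g e) * (F.pre k e : ℝ) := fun e k => by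
    have h1 : (0 : ℝ) ≤ F.P i e := by exact_mod_cast (F.P_pos i e).le
    have h2 : (0 : ℝ) ≤ F.pre k e := by exact_mod_cast F.pre_nonneg k e
    have := muPhi_mono hM ha hb k (hle e) (hg e)
    gcongr
  unfold prodMu
  refine Finset.sum_lt_sum (fun e _ => Finset.sum_le_sum fun k _ => hterm e k)
    ⟨e, Finset.mem_univ _, Finset.sum_lt_sum (fun k _ => hterm e k) ⟨k, Finset.mem_univ _, ?_⟩⟩
  have h1 : (0 : ℝ) < F.P i e := by exact_mod_cast F.P_pos i e
  have h2 : (0 : ℝ) < F.pre k e := by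
    exact_mod_cast lt_of_le_of_ne (F.pre_nonneg k e) (Ne.symm hk)
  gcongr

theorem le_preBar {k : Fin F.nPhi} {e : Fin F.nE} (hk : F.pre k e ≠ 0) :
    a k ≤ preBar M F a e :=
  Finset.le_sup (Finset.mem_filter.2 ⟨Finset.mem_univ _, hk⟩)

/-- The members of `mb(k)` lie below `a k`, so only the part inside `a k` matters. -/
theorem muPhi_congr (ha : PreGood F a) {k : Fin F.nPhi} {x y : M.carrier}
    (h : x ⊓ a k = y ⊓ a k) : muPhi M F a i k x = muPhi M F a i k y := by
  classical
  unfold muPhi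
  rw [h]
  congr 1
  refine Finset.sum_congr rfl fun l hl => ?_
  have hl' := ha.mono _ _ (Finset.mem_filter.1 hl).2.1
  rw [← inf_eq_right.2 hl', ← inf_assoc, h, inf_assoc]

end Premeasure

/-! ### The updated algebra -/

section UpdateAlgebra

variable {AtProp : Type u} {Ag : Type v} {M : PreModel AtProp Ag} {F : EventFrame Ag}
  {a : Fin F.nPhi → M.carrier} {i : Ag}

/-- The join is the one of the Heyting algebra structure, written out because the quotient also
carries a bare `Max` instance; the two agree by definition. -/
theorem iota_sup_apply (x y : PseudoQuot (preBar M F a)) (e : Fin F.nE) :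
    (@max _ SemilatticeSup.toMax x y).iota e = x.iota e ⊔ y.iota e := congrFun (PseudoQuot.iota_sup x y) e

theorem iota_inf_apply (x y : PseudoQuot (preBar M F a)) (e : Fin F.nE) :
    (@min _ SemilatticeInf.toMin x y).iota e = x.iota e ⊓ y.iota e := congrFun (PseudoQuot.iota_inf x y) e

theorem iota_himp_apply (x y : PseudoQuot (preBar M F a)) (e : Fin F.nE) :
    (@himp _ GeneralizedHeytingAlgebra.toHImp x y).iota e = (x.iota e ⇨ y.iota e) ⊓ preBar M F a e :=
  congrFun (PseudoQuot.iota_himp x y) e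

theorem iota_bot_apply (e : Fin F.nE) :
    (⊥ : PseudoQuot (preBar M F a)).iota e = ⊥ := bot_inf_eq (preBar M F a e)

theorem iota_top_apply (e : Fin F.nE) :
    (⊤ : PseudoQuot (preBar M F a)).iota e = preBar M F a e := top_inf_eq (preBar M F a e)

theorem iota_le_pre (x : PseudoQuot (preBar M F a)) (e : Fin F.nE) :
    x.iota e ≤ preBar M F a e := PseudoQuot.iota_le x e

theorem iota_compl_apply (x : PseudoQuot (preBar M F a)) (e : Fin F.nE) :
    (xᶜ).iota e = (x.iota e)ᶜ ⊓ preBar M F a e := by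
  rw [← himp_bot x, iota_himp_apply, iota_bot_apply, himp_bot]

theorem iota_dia_apply (x : PseudoQuot (preBar M F a)) (e : Fin F.nE) :
    (PseudoQuot.dia (prodDia M F i) x).iota e =
      prodDia M F i x.iota e ⊓ preBar M F a e := by
  induction x using Quotient.inductionOn
  rfl

theorem pre_himp_inf (p x : M.carrier) : p ⇨ (x ⊓ p) = p ⇨ x := by
  rw [himp_inf_distrib, himp_self, inf_top_eq]

theorem iota_box_apply (x : PseudoQuot (preBar M F a)) (e : Fin F.nE) :
    (PseudoQuot.box (prodBox M F i) x).iota e =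
      prodBox M F i (fun e' => preBar M F a e' ⇨ x.iota e') e ⊓ preBar M F a e := by
  induction x using Quotient.inductionOn with
  | _ f =>
    have : (fun e' => preBar M F a e' ⇨ (f e' ⊓ preBar M F a e')) = preBar M F a ⇨ f := by
      funext e'
      exact pre_himp_inf _ _
    show prodBox M F i (preBar M F a ⇨ f) e ⊓ _ =
      prodBox M F i (fun e' => preBar M F a e' ⇨ (f e' ⊓ preBar M F a e')) e ⊓ _
    rw [this]

theorem prodDia_le_iff {f : Fin F.nE → M.carrier} {e : Fin F.nE} {c : M.carrier} :
    prodDia M F i f e ≤ c ↔ ∀ e', (F.sim i).r e' e → M.dia i (f e') ≤ c := by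
  classical
  simp [prodDia]

theorem le_prodBox_iff {f : Fin F.nE → M.carrier} {e : Fin F.nE} {c : M.carrier} :
    c ≤ prodBox M F i f e ↔ ∀ e', (F.sim i).r e' e → c ≤ M.box i (f e') := by
  classical
  simp [prodBox]

theorem iota_dia_le_iff {x : PseudoQuot (preBar M F a)} {e : Fin F.nE} {c : M.carrier} :
    (PseudoQuot.dia (prodDia M F i) x).iota e ≤ c ↔
      ∀ e', (F.sim i).r e' e → M.dia i (x.iota e') ⊓ preBar M F a e ≤ c := by
  rw [iota_dia_apply, ← le_himp_iff, prodDia_le_iff]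
  simp only [le_himp_iff]

theorem le_iota_dia {x : PseudoQuot (preBar M F a)} {e e' : Fin F.nE}
    (h : (F.sim i).r e' e) : M.dia i (x.iota e') ⊓ preBar M F a e ≤
      (PseudoQuot.dia (prodDia M F i) x).iota e := iota_dia_le_iff.1 le_rfl e' h

theorem le_iota_box_iff {x : PseudoQuot (preBar M F a)} {e : Fin F.nE} {c : M.carrier} :
    c ≤ (PseudoQuot.box (prodBox M F i) x).iota e ↔ c ≤ preBar M F a e ∧
      ∀ e', (F.sim i).r e' e → c ≤ M.box i (preBar M F a e' ⇨ x.iota e') := by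
  rw [iota_box_apply, le_inf_iff, le_prodBox_iff, and_comm]

theorem iota_box_le {x : PseudoQuot (preBar M F a)} {e e' : Fin F.nE} (h : (F.sim i).r e' e) :
    (PseudoQuot.box (prodBox M F i) x).iota e ≤ M.box i (preBar M F a e' ⇨ x.iota e') :=
  (le_iota_box_iff.1 le_rfl).2 e' h

/-- Each law is checked one event at a time through `iota_dia_le_iff` and `le_iota_box_iff`, which
reduce it to the same law in `M`. Reflexivity of `∼_i` gives M1 and M2; symmetry and transitivity
give M5 and M6. -/
theorem update_isMonadic (hM : M.IsAPE) :
    IsMonadic (PseudoQuot.dia (a := preBar M F a) (prodDia M F i))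
      (PseudoQuot.box (prodBox M F i)) where
  dia_mono x y h e := iota_dia_le_iff.2 fun e' he =>
    (inf_le_inf_right _ ((hM.monadic i).dia_mono (h e'))).trans (le_iota_dia he)
  box_mono x y h e := le_iota_box_iff.2 ⟨iota_le_pre _ _, fun e' he =>
    (iota_box_le he).trans ((hM.monadic i).box_mono (himp_le_himp_left (h e')))⟩
  M1 x e := (le_inf ((hM.monadic i).M1 _) (iota_le_pre x e)).trans
    (le_iota_dia ((F.sim i).refl e))
  M2 x e := by
    have h1 := (iota_box_le (x := x) ((F.sim i).refl e)).trans ((hM.monadic i).M2 _)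
    have h2 := le_inf h1 (iota_le_pre (PseudoQuot.box (prodBox M F i) x) e)
    rw [himp_inf_self] at h2
    exact h2.trans inf_le_left
  M3 x y e := by
    refine iota_dia_le_iff.2 fun e' he => ?_
    rw [iota_sup_apply, iota_sup_apply]
    refine (inf_le_inf_right _ ((hM.monadic i).M3 _ _)).trans ?_
    rw [inf_sup_right]
    exact sup_le_sup (le_iota_dia he) (le_iota_dia he)
  M4 x y := by
    rw [le_himp_iff]
    intro e
    rw [iota_inf_apply]
    refine le_iota_box_iff.2 ⟨inf_le_left.trans (iota_le_pre _ _), fun e' he => ?_⟩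
    refine (inf_le_inf (iota_box_le he) (iota_box_le he)).trans ?_
    rw [← le_himp_iff]
    refine ((hM.monadic i).box_mono ?_).trans ((hM.monadic i).M4 _ _)
    rw [iota_himp_apply, pre_himp_inf, le_himp_iff, le_himp_iff]
    refine le_trans ?_ (himp_inf_le (a := x.iota e') (b := y.iota e'))
    refine le_inf ?_ ?_
    · exact (inf_le_inf_right _ inf_le_left).trans himp_inf_le
    · exact (inf_le_inf_right _ inf_le_right).trans himp_inf_le
  M5 x e := by
    refine le_iota_box_iff.2 ⟨iota_le_pre _ _, fun e' he => ?_⟩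
    refine iota_dia_le_iff.2 fun e'' he'' => inf_le_left.trans ?_
    rw [← (hM.monadic i).box_dia]
    refine (hM.monadic i).box_mono ?_
    rw [le_himp_iff]
    exact le_iota_dia ((F.sim i).trans he'' ((F.sim i).symm he))
  M6 x e := by
    refine iota_dia_le_iff.2 fun e' he => ?_
    refine le_iota_box_iff.2 ⟨inf_le_right, fun e'' he'' => inf_le_left.trans ?_⟩
    refine ((hM.monadic i).dia_mono
      (iota_box_le ((F.sim i).trans he'' ((F.sim i).symm he)))).trans ?_
    exact (hM.monadic i).M6 _
  M7 x y := by
    rw [le_himp_iff]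
    intro e
    rw [iota_inf_apply, inf_comm, ← le_himp_iff, iota_dia_le_iff]
    intro e' he
    rw [le_himp_iff]
    refine (le_inf (le_inf (inf_le_right.trans (iota_box_le he)) (inf_le_left.trans inf_le_left))
      (inf_le_left.trans inf_le_right)).trans
      (le_trans (inf_le_inf_right _ ?_) (le_iota_dia he))
    rw [← le_himp_iff]
    refine ((hM.monadic i).box_mono ?_).trans ((hM.monadic i).M7 _ _)
    -- Since `x` lies below the precondition, `pre → (x → y)` is just `x → y`.
    rw [iota_himp_apply, pre_himp_inf, himp_himp, inf_eq_right.2 (iota_le_pre x e')]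
  M8 e := by
    refine iota_dia_le_iff.2 fun e' _ => ?_
    rw [iota_bot_apply, iota_bot_apply]
    exact inf_le_left.trans (hM.monadic i).M8
  M9 e := by
    refine le_iota_box_iff.2 ⟨iota_le_pre _ _, fun e' _ => ?_⟩
    rw [iota_top_apply, iota_top_apply, himp_self]
    exact le_top.trans (hM.monadic i).M9

theorem dia_prodDia (hM : M.IsAPE) (f : Fin F.nE → M.carrier) (e : Fin F.nE) :
    M.dia i (prodDia M F i f e) = prodDia M F i f e := by
  classical
  exact Finset.sup_induction (p := fun x => M.dia i x = x) (hM.monadic i).dia_bot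
    (fun _ h _ h' => (hM.monadic i).dia_sup h h') fun _ _ => (hM.monadic i).dia_dia _

/-- Each value of `prodDia` is fixed by `◇` of `M`, hence complemented there; cutting down to the
precondition preserves this. -/
theorem update_epistemic (hM : M.IsAPE) (x : PseudoQuot (preBar M F a)) :
    @max _ SemilatticeSup.toMax (PseudoQuot.dia (prodDia M F i) x)
      (PseudoQuot.dia (prodDia M F i) x)ᶜ = ⊤ := by
  refine top_le_iff.1 fun e => ?_
  rw [iota_top_apply, iota_sup_apply, iota_compl_apply, iota_dia_apply]
  have h := hM.epistemic i (prodDia M F i x.iota e)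
  rw [dia_prodDia hM] at h
  calc preBar M F a e = (prodDia M F i x.iota e ⊔ (prodDia M F i x.iota e)ᶜ) ⊓ preBar M F a e := by
        rw [h, top_inf_eq]
    _ ≤ _ := by
      rw [inf_sup_right]
      exact sup_le_sup_left (inf_le_inf_right _ (compl_le_compl inf_le_left)) _

/-! The blocks of the updated algebra. -/

open scoped Classical in
/-- The block of the updated algebra given by the block `b` and the class of the event `e₀`. -/
def updBlock (M : PreModel AtProp Ag) (F : EventFrame Ag) (a : Fin F.nPhi → M.carrier) (i : Ag)
    (b : M.carrier) (e₀ : Fin F.nE) : PseudoQuot (preBar M F a) :=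
  PseudoQuot.mk _ fun e => if (F.sim i).r e e₀ then b else ⊥

theorem iota_updBlock_of_sim {b : M.carrier} {e e₀ : Fin F.nE} (h : (F.sim i).r e e₀) :
    (updBlock M F a i b e₀).iota e = b ⊓ preBar M F a e := by
  classical
  show (if (F.sim i).r e e₀ then b else ⊥) ⊓ preBar M F a e = _
  rw [if_pos h]

theorem iota_updBlock_of_not_sim {b : M.carrier} {e e₀ : Fin F.nE} (h : ¬ (F.sim i).r e e₀) :
    (updBlock M F a i b e₀).iota e = ⊥ := by
  classical
  show (if (F.sim i).r e e₀ then b else ⊥) ⊓ preBar M F a e = _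
  rw [if_neg h, bot_inf_eq]

theorem iota_updBlock_le (b : M.carrier) (e e₀ : Fin F.nE) :
    (updBlock M F a i b e₀).iota e ≤ b := by
  by_cases h : (F.sim i).r e e₀
  · rw [iota_updBlock_of_sim h]; exact inf_le_left
  · rw [iota_updBlock_of_not_sim h]; exact bot_le

theorem updBlock_congr (b : M.carrier) {e e₀ : Fin F.nE} (h : (F.sim i).r e e₀) :
    updBlock M F a i b e = updBlock M F a i b e₀ := by
  classical
  unfold updBlock
  congr 1
  funext e'
  exact if_congr ⟨fun h' => (F.sim i).trans h' h,
    fun h' => (F.sim i).trans h' ((F.sim i).symm h)⟩ rfl rfl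

/-- If `b` meets `y` at `e₀` then `b ≤ ◇(y e₀)`, and fixedness of `y` spreads this to every event of
the class of `e₀`. -/
theorem updBlock_le_of_fixed (hM : M.IsAPE) {b : M.carrier} (hb : IsIMin (M.dia i) b)
    {e₀ : Fin F.nE} {y : PseudoQuot (preBar M F a)}
    (hy : PseudoQuot.dia (prodDia M F i) y = y) (h : b ⊓ y.iota e₀ ≠ ⊥) :
    updBlock M F a i b e₀ ≤ y := by
  intro e
  by_cases he : (F.sim i).r e e₀
  · change (updBlock M F a i b e₀).iota e ≤ y.iota e
    rw [iota_updBlock_of_sim he, ← hy]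
    exact (inf_le_inf_right _ (hb.le_dia (hM.monadic i) h)).trans
      (le_iota_dia ((F.sim i).symm he))
  · change (updBlock M F a i b e₀).iota e ≤ y.iota e
    rw [iota_updBlock_of_not_sim he]
    exact bot_le

theorem updBlock_ne_bot {b : M.carrier} {e₀ : Fin F.nE}
    (h : b ⊓ preBar M F a e₀ ≠ ⊥) : updBlock M F a i b e₀ ≠ ⊥ := by
  intro h'
  apply h
  rw [← iota_updBlock_of_sim (i := i) ((F.sim i).refl e₀), h', iota_bot_apply]

theorem dia_updBlock (hM : M.IsAPE) {b : M.carrier} (hb : IsIMin (M.dia i) b)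
    (e₀ : Fin F.nE) :
    PseudoQuot.dia (prodDia M F i) (updBlock M F a i b e₀) = updBlock M F a i b e₀ := by
  refine le_antisymm (fun e => iota_dia_le_iff.2 fun e' he => ?_)
    ((update_isMonadic (i := i) hM).M1 _)
  by_cases h : (F.sim i).r e e₀
  · rw [iota_updBlock_of_sim h]
    exact inf_le_inf_right _ (((hM.monadic i).dia_le_iff hb.2.1).2 (iota_updBlock_le _ _ _))
  · rw [iota_updBlock_of_not_sim h,
      iota_updBlock_of_not_sim fun h' => h ((F.sim i).trans ((F.sim i).symm he) h'),
      (hM.monadic i).dia_bot]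
    exact inf_le_left

theorem exists_updBlock_le (hM : M.IsAPE) {y : PseudoQuot (preBar M F a)} (h0 : y ≠ ⊥)
    (hy : PseudoQuot.dia (prodDia M F i) y = y) :
    ∃ b e₀, IsIMin (M.dia i) b ∧ b ⊓ y.iota e₀ ≠ ⊥ ∧ updBlock M F a i b e₀ ≤ y := by
  obtain ⟨e₀, he⟩ : ∃ e, y.iota e ≠ ⊥ := by
    by_contra! h
    exact h0 (le_bot_iff.1 fun e => (h e).le.trans bot_le)
  obtain ⟨b, hb, hbe⟩ := exists_iMin_inf_ne (hM.monadic i) he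
  exact ⟨b, e₀, hb, hbe, updBlock_le_of_fixed hM hb hy hbe⟩

theorem inf_pre_ne_of_inf_iota_ne {b : M.carrier} {e : Fin F.nE}
    {y : PseudoQuot (preBar M F a)} (h : b ⊓ y.iota e ≠ ⊥) : b ⊓ preBar M F a e ≠ ⊥ :=
  fun h' => h (le_bot_iff.1 ((inf_le_inf_left _ (iota_le_pre y e)).trans h'.le))

/-- A nonzero fixed element below this one contains some `updBlock` by `exists_updBlock_le`. Being
below forces the same block `b` and an equivalent event, so that `updBlock` is the given one. -/
theorem isIMin_updBlock (hM : M.IsAPE) {b : M.carrier} (hb : IsIMin (M.dia i) b)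
    {e₀ : Fin F.nE} (h : b ⊓ preBar M F a e₀ ≠ ⊥) :
    IsIMin (PseudoQuot.dia (prodDia M F i)) (updBlock M F a i b e₀) := by
  refine ⟨updBlock_ne_bot h, dia_updBlock hM hb e₀, fun w hw hdw => ?_⟩
  by_contra h0
  obtain ⟨b', e₁, hb', hbe, hle⟩ := exists_updBlock_le hM h0 hdw
  apply not_le_of_gt hw
  have hwe : w.iota e₁ ≤ (updBlock M F a i b e₀).iota e₁ := hw.le e₁
  have hsim : (F.sim i).r e₁ e₀ := by
    by_contra hns
    rw [iota_updBlock_of_not_sim hns, le_bot_iff] at hwe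
    exact hbe (by rw [hwe, inf_bot_eq])
  have hbb : b' = b := hb'.eq_of_inf_ne (hM.monadic i) hb fun h' => hbe (le_bot_iff.1
    ((inf_le_inf_left _ (hwe.trans (iota_updBlock_le _ _ _))).trans h'.le))
  rwa [← updBlock_congr b hsim, ← hbb]

/-- With `isIMin_updBlock` this classifies the blocks of the update: they are the pairs of a block
and an event class whose precondition the block meets. -/
theorem exists_eq_updBlock (hM : M.IsAPE) {y : PseudoQuot (preBar M F a)}
    (hy : IsIMin (PseudoQuot.dia (prodDia M F i)) y) :
    ∃ b e₀, IsIMin (M.dia i) b ∧ b ⊓ preBar M F a e₀ ≠ ⊥ ∧ y = updBlock M F a i b e₀ := by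
  obtain ⟨b, e₀, hb, hbe, hle⟩ := exists_updBlock_le hM hy.1 hy.2.1
  have hne := inf_pre_ne_of_inf_iota_ne hbe
  refine ⟨b, e₀, hb, hne, le_antisymm ?_ hle⟩
  by_contra h
  exact updBlock_ne_bot hne (hy.2.2 _ (lt_of_le_not_ge hle h) (dia_updBlock hM hb e₀))

theorem iMin_bound (hM : M.IsAPE) {y : PseudoQuot (preBar M F a)}
    (hy : IsIMin (PseudoQuot.dia (prodDia M F i)) y) :
    ∃ b, IsIMin (M.dia i) b ∧ ∀ e, y.iota e ≤ b := by
  obtain ⟨b, e₀, hb, -, rfl⟩ := exists_eq_updBlock hM hy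
  exact ⟨b, hb, fun e => iota_updBlock_le _ _ _⟩

theorem prodMu_iota_lt (hM : M.IsAPE) (ha : PreGood F a) {y : PseudoQuot (preBar M F a)}
    (hy : IsIMin (PseudoQuot.dia (prodDia M F i)) y) {x z : PseudoQuot (preBar M F a)}
    (hxz : x < z) (hz : z ≤ y) : prodMu M F a i x.iota < prodMu M F a i z.iota := by
  obtain ⟨b, hb, hbd⟩ := iMin_bound hM hy
  exact prodMu_strict hM ha hb hxz (fun e => (hz e).trans (hbd e)) (iota_le_pre z)

theorem prodMu_iota_bot (hM : M.IsAPE) (ha : PreGood F a) {y : PseudoQuot (preBar M F a)}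
    (hy : IsIMin (PseudoQuot.dia (prodDia M F i)) y) :
    prodMu M F a i (⊥ : PseudoQuot (preBar M F a)).iota = 0 := by
  obtain ⟨b, hb, -⟩ := iMin_bound hM hy
  rw [← prodMu_bot hM ha hb]
  congr 1
  funext e
  exact iota_bot_apply e

theorem prodMu_iota_pos (hM : M.IsAPE) (ha : PreGood F a) {y : PseudoQuot (preBar M F a)}
    (hy : IsIMin (PseudoQuot.dia (prodDia M F i)) y) : 0 < prodMu M F a i y.iota := by
  rw [← prodMu_iota_bot hM ha hy]
  exact prodMu_iota_lt hM ha hy (bot_lt_iff_ne_bot.2 hy.1) le_rfl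

/-- A nonzero element lies below at most one block, so the choice made in `updMu` is harmless; at
`⊥` the premeasure is zero, so that case needs no separate formula. -/
theorem updMu_eq (hM : M.IsAPE) (ha : PreGood F a) {x y : PseudoQuot (preBar M F a)}
    (hy : IsIMin (PseudoQuot.dia (prodDia M F i)) y) (hxy : x ≤ y) :
    updMu M F a i x = prodMu M F a i x.iota / prodMu M F a i y.iota := by
  unfold updMu
  split_ifs with h0 h
  · rw [h0, prodMu_iota_bot hM ha hy, zero_div]
  · have : h.choose = y := h.choose_spec.1.eq_of_inf_ne (update_isMonadic hM) hy fun h' =>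
      h0 (le_bot_iff.1 ((le_inf h.choose_spec.2 hxy).trans h'.le))
    rw [this]
  · exact absurd ⟨y, hy, hxy⟩ h

/-- Below a fixed block the measure is the premeasure over one positive denominator, so each law is
inherited from `prodMu`. -/
theorem update_isIMeasure (hM : M.IsAPE) (ha : PreGood F a) :
    IsIMeasure (PseudoQuot.dia (prodDia M F i)) (updMu M F a i) where
  nonneg y x hy hx := by
    rw [updMu_eq hM ha hy hx]
    obtain ⟨b, hb, hbd⟩ := iMin_bound hM hy
    exact div_nonneg (prodMu_nonneg hM ha hb fun e => (hx e).trans (hbd e))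
      (prodMu_iota_pos hM ha hy).le
  mono y x z hy hxz hz := by
    rw [updMu_eq hM ha hy hz, updMu_eq hM ha hy (hxz.trans hz)]
    obtain ⟨b, hb, hbd⟩ := iMin_bound hM hy
    exact div_le_div_of_nonneg_right (prodMu_mono hM ha hb hxz fun e => (hz e).trans (hbd e))
      (prodMu_iota_pos hM ha hy).le
  modular y x z hy hx hz := by
    rw [updMu_eq hM ha hy hz, updMu_eq hM ha hy hx, updMu_eq hM ha hy (sup_le hx hz),
      updMu_eq hM ha hy (inf_le_left.trans hx), ← add_div, ← sub_div]
    obtain ⟨b, hb, hbd⟩ := iMin_bound hM hy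
    congr 1
    exact (congrArg _ (PseudoQuot.iota_sup x z)).trans ((prodMu_modular hM ha hb
      (fun e => (hx e).trans (hbd e)) fun e => (hz e).trans (hbd e)).trans
      (congrArg (fun w => _ - prodMu M F a i w) (PseudoQuot.iota_inf x z).symm))
  bot y _ := if_pos rfl
  strict y x z hy hxz hz := by
    rw [updMu_eq hM ha hy hz, updMu_eq hM ha hy (hxz.le.trans hz)]
    exact div_lt_div_of_pos_right (prodMu_iota_lt hM ha hy hxz hz) (prodMu_iota_pos hM ha hy)
  one y hy := by
    rw [updMu_eq hM ha hy le_rfl, div_self (prodMu_iota_pos hM ha hy).ne']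

/-- The update of an APE-model is an APE-model. -/
theorem update_isAPE (hM : M.IsAPE) (ha : PreGood F a) (s : Fin F.nE → AtProp → M.carrier) :
    (update M F a s).IsAPE where
  monadic _ := update_isMonadic hM
  epistemic _ := update_epistemic hM
  measure _ := update_isIMeasure hM ha

end UpdateAlgebra

/-! ### Values of formulas -/

section Values

variable {AtProp : Type u} {Ag : Type v}

/-- The value of the term `t` of agent `i` on the block `b`. -/
def termVal (M : PreModel AtProp Ag) (i : Ag) (t : List (ℚ × Fml AtProp Ag)) (b : M.carrier) : ℝ :=
  (t.map fun x => (x.1 : ℝ) * M.mu i (eval x.2 M ⊓ b)).sum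

theorem eval_ge (M : PreModel AtProp Ag) (i : Ag) (t : List (ℚ × Fml AtProp Ag)) (β : ℚ) :
    eval (ge i t β) M = blockSup (M.dia i) fun b => (β : ℝ) ≤ termVal M i t b := by
  unfold ge
  simp only [eval, blockSup]
  congr 1
  ext b
  simp only [Set.mem_ofPred_eq, termVal]
  rw [← Fin.sum_univ_fun_getElem]
  rfl

theorem termVal_append (M : PreModel AtProp Ag) (i : Ag) (t t' : List (ℚ × Fml AtProp Ag))
    (b : M.carrier) : termVal M i (t ++ t') b = termVal M i t b + termVal M i t' b := by
  simp [termVal]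

theorem termVal_cons (M : PreModel AtProp Ag) (i : Ag) (x : ℚ × Fml AtProp Ag)
    (t : List (ℚ × Fml AtProp Ag)) (b : M.carrier) :
    termVal M i (x :: t) b = (x.1 : ℝ) * M.mu i (eval x.2 M ⊓ b) + termVal M i t b := by
  simp [termVal]

theorem termVal_nil (M : PreModel AtProp Ag) (i : Ag) (b : M.carrier) :
    termVal M i [] b = 0 := by
  simp [termVal]

theorem termVal_smulTerm (M : PreModel AtProp Ag) (i : Ag) (d : ℚ)
    (t : List (ℚ × Fml AtProp Ag)) (b : M.carrier) :
    termVal M i (smulTerm d t) b = d * termVal M i t b := by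
  induction t with
  | nil => simp [termVal, smulTerm]
  | cons x t ih =>
    have : smulTerm d (x :: t) = (d * x.1, x.2) :: smulTerm d t := rfl
    rw [this, termVal_cons, termVal_cons, ih]
    push_cast
    ring

theorem termVal_flatMap (M : PreModel AtProp Ag) (i : Ag) {ι : Type*} (l : List ι)
    (f : ι → List (ℚ × Fml AtProp Ag)) (b : M.carrier) :
    termVal M i (l.flatMap f) b = (l.map fun x => termVal M i (f x) b).sum := by
  induction l with
  | nil => simp [termVal]
  | cons x l ih => rw [List.flatMap_cons, termVal_append, ih]; simp

theorem sum_map_filter_finRange {n : ℕ} (p : Fin n → Prop) [DecidablePred p] (f : Fin n → ℝ) :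
    (((List.finRange n).filter fun k => decide (p k)).map f).sum =
      ∑ k ∈ Finset.univ.filter p, f k := by
  rw [← List.sum_toFinset f ((List.nodup_finRange n).filter _), List.toFinset_filter]
  simp

theorem termVal_muPhiTerm (M : PreModel AtProp Ag) (F : EventFrame Ag)
    (Φ : Fin F.nPhi → Fml AtProp Ag) (i : Ag) (k : Fin F.nPhi) (c : ℚ) (χ : Fml AtProp Ag)
    (b : M.carrier) : termVal M i (muPhiTerm F Φ k c χ) b =
      c * muPhi M F (fun k => eval (Φ k) M) i k (eval χ M ⊓ b) := by
  classical
  unfold muPhiTerm muPhi mbList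
  rw [termVal_cons]
  simp only [termVal, List.map_map, Function.comp_def, eval]
  rw [sum_map_filter_finRange]
  simp only [inf_right_comm (eval χ M)]
  push_cast
  rw [mul_sub, Finset.mul_sum]
  simp only [neg_mul, Finset.sum_neg_distrib]
  ring

open scoped Classical in
theorem termVal_updTerm (M : PreModel AtProp Ag) (F : EventFrame Ag)
    (Φ : Fin F.nPhi → Fml AtProp Ag) (i : Ag) (e : Fin F.nE) (c : ℚ)
    (χ : Fin F.nE → Fml AtProp Ag) (b : M.carrier) : termVal M i (updTerm F Φ i e c χ) b =
      c * ∑ e' ∈ Finset.univ.filter (fun e' => (F.sim i).r e' e), ∑ k,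
        (F.P i e' : ℝ) * muPhi M F (fun k => eval (Φ k) M) i k (eval (χ e') M ⊓ b) * F.pre k e' := by
  unfold updTerm simList
  rw [termVal_flatMap, sum_map_filter_finRange, Finset.mul_sum]
  refine Finset.sum_congr rfl fun e' _ => ?_
  rw [termVal_flatMap]
  simp only [termVal_muPhiTerm]
  rw [← List.ofFn_eq_map, List.sum_ofFn, Finset.mul_sum]
  refine Finset.sum_congr rfl fun k _ => ?_
  push_cast
  ring

theorem eval_bigOr_le_iff {M : PreModel AtProp Ag} {l : List (Fml AtProp Ag)} {c : M.carrier} :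
    eval (bigOr l) M ≤ c ↔ ∀ φ ∈ l, eval φ M ≤ c := by
  induction l with
  | nil => simp [bigOr, eval]
  | cons φ l ih => simp [bigOr, eval, ih]

theorem le_eval_bigAnd_iff {M : PreModel AtProp Ag} {l : List (Fml AtProp Ag)} {c : M.carrier} :
    c ≤ eval (bigAnd l) M ↔ ∀ φ ∈ l, c ≤ eval φ M := by
  induction l with
  | nil => simp [bigAnd, eval, top]
  | cons φ l ih => simp [bigAnd, eval, ih]

theorem eval_top (M : PreModel AtProp Ag) : eval top M = ⊤ := by simp [top, eval]

theorem eval_preFml (M : PreModel AtProp Ag) (F : EventFrame Ag) (Φ : Fin F.nPhi → Fml AtProp Ag)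
    (e : Fin F.nE) : eval (preFml F Φ e) M = preBar M F (fun k => eval (Φ k) M) e := by
  refine eq_of_forall_ge_iff fun c => ?_
  unfold preFml preBar
  rw [eval_bigOr_le_iff]
  simp

theorem mem_simList {F : EventFrame Ag} {i : Ag} {e e' : Fin F.nE} :
    e' ∈ simList F i e ↔ (F.sim i).r e' e := by
  classical
  simp [simList]

theorem eval_iff_eq_top {M : PreModel AtProp Ag} {φ ψ : Fml AtProp Ag} :
    eval (iff φ ψ) M = ⊤ ↔ eval φ M = eval ψ M := by
  simp only [Fml.iff, eval, inf_eq_top_iff, himp_eq_top_iff]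
  exact ⟨fun h => le_antisymm h.1 h.2, fun h => ⟨h.le, h.ge⟩⟩

/-- The value of `φ` in the updated model at the event `e`. -/
def updVal (F : EventFrame Ag) (Φ : Fin F.nPhi → Fml AtProp Ag)
    (sub : Fin F.nE → AtProp → Fml AtProp Ag) (M : PreModel AtProp Ag) (φ : Fml AtProp Ag)
    (e : Fin F.nE) : M.carrier :=
  PseudoQuot.iota (a := preBar M F fun k => eval (Φ k) M)
    (eval φ (update M F (fun k => eval (Φ k) M) fun f p => eval (sub f p) M)) e

variable {M : PreModel AtProp Ag} {F : EventFrame Ag} {Φ : Fin F.nPhi → Fml AtProp Ag}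
  {sub : Fin F.nE → AtProp → Fml AtProp Ag} {φ ψ : Fml AtProp Ag} {e : Fin F.nE} {i : Ag}

theorem eval_upDia : eval (upDia F Φ sub e φ) M = updVal F Φ sub M φ e := by
  simp only [eval]
  exact inf_eq_right.2 (iota_le_pre _ _)

theorem eval_upBox : eval (upBox F Φ sub e φ) M =
    eval (preFml F Φ e) M ⇨ updVal F Φ sub M φ e := by
  rw [eval_preFml]
  simp only [eval]
  rfl

theorem updVal_le : updVal F Φ sub M φ e ≤ eval (preFml F Φ e) M := by
  rw [eval_preFml]
  exact iota_le_pre _ _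

theorem updVal_atom (p : AtProp) : updVal F Φ sub M (atom p) e =
    eval (sub e p) M ⊓ eval (preFml F Φ e) M := by
  rw [eval_preFml]
  simp only [updVal, eval]
  rfl

theorem updVal_bot : updVal F Φ sub M bot e = ⊥ := by
  simp only [updVal, eval]
  exact iota_bot_apply e

theorem updVal_conj : updVal F Φ sub M (conj φ ψ) e =
    updVal F Φ sub M φ e ⊓ updVal F Φ sub M ψ e := by
  simp only [updVal, eval]
  exact iota_inf_apply _ _ e

theorem updVal_disj : updVal F Φ sub M (disj φ ψ) e =
    updVal F Φ sub M φ e ⊔ updVal F Φ sub M ψ e := by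
  simp only [updVal, eval]
  exact iota_sup_apply _ _ e

theorem updVal_impl : updVal F Φ sub M (impl φ ψ) e =
    (updVal F Φ sub M φ e ⇨ updVal F Φ sub M ψ e) ⊓ eval (preFml F Φ e) M := by
  rw [eval_preFml]
  simp only [updVal, eval]
  exact iota_himp_apply _ _ e

theorem updVal_dia : updVal F Φ sub M (dia i φ) e =
    eval (bigOr ((simList F i e).map fun e' => dia i (upDia F Φ sub e' φ))) M ⊓
      eval (preFml F Φ e) M := by
  have h : eval (bigOr ((simList F i e).map fun e' => dia i (upDia F Φ sub e' φ))) M =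
      prodDia M F i (updVal F Φ sub M φ) e := by
    refine eq_of_forall_ge_iff fun c => ?_
    rw [eval_bigOr_le_iff, prodDia_le_iff]
    simp only [List.forall_mem_map, mem_simList]
    refine forall₂_congr fun e' _ => ?_
    rw [eval, eval_upDia]
  rw [h, eval_preFml]
  conv_lhs => simp only [updVal, eval]
  exact iota_dia_apply _ e

theorem updVal_box : updVal F Φ sub M (box i φ) e =
    eval (bigAnd ((simList F i e).map fun e' => box i (upBox F Φ sub e' φ))) M ⊓
      eval (preFml F Φ e) M := by
  have h : eval (bigAnd ((simList F i e).map fun e' => box i (upBox F Φ sub e' φ))) M =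
      prodBox M F i (fun e' => preBar M F (fun k => eval (Φ k) M) e' ⇨
        updVal F Φ sub M φ e') e := by
    refine eq_of_forall_le_iff fun c => ?_
    rw [le_eval_bigAnd_iff, le_prodBox_iff]
    simp only [List.forall_mem_map, mem_simList]
    refine forall₂_congr fun e' _ => ?_
    rw [eval, eval_upBox, eval_preFml]
  rw [h, eval_preFml]
  conv_lhs => simp only [updVal, eval]
  exact iota_box_apply _ e

/-- This explains the box in the reduction axiom for inequalities: inside a precondition relevant to
`e'`, the elements `x` and `pre(e') → x` coincide, and `muPhi` looks only inside that precondition.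
-/
theorem prodMu_inf_updBlock (hM : M.IsAPE) {a : Fin F.nPhi → M.carrier}
    (ha : PreGood F a) {b : M.carrier} (hb : IsIMin (M.dia i) b) (e : Fin F.nE)
    (x : PseudoQuot (preBar M F a)) : (open scoped Classical in
    prodMu M F a i (@min _ SemilatticeInf.toMin x (updBlock M F a i b e)).iota =
      ∑ e' ∈ Finset.univ.filter (fun e' => (F.sim i).r e' e), ∑ k,
        (F.P i e' : ℝ) * muPhi M F a i k ((preBar M F a e' ⇨ x.iota e') ⊓ b) * F.pre k e') := by
  classical
  unfold prodMu
  rw [Finset.sum_filter]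
  refine Finset.sum_congr rfl fun e' _ => ?_
  split_ifs with h
  · refine Finset.sum_congr rfl fun k _ => ?_
    -- `a k ≤ pre(e')` is available only when `pre(e' | k) ≠ 0`; otherwise the summand vanishes.
    by_cases hk : F.pre k e' = 0
    · rw [hk]; simp
    congr 2
    apply muPhi_congr ha
    rw [iota_inf_apply, iota_updBlock_of_sim h]
    apply le_antisymm
    · exact inf_le_inf_right _ (inf_le_inf le_himp inf_le_left)
    · have h1 : (preBar M F a e' ⇨ x.iota e') ⊓ b ⊓ a k ≤ preBar M F a e' :=
        inf_le_right.trans (le_preBar hk)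
      refine le_inf (le_inf ?_ (le_inf (inf_le_left.trans inf_le_right) h1)) inf_le_right
      exact (le_inf (inf_le_left.trans inf_le_left) h1).trans himp_inf_le
  · rw [iota_inf_apply, iota_updBlock_of_not_sim h, inf_bot_eq]
    simp [muPhi_bot hM ha hb]

end Values

/-! ### Soundness -/

section Soundness

variable {AtProp : Type u} {Ag : Type v}

section

variable {M : PreModel AtProp Ag} {F : EventFrame Ag} {Φ : Fin F.nPhi → Fml AtProp Ag}
  {sub : Fin F.nE → AtProp → Fml AtProp Ag} {e : Fin F.nE} {i : Ag}

/-- Multiply by the premeasure of the new block, which is positive. The left-hand term becomes `C`,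
and `-β` times the denominator becomes `D`, because the denominator is the same expression evaluated
at `⊤`. -/
theorem le_termVal_updBlock_iff (hM : M.IsAPE) (ha : PreGood F fun k => eval (Φ k) M)
    {b : M.carrier} (hb : IsIMin (M.dia i) b)
    (hbe : b ⊓ preBar M F (fun k => eval (Φ k) M) e ≠ ⊥) (t : List (ℚ × Fml AtProp Ag)) (β : ℚ) :
    (β : ℝ) ≤ termVal (update M F (fun k => eval (Φ k) M) fun f p => eval (sub f p) M) i t
        (updBlock M F (fun k => eval (Φ k) M) i b e) ↔
      b ≤ eval (updIneq F Φ sub i e t β) M := by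
  classical
  set a : Fin F.nPhi → M.carrier := fun k => eval (Φ k) M with ha_def
  set y := updBlock M F a i b e with hy_def
  have hy : IsIMin (PseudoQuot.dia (prodDia M F i)) y := isIMin_updBlock hM hb hbe
  have hpos := prodMu_iota_pos hM ha hy
  -- Clearing the denominator, summand by summand: this is `C`.
  have hval : termVal (update M F a fun f p => eval (sub f p) M) i t y * prodMu M F a i y.iota =
      termVal M i (t.flatMap fun x => updTerm F Φ i e x.1 fun e' => upBox F Φ sub e' x.2) b := by
    rw [termVal_flatMap]
    induction t with
    | nil => simp [termVal]
    | cons x t ih =>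
      have h0 : termVal (update M F a fun f p => eval (sub f p) M) i (x :: t) y =
          (x.1 : ℝ) * updMu M F a i (@min _ SemilatticeInf.toMin
            (eval x.2 (update M F a fun f p => eval (sub f p) M)) y) +
          termVal (update M F a fun f p => eval (sub f p) M) i t y := termVal_cons _ i x t _
      rw [h0, add_mul, ih, List.map_cons, List.sum_cons]
      congr 1
      rw [termVal_updTerm]
      have h1 := updMu_eq hM ha hy (x := @min _ SemilatticeInf.toMin
        (eval x.2 (update M F a fun f p => eval (sub f p) M)) y) inf_le_right
      have h2 := prodMu_inf_updBlock hM ha hb e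
        (eval x.2 (update M F a fun f p => eval (sub f p) M))
      simp only [eval_upBox, eval_preFml]
      refine Eq.trans ?_ (congrArg (fun z => (x.1 : ℝ) * z) h2)
      rw [mul_assoc]
      congr 1
      rw [eq_div_iff hpos.ne'] at h1
      exact h1
  -- The denominator itself, as the coefficient of `-β` in `D`.
  have htop : prodMu M F a i y.iota = ∑ e' ∈ Finset.univ.filter (fun e' => (F.sim i).r e' e), ∑ k,
      (F.P i e' : ℝ) * muPhi M F a i k (eval (top : Fml AtProp Ag) M ⊓ b) * F.pre k e' := by
    have h2 := prodMu_inf_updBlock hM ha hb e ⊤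
    rw [top_inf_eq] at h2
    rw [h2]
    simp only [iota_top_apply, himp_self, eval_top]
  rw [updIneq, eval_ge, hb.le_blockSup_iff (hM.monadic i), termVal_append, termVal_updTerm,
    ← hval, ← htop, ← mul_le_mul_iff_left₀ hpos]
  push_cast
  constructor <;> intro h <;> linarith

/-- Both inequalities are fixed elements of their algebras, so it is enough to compare them on the
blocks `b` that meet the precondition of `e`; there `le_termVal_updBlock_iff` applies. -/
theorem updVal_ge (hM : M.IsAPE) (ha : PreGood F fun k => eval (Φ k) M)
    (t : List (ℚ × Fml AtProp Ag)) (β : ℚ) : updVal F Φ sub M (ge i t β) e =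
      eval (updIneq F Φ sub i e t β) M ⊓ eval (preFml F Φ e) M := by
  rw [eval_preFml]
  have hU := update_isAPE hM ha fun f p => eval (sub f p) M
  have hfix : PseudoQuot.dia (prodDia M F i) (eval (ge i t β)
      (update M F (fun k => eval (Φ k) M) fun f p => eval (sub f p) M)) = eval (ge i t β)
      (update M F (fun k => eval (Φ k) M) fun f p => eval (sub f p) M) := by
    rw [eval_ge]
    exact dia_blockSup (hU.monadic i) _
  have hblk : ∀ b, IsIMin (M.dia i) b → b ⊓ preBar M F (fun k => eval (Φ k) M) e ≠ ⊥ →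
      (updBlock M F (fun k => eval (Φ k) M) i b e ≤ eval (ge i t β)
        (update M F (fun k => eval (Φ k) M) fun f p => eval (sub f p) M) ↔
      b ≤ eval (updIneq F Φ sub i e t β) M) := fun b hb hbe => by
    rw [← le_termVal_updBlock_iff hM ha hb hbe, eval_ge]
    exact IsIMin.le_blockSup_iff (hU.monadic i) (isIMin_updBlock hM hb hbe)
  apply le_antisymm
  · refine le_of_blocks (hM.monadic i) (hM.epistemic i) fun b hb => ?_
    by_cases h : b ⊓ updVal F Φ sub M (ge i t β) e = ⊥
    · rw [h]; exact bot_le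
    have h1 := updBlock_le_of_fixed hM hb hfix h
    exact inf_le_inf ((hblk b hb (inf_pre_ne_of_inf_iota_ne h)).1 h1) (iota_le_pre _ _)
  · refine le_of_blocks (hM.monadic i) (hM.epistemic i) fun b hb => ?_
    rw [← inf_assoc]
    by_cases h : b ⊓ preBar M F (fun k => eval (Φ k) M) e = ⊥
    · exact (inf_le_inf_right _ inf_le_left).trans (h.le.trans bot_le)
    have hfix' : M.dia i (eval (updIneq F Φ sub i e t β) M) = eval (updIneq F Φ sub i e t β) M := by
      rw [updIneq, eval_ge]
      exact dia_blockSup (hM.monadic i) _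
    rcases hb.eq_or_disjoint (hM.monadic i) hfix' with h' | h'
    · refine (inf_le_inf_right _ inf_le_left).trans ?_
      rw [← iota_updBlock_of_sim (i := i) ((F.sim i).refl e)]
      exact (hblk b hb h).2 h' e
    · rw [h', bot_inf_eq]
      exact bot_le

end

/-- `φ` is semantically well-formed: the preconditions of the event structures occurring in `φ`
satisfy the required relations in all APE-models. -/
def SWF : Fml AtProp Ag → Prop
  | atom _ => True
  | bot => True
  | conj φ ψ => SWF φ ∧ SWF ψ
  | disj φ ψ => SWF φ ∧ SWF ψ
  | impl φ ψ => SWF φ ∧ SWF ψ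
  | dia _ φ => SWF φ
  | box _ φ => SWF φ
  | upDia F Φ sub _ φ => ((∀ k, SWF (Φ k)) ∧ (∀ e p, SWF (sub e p)) ∧
      ∀ M : PreModel AtProp Ag, M.IsAPE → PreGood F fun k => eval (Φ k) M) ∧ SWF φ
  | upBox F Φ sub _ φ => ((∀ k, SWF (Φ k)) ∧ (∀ e p, SWF (sub e p)) ∧
      ∀ M : PreModel AtProp Ag, M.IsAPE → PreGood F fun k => eval (Φ k) M) ∧ SWF φ
  | prob _ _ _ φ _ => ∀ k, SWF (φ k)

/-- `SWF` is needed under an update: the hypothesis on `A` and `B` covers only APE-models, so the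
updated model has to be one. -/
theorem Repl.eval_eq {A B φ φ' : Fml AtProp Ag} (h : Repl A B φ φ')
    (hAB : ∀ M : PreModel AtProp Ag, M.IsAPE → eval A M = eval B M) (hφ : SWF φ) :
    ∀ M : PreModel AtProp Ag, M.IsAPE → eval φ M = eval φ' M := by
  induction h with
  | here => exact hAB
  | refl => exact fun _ _ => rfl
  | conj _ _ ih ih' => intro M hM; simp only [eval, ih hφ.1 M hM, ih' hφ.2 M hM]
  | disj _ _ ih ih' => intro M hM; simp only [eval, ih hφ.1 M hM, ih' hφ.2 M hM]
  | impl _ _ ih ih' => intro M hM; simp only [eval, ih hφ.1 M hM, ih' hφ.2 M hM]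
  | dia _ ih => intro M hM; simp only [eval, ih hφ M hM]
  | box _ ih => intro M hM; simp only [eval, ih hφ M hM]
  | @upDia F Φ Φ' sub sub' e φ φ' _ _ _ ih1 ih2 ih3 =>
    intro M hM
    obtain ⟨⟨h1, h2, h3⟩, h4⟩ := hφ
    have e1 : (fun k => eval (Φ k) M) = fun k => eval (Φ' k) M :=
      funext fun k => ih1 k (h1 k) M hM
    have e2 : (fun f p => eval (sub f p) M) = fun f p => eval (sub' f p) M :=
      funext fun f => funext fun p => ih2 f p (h2 f p) M hM
    simp only [eval]
    rw [ih3 h4 _ (update_isAPE hM (h3 M hM) _), e1, e2]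
  | @upBox F Φ Φ' sub sub' e φ φ' _ _ _ ih1 ih2 ih3 =>
    intro M hM
    obtain ⟨⟨h1, h2, h3⟩, h4⟩ := hφ
    have e1 : (fun k => eval (Φ k) M) = fun k => eval (Φ' k) M :=
      funext fun k => ih1 k (h1 k) M hM
    have e2 : (fun f p => eval (sub f p) M) = fun f p => eval (sub' f p) M :=
      funext fun f => funext fun p => ih2 f p (h2 f p) M hM
    simp only [eval]
    rw [ih3 h4 _ (update_isAPE hM (h3 M hM) _), e1, e2]
  | prob _ ih => intro M hM; simp only [eval, fun k => ih k (hφ k) M hM]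

theorem le_eval_ge_iff {M : PreModel AtProp Ag} (hM : M.IsAPE) {i : Ag} {b : M.carrier}
    (hb : IsIMin (M.dia i) b) {t : List (ℚ × Fml AtProp Ag)} {β : ℚ} :
    b ≤ eval (ge i t β) M ↔ (β : ℝ) ≤ termVal M i t b := by
  rw [eval_ge, hb.le_blockSup_iff (hM.monadic i)]

theorem dia_eval_ge {M : PreModel AtProp Ag} (hM : M.IsAPE) (i : Ag)
    (t : List (ℚ × Fml AtProp Ag)) (β : ℚ) :
    M.dia i (eval (ge i t β) M) = eval (ge i t β) M := by
  rw [eval_ge, dia_blockSup (hM.monadic i)]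

theorem eval_ge_le_iff {M : PreModel AtProp Ag} (hM : M.IsAPE) {i : Ag} {x : M.carrier}
    {t : List (ℚ × Fml AtProp Ag)} {β : ℚ} : eval (ge i t β) M ≤ x ↔
      ∀ b, IsIMin (M.dia i) b → (β : ℝ) ≤ termVal M i t b → b ≤ x :=
  ⟨fun h _ hb h' => ((le_eval_ge_iff hM hb).2 h').trans h, fun h =>
    le_of_blocks_of_fixed (hM.monadic i) (hM.epistemic i) (dia_eval_ge hM i t β)
      fun b hb h' => h b hb ((le_eval_ge_iff hM hb).1 h')⟩

theorem le_himp_iff_inf_le_inf {A : Type} [HeytingAlgebra A] {b x y : A} :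
    b ≤ x ⇨ y ↔ x ⊓ b ≤ y ⊓ b := by
  rw [le_himp_iff, inf_comm b]
  exact ⟨fun h => le_inf h inf_le_right, fun h => h.trans inf_le_left⟩

/-- The modal axioms are laws of the algebra, the axioms on inequalities and probabilities are
tested on blocks, and the reduction axioms are the equations for `updVal`. -/
theorem Ax.sound {φ : Fml AtProp Ag} (h : Ax φ) (hs : SWF φ) {M : PreModel AtProp Ag}
    (hM : M.IsAPE) : eval φ M = ⊤ := by
  cases h with
  | H1 A B => simp only [eval, himp_eq_top_iff]; exact le_himp
  | H2 A B C =>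
    simp only [eval, himp_eq_top_iff, le_himp_iff]
    have h1 : (eval A M ⇨ eval B M ⇨ eval C M) ⊓ (eval A M ⇨ eval B M) ⊓ eval A M ≤ eval B M :=
      (inf_le_inf_right _ inf_le_right).trans himp_inf_le
    have h2 : (eval A M ⇨ eval B M ⇨ eval C M) ⊓ (eval A M ⇨ eval B M) ⊓ eval A M ≤
      eval B M ⇨ eval C M := (inf_le_inf_right _ inf_le_left).trans himp_inf_le
    exact (le_inf h2 h1).trans himp_inf_le
  | H3 A B => simp only [eval, himp_eq_top_iff, le_himp_iff]; exact le_rfl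
  | H4 A B C =>
    simp only [eval, himp_eq_top_iff, le_himp_iff]
    rw [← sup_himp_distrib]
    exact himp_inf_le
  | H5 A B => simp only [eval, himp_eq_top_iff]; exact inf_le_left
  | H6 A B => simp only [eval, himp_eq_top_iff]; exact inf_le_right
  | H7 A B => simp only [eval, himp_eq_top_iff]; exact le_sup_left
  | H8 A B => simp only [eval, himp_eq_top_iff]; exact le_sup_right
  | H9 A => simp only [eval, himp_eq_top_iff]; exact bot_le
  | M1 i A => simp only [eval, himp_eq_top_iff]; exact (hM.monadic i).M1 _
  | M2 i A => simp only [eval, himp_eq_top_iff]; exact (hM.monadic i).M2 _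
  | M3 i A B => simp only [eval, himp_eq_top_iff]; exact (hM.monadic i).M3 _ _
  | M4 i A B => simp only [eval, himp_eq_top_iff]; exact (hM.monadic i).M4 _ _
  | M5 i A => simp only [eval, himp_eq_top_iff]; exact (hM.monadic i).M5 _
  | M6 i A => simp only [eval, himp_eq_top_iff]; exact (hM.monadic i).M6 _
  | M7 i A B => simp only [eval, himp_eq_top_iff]; exact (hM.monadic i).M7 _ _
  | E i A => simp only [eval, neg, himp_bot]; exact hM.epistemic i _
  | N0 i t =>
    refine eq_top_of_blocks (hM.monadic i) (hM.epistemic i) fun b hb => ?_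
    rw [geTerm, le_eval_ge_iff hM hb, termVal_append, termVal_smulTerm]
    push_cast
    linarith
  | N1 i t β φ =>
    rw [eval_iff_eq_top, eval_ge, eval_ge]
    simp [termVal_append, termVal_cons, termVal_nil]
  | N2 i t t' β hp =>
    simp only [eval, himp_eq_top_iff, eval_ge_le_iff hM]
    intro b hb h
    rw [le_eval_ge_iff hM hb]
    rwa [termVal, ← (hp.map _).sum_eq]
  | N3 i l β β' =>
    simp only [eval, himp_eq_top_iff]
    refine le_of_blocks_of_fixed (hM.monadic i) (hM.epistemic i)
      ((hM.monadic i).dia_inf (dia_eval_ge hM _ _ _) (dia_eval_ge hM _ _ _)) fun b hb h => ?_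
    rw [le_inf_iff, le_eval_ge_iff hM hb, le_eval_ge_iff hM hb] at h
    rw [le_eval_ge_iff hM hb]
    have : termVal M i (l.map fun x => (x.1 + x.2.1, x.2.2)) b =
        termVal M i (l.map fun x => (x.1, x.2.2)) b +
          termVal M i (l.map fun x => (x.2.1, x.2.2)) b := by
      simp only [termVal, List.map_map, ← List.sum_map_add, Function.comp_def]
      congr 1
      refine List.map_congr_left fun x _ => ?_
      push_cast
      ring
    rw [this]
    push_cast
    linarith
  | N4 i t β d hd =>
    simp only [eval, himp_eq_top_iff, eval_ge_le_iff hM]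
    intro b hb h
    rw [le_eval_ge_iff hM hb, termVal_smulTerm]
    push_cast
    have : (0 : ℝ) ≤ d := by exact_mod_cast hd
    gcongr
  | N5 i t β =>
    refine eq_top_of_blocks (hM.monadic i) (hM.epistemic i) fun b hb => ?_
    simp only [eval]
    rw [hb.le_sup_iff (hM.monadic i) (dia_eval_ge hM _ _ _), Fml.le, le_eval_ge_iff hM hb,
      le_eval_ge_iff hM hb, termVal_smulTerm]
    push_cast
    rcases le_total (β : ℝ) (termVal M i t b) with h | h
    · exact Or.inl h
    · right; linarith
  | N6 i t β γ hγ =>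
    simp only [eval, gt, neg, himp_eq_top_iff]
    rw [le_himp_iff, Fml.le]
    refine le_of_blocks_of_fixed (hM.monadic i) (hM.epistemic i)
      ((hM.monadic i).dia_inf (dia_eval_ge hM _ _ _) (dia_eval_ge hM _ _ _)) fun b hb h => ?_
    rw [le_inf_iff, le_eval_ge_iff hM hb, le_eval_ge_iff hM hb, termVal_smulTerm] at h
    push_cast at h
    have : (γ : ℝ) < β := by exact_mod_cast hγ
    linarith
  | P1 i =>
    refine eq_top_of_blocks (hM.monadic i) (hM.epistemic i) fun b hb => ?_
    simp only [Fml.eq, Fml.le, eval]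
    rw [le_inf_iff, le_eval_ge_iff hM hb, le_eval_ge_iff hM hb, termVal_smulTerm, termVal_cons,
      termVal_nil]
    simp [eval, (hM.measure i).bot b hb]
  | P2 i =>
    refine eq_top_of_blocks (hM.monadic i) (hM.epistemic i) fun b hb => ?_
    simp only [Fml.eq, Fml.le, eval]
    rw [le_inf_iff, le_eval_ge_iff hM hb, le_eval_ge_iff hM hb, termVal_smulTerm, termVal_cons,
      termVal_nil]
    simp [eval_top, (hM.measure i).one b hb]
  | P3 i φ ψ =>
    refine eq_top_of_blocks (hM.monadic i) (hM.epistemic i) fun b hb => ?_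
    simp only [eqTerm, geTerm, eval]
    rw [le_inf_iff, le_eval_ge_iff hM hb, le_eval_ge_iff hM hb]
    simp only [termVal_smulTerm, termVal_append, termVal_cons, termVal_nil, eval]
    have := (hM.measure i).modular b (eval φ M ⊓ b) (eval ψ M ⊓ b) hb inf_le_right inf_le_right
    rw [← inf_sup_right, ← inf_inf_distrib_right] at this
    rw [this]
    push_cast
    constructor <;> linarith
  | P4 i φ ψ =>
    rw [eval_iff_eq_top]
    simp only [eqTerm, geTerm, Fml.iff, eval]
    have hkey : ∀ b, IsIMin (M.dia i) b →
        (b ≤ M.box i (eval φ M ⇨ eval ψ M) ⊓ (eval (ge i ([(1, φ)] ++ smulTerm (-1) [(1, ψ)]) 0) M ⊓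
          eval (ge i ([(1, ψ)] ++ smulTerm (-1) [(1, φ)]) 0) M) ↔
        b ≤ M.box i ((eval ψ M ⇨ eval φ M) ⊓ (eval φ M ⇨ eval ψ M))) := by
      intro b hb
      rw [le_inf_iff, le_inf_iff, hb.le_box_iff (hM.monadic i), hb.le_box_iff (hM.monadic i),
        le_inf_iff, le_eval_ge_iff hM hb, le_eval_ge_iff hM hb, le_himp_iff_inf_le_inf,
        le_himp_iff_inf_le_inf]
      simp only [termVal_smulTerm, termVal_append, termVal_cons, termVal_nil]
      push_cast
      constructor
      -- On `b` the value of `φ` is below that of `ψ`; if they differed, strictness would separate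
      -- their measures.
      · rintro ⟨h1, h2, h3⟩
        refine ⟨?_, h1⟩
        by_contra hne
        have := (hM.measure i).strict b _ _ hb (lt_of_le_not_ge h1 hne) inf_le_right
        linarith
      · rintro ⟨h1, h2⟩
        rw [le_antisymm h2 h1]
        refine ⟨le_rfl, ?_, ?_⟩ <;> linarith
    apply le_antisymm
    · exact le_of_blocks_of_fixed (hM.monadic i) (hM.epistemic i)
        ((hM.monadic i).dia_inf ((hM.monadic i).dia_box _) ((hM.monadic i).dia_inf
          (dia_eval_ge hM _ _ _) (dia_eval_ge hM _ _ _))) fun b hb => (hkey b hb).1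
    · exact le_of_blocks_of_fixed (hM.monadic i) (hM.epistemic i) ((hM.monadic i).dia_box _)
        fun b hb => (hkey b hb).2
  | P5 i t β =>
    simp only [eval, himp_eq_top_iff]
    rw [(hM.monadic i).le_box_iff (dia_eval_ge hM _ _ _)]
  | I1 F Φ sub e p =>
    rw [eval_iff_eq_top, eval_upBox, updVal_atom, pre_himp_inf, eval]
  | I2 F Φ sub e p =>
    rw [eval_iff_eq_top, eval_upDia, updVal_atom, eval, inf_comm]
  | I3 F Φ sub e =>
    rw [eval_iff_eq_top, eval_upBox, top, updVal_impl, pre_himp_inf, himp_self, himp_top, eval,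
      himp_self]
  | I4 F Φ sub e =>
    rw [eval_iff_eq_top, eval_upDia, top, updVal_impl, himp_self, top_inf_eq]
  | I5 F Φ sub e =>
    rw [eval_iff_eq_top, eval_upBox, updVal_bot, neg, eval, eval]
  | I6 F Φ sub e =>
    rw [eval_iff_eq_top, eval_upDia, updVal_bot, eval]
  | I7 F Φ sub e φ ψ =>
    rw [eval_iff_eq_top, eval, eval_upBox, eval_upBox, eval_upBox, updVal_conj, himp_inf_distrib]
  | I8 F Φ sub e φ ψ =>
    rw [eval_iff_eq_top, eval, eval_upDia, eval_upDia, eval_upDia, updVal_conj]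
  | I9 F Φ sub e φ ψ =>
    rw [eval_iff_eq_top, eval, eval_upBox, eval, eval_upDia, eval_upDia, updVal_disj]
  | I10 F Φ sub e φ ψ =>
    rw [eval_iff_eq_top, eval, eval_upDia, eval_upDia, eval_upDia, updVal_disj]
  | I11 F Φ sub e φ ψ =>
    rw [eval_iff_eq_top, eval, eval_upBox, eval_upDia, eval_upDia, updVal_impl, pre_himp_inf,
      himp_himp, inf_eq_right.2 updVal_le]
  | I12 F Φ sub e φ ψ =>
    rw [eval_iff_eq_top, eval, eval, eval_upDia, eval_upDia, eval_upDia, updVal_impl, inf_comm]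
  | I13 F Φ sub e i φ =>
    rw [eval_iff_eq_top, eval, eval_upBox, updVal_dia, pre_himp_inf]
  | I14 F Φ sub e i φ =>
    rw [eval_iff_eq_top, eval, eval_upDia, updVal_dia, inf_comm]
  | I15 F Φ sub e i φ =>
    rw [eval_iff_eq_top, eval, eval_upBox, updVal_box, pre_himp_inf]
  | I16 F Φ sub e i φ =>
    rw [eval_iff_eq_top, eval, eval_upDia, updVal_box, inf_comm]
  | I17 F Φ sub e i t β =>
    -- Only this axiom and the next use the conditions on the preconditions, which make the
    -- premeasure positive on blocks.
    have ha := hs.1.1.1.2.2 M hM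
    rw [eval_iff_eq_top, eval, eval_upBox, updVal_ge hM ha, pre_himp_inf]
  | I18 F Φ sub e i t β =>
    have ha := hs.1.1.1.2.2 M hM
    rw [eval_iff_eq_top, eval, eval_upDia, updVal_ge hM ha, inf_comm]

/-- Every theorem of IPDEL is valid in all APE-models. -/
theorem Provable.sound {φ : Fml AtProp Ag} (h : Provable φ) : Valid φ := by
  -- Well-formedness refers to provability, so the three notions are handled by one simultaneous
  -- induction: formulas are `SWF`, event structures have good preconditions in every APE-model,
  -- theorems are valid.
  refine Provable.rec (motive_1 := fun φ _ => SWF φ)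
    (motive_2 := fun F Φ sub _ => (∀ k, SWF (Φ k)) ∧ (∀ e p, SWF (sub e p)) ∧
      ∀ M : PreModel AtProp Ag, M.IsAPE → PreGood F fun k => eval (Φ k) M)
    (motive_3 := fun φ _ => Valid φ) (fun _ => trivial) trivial (fun _ _ h h' => ⟨h, h'⟩)
    (fun _ _ h h' => ⟨h, h'⟩) (fun _ _ h h' => ⟨h, h'⟩) (fun _ h => h) (fun _ h => h)
    (fun _ _ h h' => ⟨h, h'⟩) (fun _ _ h h' => ⟨h, h'⟩) (fun _ h => h) ?_ ?_ ?_ ?_ ?_ ?_ ?_ h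
  · intro F Φ sub _ _ _ _ _ _ h1 h2 h3 h4
    refine ⟨h1, h2, fun M hM => ⟨fun k l hkl => ?_, fun k l hne hkl hlk => ?_⟩⟩
    · have := h3 k l hkl M hM
      rwa [eval, himp_eq_top_iff] at this
    · have := h4 k l hne hkl hlk M hM
      rwa [neg, eval, himp_eq_top_iff, eval, eval, le_bot_iff] at this
  · intro φ _ hax hs M hM
    exact hax.sound hs hM
  · intro A B _ _ h1 h2 M hM
    have := h1 M hM
    rw [eval, h2 M hM, himp_eq_top_iff] at this
    exact top_le_iff.1 this
  · intro i A _ h1 M hM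
    rw [eval, h1 M hM]
    exact top_le_iff.1 (hM.monadic i).M9
  · intro F Φ sub e A _ _ hev h1 M hM
    rw [eval_upBox, himp_eq_top_iff, updVal, h1 _ (update_isAPE hM (hev.2.2 M hM) _), eval_preFml]
    exact (iota_top_apply e).ge
  · intro i A B _ h1 M hM
    refine eq_top_of_blocks (hM.monadic i) (hM.epistemic i) fun b hb => ?_
    rw [geTerm, le_eval_ge_iff hM hb, termVal_append, termVal_smulTerm]
    simp only [termVal_cons, termVal_nil]
    have h2 := h1 M hM
    rw [eval, himp_eq_top_iff] at h2
    have := (hM.measure i).mono b _ _ hb (inf_le_inf_right b h2) inf_le_right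
    push_cast
    linarith
  · intro A B φ φ' _ _ _ hr h1 hs _ M hM
    rw [eval_iff_eq_top]
    exact hr.eval_eq (fun M hM => eval_iff_eq_top.1 (h1 M hM)) hs M hM

end Soundness

/-! ### The Lindenbaum algebra -/

section Lindenbaum

variable {AtProp : Type u} {Ag : Type v}

theorem Provable.weaken {A B : Fml AtProp Ag} (hA : WF A) (hB : WF B) (h : Provable B) :
    Provable (impl A B) := .mp (.ax (.impl hB (.impl hA hB)) (.H1 _ _)) h

theorem Provable.distrib {A B C : Fml AtProp Ag} (hA : WF A) (hB : WF B) (hC : WF C)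
    (h : Provable (impl A (impl B C))) (h' : Provable (impl A B)) : Provable (impl A C) :=
  .mp (.mp (.ax (.impl (.impl hA (.impl hB hC)) (.impl (.impl hA hB) (.impl hA hC)))
    (.H2 _ _ _)) h) h'

theorem Provable.imp_trans {A B C : Fml AtProp Ag} (hA : WF A) (hB : WF B) (hC : WF C)
    (h : Provable (impl A B)) (h' : Provable (impl B C)) : Provable (impl A C) :=
  .distrib hA hB hC (.weaken hA (.impl hB hC) h') h

theorem Provable.imp_refl {A : Fml AtProp Ag} (hA : WF A) : Provable (impl A A) :=
  .distrib hA (.impl hA hA) hA (.ax (.impl hA (.impl (.impl hA hA) hA)) (.H1 _ _))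
    (.ax (.impl hA (.impl hA hA)) (.H1 _ _))

theorem Provable.le_conj {A B C : Fml AtProp Ag} (hA : WF A) (hB : WF B) (hC : WF C)
    (h : Provable (impl A B)) (h' : Provable (impl A C)) : Provable (impl A (conj B C)) :=
  .distrib hA hC (.conj hB hC) (.imp_trans hA hB (.impl hC (.conj hB hC)) h
    (.ax (.impl hB (.impl hC (.conj hB hC))) (.H3 _ _))) h'

theorem Provable.disj_le {A B C : Fml AtProp Ag} (hA : WF A) (hB : WF B) (hC : WF C)
    (h : Provable (impl A C)) (h' : Provable (impl B C)) : Provable (impl (disj A B) C) :=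
  .mp (.mp (.ax (.impl (.impl hA hC) (.impl (.impl hB hC) (.impl (.disj hA hB) hC)))
    (.H4 _ _ _)) h) h'

theorem Provable.conj_left {A B : Fml AtProp Ag} (hA : WF A) (hB : WF B) :
    Provable (impl (conj A B) A) := .ax (.impl (.conj hA hB) hA) (.H5 _ _)

theorem Provable.conj_right {A B : Fml AtProp Ag} (hA : WF A) (hB : WF B) :
    Provable (impl (conj A B) B) := .ax (.impl (.conj hA hB) hB) (.H6 _ _)

theorem Provable.le_impl_iff {A B C : Fml AtProp Ag} (hA : WF A) (hB : WF B) (hC : WF C) :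
    Provable (impl A (impl B C)) ↔ Provable (impl (conj A B) C) := by
  have hAB := WF.conj hA hB
  constructor
  · intro h
    exact .distrib hAB hB hC (.imp_trans hAB hA (.impl hB hC) (.conj_left hA hB) h)
      (.conj_right hA hB)
  · intro h
    refine .imp_trans hA (.impl hB hAB) (.impl hB hC)
      (.ax (.impl hA (.impl hB hAB)) (.H3 _ _)) ?_
    exact .mp (.ax (.impl (.impl hB (.impl hAB hC)) (.impl (.impl hB hAB) (.impl hB hC)))
      (.H2 _ _ _)) (.weaken hB (.impl hAB hC) h)

theorem WF.top : WF (Fml.top : Fml AtProp Ag) := .impl .bot .bot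

theorem WF.neg {A : Fml AtProp Ag} (hA : WF A) : WF (Fml.neg A) := .impl hA .bot

theorem WF.iff {A B : Fml AtProp Ag} (hA : WF A) (hB : WF B) : WF (Fml.iff A B) :=
  .conj (.impl hA hB) (.impl hB hA)

theorem Provable.iff_iff {A B : Fml AtProp Ag} (hA : WF A) (hB : WF B) :
    Provable (iff A B) ↔ Provable (impl A B) ∧ Provable (impl B A) := by
  have h1 := WF.impl hA hB
  have h2 := WF.impl hB hA
  refine ⟨fun h => ⟨.mp (.conj_left h1 h2) h, .mp (.conj_right h1 h2) h⟩, fun h => ?_⟩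
  exact .mp (.mp (.ax (.impl h1 (.impl h2 (.conj h1 h2))) (.H3 _ _)) h.1) h.2

/-- The formulas of the language, ordered by provable implication. -/
def WFml (AtProp : Type u) (Ag : Type v) : Type (max u v) := {φ : Fml AtProp Ag // WF φ}

instance : Preorder (WFml AtProp Ag) where
  le φ ψ := Provable (impl φ.1 ψ.1)
  le_refl φ := .imp_refl φ.2
  le_trans φ ψ χ h h' := .imp_trans φ.2 ψ.2 χ.2 h h'

/-- The Lindenbaum algebra. -/
def Lind (AtProp : Type u) (Ag : Type v) : Type (max u v) :=
  Antisymmetrization (WFml AtProp Ag) (· ≤ ·)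

namespace Lind

instance : PartialOrder (Lind AtProp Ag) :=
  inferInstanceAs (PartialOrder (Antisymmetrization (WFml AtProp Ag) (· ≤ ·)))

/-- The class of a formula. -/
def cls (φ : Fml AtProp Ag) (h : WF φ) : Lind AtProp Ag :=
  toAntisymmetrization (· ≤ ·) (⟨φ, h⟩ : WFml AtProp Ag)

theorem cls_le_iff {φ ψ : Fml AtProp Ag} {hφ : WF φ} {hψ : WF ψ} :
    cls φ hφ ≤ cls ψ hψ ↔ Provable (impl φ ψ) := Iff.rfl

theorem cls_surj (x : Lind AtProp Ag) : ∃ φ h, cls φ h = x := by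
  induction x using Quotient.inductionOn with
  | _ φ => exact ⟨φ.1, φ.2, rfl⟩

theorem cls_eq_iff {φ ψ : Fml AtProp Ag} {hφ : WF φ} {hψ : WF ψ} :
    cls φ hφ = cls ψ hψ ↔ Provable (iff φ ψ) := by
  rw [le_antisymm_iff, cls_le_iff, cls_le_iff, Provable.iff_iff hφ hψ]

/-- The operation induced by a binary connective. -/
def map₂ (f : Fml AtProp Ag → Fml AtProp Ag → Fml AtProp Ag)
    (hf : ∀ {A B}, WF A → WF B → WF (f A B))
    (h : ∀ {A A' B B'} (hA : WF A) (hA' : WF A') (hB : WF B) (hB' : WF B'),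
      cls A hA = cls A' hA' → cls B hB = cls B' hB' →
        cls (f A B) (hf hA hB) = cls (f A' B') (hf hA' hB')) :
    Lind AtProp Ag → Lind AtProp Ag → Lind AtProp Ag :=
  Quotient.lift₂ (fun A B => cls (f A.1 B.1) (hf A.2 B.2)) fun A B A' B' hA hB =>
    h A.2 A'.2 B.2 B'.2 (Quotient.sound hA) (Quotient.sound hB)

/-- The operation induced by a unary connective. -/
def map₁ (f : Fml AtProp Ag → Fml AtProp Ag) (hf : ∀ {A}, WF A → WF (f A))
    (h : ∀ {A A'} (hA : WF A) (hA' : WF A'), cls A hA = cls A' hA' →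
        cls (f A) (hf hA) = cls (f A') (hf hA')) : Lind AtProp Ag → Lind AtProp Ag :=
  Quotient.lift (fun A => cls (f A.1) (hf A.2)) fun A A' hA =>
    h A.2 A'.2 (Quotient.sound hA)

theorem cls_congr_of_repl {A B φ φ' : Fml AtProp Ag} {hA : WF A} {hB : WF B} (hφ : WF φ)
    (hφ' : WF φ') (h : cls A hA = cls B hB) (hr : Repl A B φ φ') : cls φ hφ = cls φ' hφ' :=
  cls_eq_iff.2 (.subEq (cls_eq_iff.1 h) hφ hφ' hr)

/-- `Repl` exchanges a single pair of formulas, so the two arguments are replaced in turn. -/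
theorem map₂_congr {f : Fml AtProp Ag → Fml AtProp Ag → Fml AtProp Ag}
    (hf : ∀ {A B}, WF A → WF B → WF (f A B))
    (hr : ∀ {C D A A' B B'}, Repl C D A A' → Repl C D B B' → Repl C D (f A B) (f A' B'))
    {A A' B B' : Fml AtProp Ag} (hA : WF A) (hA' : WF A') (hB : WF B) (hB' : WF B')
    (h : cls A hA = cls A' hA') (h' : cls B hB = cls B' hB') :
    cls (f A B) (hf hA hB) = cls (f A' B') (hf hA' hB') :=
  (cls_congr_of_repl (hf hA hB) (hf hA' hB) h (hr .here (.refl _))).trans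
    (cls_congr_of_repl _ _ h' (hr (.refl _) .here))

instance : Max (Lind AtProp Ag) := ⟨map₂ disj .disj (map₂_congr .disj .disj)⟩

instance : Min (Lind AtProp Ag) := ⟨map₂ conj .conj (map₂_congr .conj .conj)⟩

instance : HImp (Lind AtProp Ag) := ⟨map₂ impl .impl (map₂_congr .impl .impl)⟩

instance : HeytingAlgebra (Lind AtProp Ag) where
  sup x y := x ⊔ y
  inf x y := x ⊓ y
  top := cls top .top
  bot := cls bot .bot
  compl x := x ⇨ cls bot .bot
  le_sup_left x y := by
    obtain ⟨φ, hφ, rfl⟩ := cls_surj x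
    obtain ⟨ψ, hψ, rfl⟩ := cls_surj y
    exact .ax (.impl hφ (.disj hφ hψ)) (.H7 _ _)
  le_sup_right x y := by
    obtain ⟨φ, hφ, rfl⟩ := cls_surj x
    obtain ⟨ψ, hψ, rfl⟩ := cls_surj y
    exact .ax (.impl hψ (.disj hφ hψ)) (.H8 _ _)
  sup_le x y z := by
    obtain ⟨φ, hφ, rfl⟩ := cls_surj x
    obtain ⟨ψ, hψ, rfl⟩ := cls_surj y
    obtain ⟨χ, hχ, rfl⟩ := cls_surj z
    exact fun h h' => .disj_le hφ hψ hχ h h'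
  inf_le_left x y := by
    obtain ⟨φ, hφ, rfl⟩ := cls_surj x
    obtain ⟨ψ, hψ, rfl⟩ := cls_surj y
    exact .conj_left hφ hψ
  inf_le_right x y := by
    obtain ⟨φ, hφ, rfl⟩ := cls_surj x
    obtain ⟨ψ, hψ, rfl⟩ := cls_surj y
    exact .conj_right hφ hψ
  le_inf x y z := by
    obtain ⟨φ, hφ, rfl⟩ := cls_surj x
    obtain ⟨ψ, hψ, rfl⟩ := cls_surj y
    obtain ⟨χ, hχ, rfl⟩ := cls_surj z
    exact fun h h' => .le_conj hφ hψ hχ h h'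
  le_top x := by
    obtain ⟨φ, hφ, rfl⟩ := cls_surj x
    exact .weaken hφ .top (.imp_refl .bot)
  bot_le x := by
    obtain ⟨φ, hφ, rfl⟩ := cls_surj x
    exact .ax (.impl .bot hφ) (.H9 _)
  le_himp_iff x y z := by
    obtain ⟨φ, hφ, rfl⟩ := cls_surj x
    obtain ⟨ψ, hψ, rfl⟩ := cls_surj y
    obtain ⟨χ, hχ, rfl⟩ := cls_surj z
    exact Provable.le_impl_iff hφ hψ hχ
  himp_bot _ := rfl

theorem cls_conj {φ ψ : Fml AtProp Ag} (hφ : WF φ) (hψ : WF ψ) :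
    cls (conj φ ψ) (.conj hφ hψ) = @min _ SemilatticeInf.toMin (cls φ hφ) (cls ψ hψ) := rfl

theorem cls_disj {φ ψ : Fml AtProp Ag} (hφ : WF φ) (hψ : WF ψ) :
    cls (disj φ ψ) (.disj hφ hψ) = @max _ SemilatticeSup.toMax (cls φ hφ) (cls ψ hψ) := rfl

theorem cls_impl {φ ψ : Fml AtProp Ag} (hφ : WF φ) (hψ : WF ψ) : cls (impl φ ψ) (.impl hφ hψ) =
    @himp _ GeneralizedHeytingAlgebra.toHImp (cls φ hφ) (cls ψ hψ) := rfl

theorem cls_bot : cls (bot : Fml AtProp Ag) .bot = ⊥ := rfl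

theorem cls_top : cls (top : Fml AtProp Ag) .top = ⊤ := rfl

theorem cls_eq_top_iff {φ : Fml AtProp Ag} {hφ : WF φ} : cls φ hφ = ⊤ ↔ Provable φ := by
  rw [← top_le_iff, ← cls_top, cls_le_iff]
  exact ⟨fun h => .mp h (.imp_refl .bot), .weaken .top hφ⟩

/-- The diamond of agent `i`. -/
def dia (i : Ag) : Lind AtProp Ag → Lind AtProp Ag :=
  map₁ (Fml.dia i) .dia fun hA hA' h => cls_congr_of_repl (.dia hA) (.dia hA') h (.dia .here)

/-- The box of agent `i`. -/
def box (i : Ag) : Lind AtProp Ag → Lind AtProp Ag :=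
  map₁ (Fml.box i) .box fun hA hA' h => cls_congr_of_repl (.box hA) (.box hA') h (.box .here)

theorem cls_dia (i : Ag) {φ : Fml AtProp Ag} (hφ : WF φ) :
    cls (Fml.dia i φ) (.dia hφ) = dia i (cls φ hφ) := rfl

theorem cls_box (i : Ag) {φ : Fml AtProp Ag} (hφ : WF φ) :
    cls (Fml.box i φ) (.box hφ) = box i (cls φ hφ) := rfl

-- Modal laws of the Lindenbaum algebra

variable (i : Ag) (x y : Lind AtProp Ag)

theorem le_dia : x ≤ dia i x := by
  obtain ⟨φ, hφ, rfl⟩ := cls_surj x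
  exact .ax (.impl hφ (.dia hφ)) (.M1 _ _)

theorem box_le : box i x ≤ x := by
  obtain ⟨φ, hφ, rfl⟩ := cls_surj x
  exact .ax (.impl (.box hφ) hφ) (.M2 _ _)

theorem box_himp_le : box i (x ⇨ y) ≤ box i x ⇨ box i y := by
  obtain ⟨φ, hφ, rfl⟩ := cls_surj x
  obtain ⟨ψ, hψ, rfl⟩ := cls_surj y
  exact .ax (.impl (.box (.impl hφ hψ)) (.impl (.box hφ) (.box hψ))) (.M4 _ _ _)

theorem dia_le_box_dia : dia i x ≤ box i (dia i x) := by
  obtain ⟨φ, hφ, rfl⟩ := cls_surj x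
  exact .ax (.impl (.dia hφ) (.box (.dia hφ))) (.M5 _ _)

theorem dia_box_le : dia i (box i x) ≤ box i x := by
  obtain ⟨φ, hφ, rfl⟩ := cls_surj x
  exact .ax (.impl (.dia (.box hφ)) (.box hφ)) (.M6 _ _)

theorem box_himp_le_dia : box i (x ⇨ y) ≤ dia i x ⇨ dia i y := by
  obtain ⟨φ, hφ, rfl⟩ := cls_surj x
  obtain ⟨ψ, hψ, rfl⟩ := cls_surj y
  exact .ax (.impl (.box (.impl hφ hψ)) (.impl (.dia hφ) (.dia hψ))) (.M7 _ _ _)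

theorem dia_sup_compl : dia i x ⊔ (dia i x)ᶜ = ⊤ := by
  obtain ⟨φ, hφ, rfl⟩ := cls_surj x
  have h : WF (disj (Fml.dia i φ) (neg (Fml.dia i φ))) := .disj (.dia hφ) (.neg (.dia hφ))
  exact cls_eq_top_iff (hφ := h).2 (.ax h (.E _ _))

theorem box_top : box i (⊤ : Lind AtProp Ag) = ⊤ :=
  cls_eq_top_iff (hφ := .box .top).2 (.nec i (.imp_refl .bot))

end Lind

end Lindenbaum

/-! ### Elimination of updates -/

section Reduction

variable {AtProp : Type u} {Ag : Type v}

open Lind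

theorem cls_prob_congr {i : Ag} {n : ℕ} {α : Fin n → ℚ} {φ φ' : Fin n → Fml AtProp Ag} {β : ℚ}
    (hφ : ∀ k, WF (φ k)) (hφ' : ∀ k, WF (φ' k)) (h : ∀ k, cls (φ k) (hφ k) = cls (φ' k) (hφ' k)) :
    cls (prob i n α φ β) (.prob hφ) = cls (prob i n α φ' β) (.prob hφ') := by
  classical
  -- The replacement rule handles one pair of formulas at a time, so the entries indexed by `S` are
  -- exchanged one by one.
  have key : ∀ (S : Finset (Fin n)) (hS : ∀ k, WF (if k ∈ S then φ' k else φ k)),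
      cls (prob i n α φ β) (.prob hφ) =
        cls (prob i n α (fun k => if k ∈ S then φ' k else φ k) β) (.prob hS) := by
    intro S
    induction S using Finset.induction_on with
    | empty => intro hS; simp
    | insert k S hk ih =>
      intro hS
      have hS' : ∀ k, WF (if k ∈ S then φ' k else φ k) := fun k => by
        split_ifs
        exacts [hφ' k, hφ k]
      refine (ih hS').trans (cls_congr_of_repl _ _ (h k) (.prob fun l => ?_))
      by_cases hl : l = k
      · subst hl
        simpa [hk] using Repl.here
      · simpa [hl] using Repl.refl _
  have := key Finset.univ (fun k => by simpa using hφ' k)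
  simpa using this

/-- The formulas without updates. -/
def Static : Fml AtProp Ag → Prop
  | atom _ => True
  | bot => True
  | conj φ ψ => Static φ ∧ Static ψ
  | disj φ ψ => Static φ ∧ Static ψ
  | impl φ ψ => Static φ ∧ Static ψ
  | .dia _ φ => Static φ
  | .box _ φ => Static φ
  | upDia _ _ _ _ _ => False
  | upBox _ _ _ _ _ => False
  | prob _ _ _ φ _ => ∀ k, Static (φ k)

/-- `φ` is provably equivalent to a formula without updates. -/
def HasStatic (φ : Fml AtProp Ag) : Prop :=
  ∃ (h : WF φ) (ψ : Fml AtProp Ag) (h' : WF ψ), Static ψ ∧ cls φ h = cls ψ h'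

namespace HasStatic

variable {φ ψ : Fml AtProp Ag}

theorem wf (h : HasStatic φ) : WF φ := h.1

theorem of_static (h : WF φ) (h' : Static φ) : HasStatic φ := ⟨h, φ, h, h', rfl⟩

theorem of_cls_eq (h : HasStatic ψ) (hφ : WF φ) (he : cls φ hφ = cls ψ h.wf) : HasStatic φ := by
  obtain ⟨_, χ, hχ, hs, heq⟩ := h
  exact ⟨hφ, χ, hχ, hs, he.trans heq⟩

theorem of_ax (h : HasStatic ψ) (hφ : WF φ) (ha : Ax (iff φ ψ)) : HasStatic φ :=
  h.of_cls_eq hφ (cls_eq_iff.2 (.ax (.iff hφ h.wf) ha))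

theorem conj : HasStatic φ → HasStatic ψ → HasStatic (conj φ ψ) := by
  rintro ⟨h, χ, h', hs, he⟩ ⟨k, ω, k', ks, ke⟩
  exact ⟨.conj h k, Fml.conj χ ω, .conj h' k', ⟨hs, ks⟩, by
    rw [cls_conj h k, cls_conj h' k', he, ke]⟩

theorem disj : HasStatic φ → HasStatic ψ → HasStatic (disj φ ψ) := by
  rintro ⟨h, χ, h', hs, he⟩ ⟨k, ω, k', ks, ke⟩
  exact ⟨.disj h k, Fml.disj χ ω, .disj h' k', ⟨hs, ks⟩, by
    rw [cls_disj h k, cls_disj h' k', he, ke]⟩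

theorem impl : HasStatic φ → HasStatic ψ → HasStatic (impl φ ψ) := by
  rintro ⟨h, χ, h', hs, he⟩ ⟨k, ω, k', ks, ke⟩
  exact ⟨.impl h k, Fml.impl χ ω, .impl h' k', ⟨hs, ks⟩, by
    rw [cls_impl h k, cls_impl h' k', he, ke]⟩

theorem dia (i : Ag) : HasStatic φ → HasStatic (Fml.dia i φ) := by
  rintro ⟨h, χ, h', hs, he⟩
  exact ⟨.dia h, Fml.dia i χ, .dia h', hs, by rw [cls_dia i h, cls_dia i h', he]⟩

theorem box (i : Ag) : HasStatic φ → HasStatic (Fml.box i φ) := by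
  rintro ⟨h, χ, h', hs, he⟩
  exact ⟨.box h, Fml.box i χ, .box h', hs, by rw [cls_box i h, cls_box i h', he]⟩

theorem prob {i : Ag} {n : ℕ} {α : Fin n → ℚ} {φ : Fin n → Fml AtProp Ag} {β : ℚ}
    (h : ∀ k, HasStatic (φ k)) : HasStatic (prob i n α φ β) := by
  choose h χ h' hs he using h
  exact ⟨.prob h, Fml.prob i n α χ β, .prob h', hs, cls_prob_congr h h' he⟩

theorem bot : HasStatic (bot : Fml AtProp Ag) := of_static .bot trivial

theorem top : HasStatic (top : Fml AtProp Ag) := bot.impl bot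

theorem ge {i : Ag} {t : List (ℚ × Fml AtProp Ag)} {β : ℚ} (h : ∀ x ∈ t, HasStatic x.2) :
    HasStatic (ge i t β) := prob fun k => h _ (List.get_mem t k)

theorem bigOr {l : List (Fml AtProp Ag)} (h : ∀ φ ∈ l, HasStatic φ) : HasStatic (bigOr l) := by
  induction l with
  | nil => exact bot
  | cons φ l ih =>
    exact (h φ List.mem_cons_self).disj (ih fun ψ hψ => h ψ (List.mem_cons_of_mem _ hψ))

theorem bigAnd {l : List (Fml AtProp Ag)} (h : ∀ φ ∈ l, HasStatic φ) : HasStatic (bigAnd l) := by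
  induction l with
  | nil => exact top
  | cons φ l ih =>
    exact (h φ List.mem_cons_self).conj (ih fun ψ hψ => h ψ (List.mem_cons_of_mem _ hψ))

variable {F : EventFrame Ag} {Φ : Fin F.nPhi → Fml AtProp Ag}
  {sub : Fin F.nE → AtProp → Fml AtProp Ag}

theorem preFml (hΦ : ∀ k, HasStatic (Φ k)) (e : Fin F.nE) : HasStatic (preFml F Φ e) := by
  refine bigOr fun φ hφ => ?_
  obtain ⟨k, -, rfl⟩ := List.mem_map.1 hφ
  exact hΦ k

theorem mem_updTerm (hΦ : ∀ k, HasStatic (Φ k)) {i : Ag} {e : Fin F.nE} {c : ℚ}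
    {χ : Fin F.nE → Fml AtProp Ag} (hχ : ∀ e, HasStatic (χ e)) :
    ∀ x ∈ updTerm F Φ i e c χ, HasStatic x.2 := by
  intro x hx
  simp only [updTerm, muPhiTerm, List.mem_flatMap, List.mem_cons, List.mem_map] at hx
  obtain ⟨e', -, k, -, rfl | ⟨l, -, rfl⟩⟩ := hx
  · exact (hχ e').conj (hΦ k)
  · exact (hχ e').conj (hΦ l)

theorem updIneq (hΦ : ∀ k, HasStatic (Φ k)) {i : Ag} {e : Fin F.nE}
    {t : List (ℚ × Fml AtProp Ag)} {β : ℚ}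
    (ht : ∀ x ∈ t, ∀ e, HasStatic (upBox F Φ sub e x.2)) :
    HasStatic (updIneq F Φ sub i e t β) := by
  refine ge fun x hx => ?_
  rcases List.mem_append.1 hx with hx | hx
  · obtain ⟨y, hy, hx⟩ := List.mem_flatMap.1 hx
    exact mem_updTerm hΦ (ht y hy) x hx
  · exact mem_updTerm hΦ (fun _ => top) x hx

/-- Induction on the static formula, one reduction axiom per connective. Box and diamond are treated
together because their reductions refer to each other, and for all events at once because the modal
and probabilistic reductions pass to indistinguishable events. -/
theorem update_of_static (hev : WFEvent F Φ sub) (hΦ : ∀ k, HasStatic (Φ k))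
    (hsub : ∀ e p, HasStatic (sub e p)) (hφ : WF φ) (hs : Static φ) :
    ∀ e, HasStatic (upBox F Φ sub e φ) ∧ HasStatic (upDia F Φ sub e φ) := by
  induction φ with
  | atom p =>
    exact fun e => ⟨((preFml hΦ e).impl (hsub e p)).of_ax (.upBox hev hφ) (.I1 ..),
      ((preFml hΦ e).conj (hsub e p)).of_ax (.upDia hev hφ) (.I2 ..)⟩
  | bot =>
    exact fun e => ⟨((preFml hΦ e).impl bot).of_ax (.upBox hev hφ) (.I5 ..),
      bot.of_ax (.upDia hev hφ) (.I6 ..)⟩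
  | conj φ ψ ih ih' =>
    intro e
    cases hφ with | conj h1 h2 =>
    exact ⟨((ih h1 hs.1 e).1.conj (ih' h2 hs.2 e).1).of_ax (.upBox hev (.conj h1 h2)) (.I7 ..),
      ((ih h1 hs.1 e).2.conj (ih' h2 hs.2 e).2).of_ax (.upDia hev (.conj h1 h2)) (.I8 ..)⟩
  | disj φ ψ ih ih' =>
    intro e
    cases hφ with | disj h1 h2 =>
    have h := (ih h1 hs.1 e).2.disj (ih' h2 hs.2 e).2
    exact ⟨((preFml hΦ e).impl h).of_ax (.upBox hev (.disj h1 h2)) (.I9 ..),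
      h.of_ax (.upDia hev (.disj h1 h2)) (.I10 ..)⟩
  | impl φ ψ ih ih' =>
    intro e
    cases hφ with | impl h1 h2 =>
    have h := (ih h1 hs.1 e).2.impl (ih' h2 hs.2 e).2
    exact ⟨h.of_ax (.upBox hev (.impl h1 h2)) (.I11 ..),
      ((preFml hΦ e).conj h).of_ax (.upDia hev (.impl h1 h2)) (.I12 ..)⟩
  | dia i φ ih =>
    intro e
    cases hφ with | dia h1 =>
    have h : HasStatic (Fml.bigOr ((simList F i e).map fun e' => .dia i (upDia F Φ sub e' φ))) := by
      refine bigOr fun ψ hψ => ?_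
      obtain ⟨e', -, rfl⟩ := List.mem_map.1 hψ
      exact (ih h1 hs e').2.dia i
    exact ⟨((preFml hΦ e).impl h).of_ax (.upBox hev (.dia h1)) (.I13 ..),
      ((preFml hΦ e).conj h).of_ax (.upDia hev (.dia h1)) (.I14 ..)⟩
  | box i φ ih =>
    intro e
    cases hφ with | box h1 =>
    have h : HasStatic (Fml.bigAnd ((simList F i e).map fun e' => .box i (upBox F Φ sub e' φ))) := by
      refine bigAnd fun ψ hψ => ?_
      obtain ⟨e', -, rfl⟩ := List.mem_map.1 hψ
      exact (ih h1 hs e').1.box i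
    exact ⟨((preFml hΦ e).impl h).of_ax (.upBox hev (.box h1)) (.I15 ..),
      ((preFml hΦ e).conj h).of_ax (.upDia hev (.box h1)) (.I16 ..)⟩
  | upDia => exact hs.elim
  | upBox => exact hs.elim
  | prob i n α φ β ih =>
    intro e
    have h1 : ∀ k, WF (φ k) := by cases hφ; assumption
    have h : HasStatic (Fml.updIneq F Φ sub i e (List.ofFn fun k => (α k, φ k)) β) := by
      refine updIneq hΦ fun x hx e' => ?_
      obtain ⟨k, rfl⟩ := (List.mem_ofFn' _ _).1 hx
      exact (ih k (h1 k) (hs k) e').1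
    -- The axioms I17 and I18 are stated for terms given as lists.
    rw [prob_eq_ge] at hφ ⊢
    exact ⟨((preFml hΦ e).impl h).of_ax (.upBox hev hφ) (.I17 ..),
      ((preFml hΦ e).conj h).of_ax (.upDia hev hφ) (.I18 ..)⟩

/-- Every formula is provably equivalent to a formula without updates. -/
theorem of_wf (hφ : WF φ) : HasStatic φ := by
  induction φ with
  | atom p => exact of_static hφ trivial
  | bot => exact bot
  | conj φ ψ ih ih' => cases hφ with | conj h1 h2 => exact (ih h1).conj (ih' h2)
  | disj φ ψ ih ih' => cases hφ with | disj h1 h2 => exact (ih h1).disj (ih' h2)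
  | impl φ ψ ih ih' => cases hφ with | impl h1 h2 => exact (ih h1).impl (ih' h2)
  | dia i φ ih => cases hφ with | dia h1 => exact (ih h1).dia i
  | box i φ ih => cases hφ with | box h1 => exact (ih h1).box i
  | upDia F Φ sub e φ ihΦ ihsub ih =>
    cases hφ with | upDia hev h1 =>
    obtain ⟨h, ψ, hψ, hs, he⟩ := ih h1
    obtain ⟨hΦ, hsub⟩ : (∀ k, WF (Φ k)) ∧ ∀ e p, WF (sub e p) := by
      cases hev; constructor <;> assumption
    -- The formula in the scope is first replaced by its static equivalent; the preconditions and
    -- substitutions stay in place, since only static equivalents of them are required.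
    exact (update_of_static hev (fun k => ihΦ k (hΦ k)) (fun e p => ihsub e p (hsub e p))
      hψ hs e).2.of_cls_eq (.upDia hev h1)
      (cls_congr_of_repl _ _ he (.upDia (fun _ => .refl _) (fun _ _ => .refl _) .here))
  | upBox F Φ sub e φ ihΦ ihsub ih =>
    cases hφ with | upBox hev h1 =>
    obtain ⟨h, ψ, hψ, hs, he⟩ := ih h1
    obtain ⟨hΦ, hsub⟩ : (∀ k, WF (Φ k)) ∧ ∀ e p, WF (sub e p) := by
      cases hev; constructor <;> assumption
    exact (update_of_static hev (fun k => ihΦ k (hΦ k)) (fun e p => ihsub e p (hsub e p))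
      hψ hs e).1.of_cls_eq (.upBox hev h1)
      (cls_congr_of_repl _ _ he (.upBox (fun _ => .refl _) (fun _ _ => .refl _) .here))
  | prob i n α φ β ih =>
    have h1 : ∀ k, WF (φ k) := by cases hφ; assumption
    exact prob fun k => ih k (h1 k)

end HasStatic

end Reduction

/-! ### Positive functionals -/

section Functional

/-- Finitely many strict inequalities survive a small perturbation. -/
theorem exists_small {V : Type*} (l : List V) (f g : V → ℚ) (hf : ∀ p ∈ l, 0 < f p) :
    ∃ ε : ℚ, 0 < ε ∧ ∀ p ∈ l, 0 < f p + ε * g p := by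
  induction l with
  | nil => exact ⟨1, one_pos, by simp⟩
  | cons q l ih =>
    obtain ⟨ε, hε, h⟩ := ih fun p hp => hf p (List.mem_cons_of_mem _ hp)
    have hq := hf q List.mem_cons_self
    -- The second bound keeps the perturbation at `q` below half of `f q`; shrinking `ε` does no
    -- harm at the other points, where `f` is positive.
    refine ⟨min ε (f q / (2 * (|g q| + 1))), lt_min hε (by positivity), fun p hp => ?_⟩
    rcases List.mem_cons.1 hp with rfl | hp
    · set δ := min ε (f p / (2 * (|g p| + 1))) with hδ_def
      have h0 : 0 < δ := lt_min hε (by positivity)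
      have h1 : δ ≤ f p / (2 * (|g p| + 1)) := min_le_right _ _
      rw [le_div_iff₀ (by positivity)] at h1
      have h2 : -|g p| ≤ g p := neg_abs_le _
      nlinarith [abs_nonneg (g p)]
    · have hp' := h p hp
      have hfp := hf p (List.mem_cons_of_mem _ hp)
      rcases le_total 0 (g p) with hg | hg
      · have : 0 ≤ min ε (f q / (2 * (|g q| + 1))) := (lt_min hε (by positivity)).le
        positivity
      · have : min ε (f q / (2 * (|g q| + 1))) ≤ ε := min_le_left _ _
        nlinarith

variable {V : Type*} [AddCommGroup V] [Module ℚ V]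

/-- Finitely many elements of a convex cone that avoids the subspace `K` are positive under some
functional that vanishes on `K`. -/
theorem exists_functional_pos {Pos : V → Prop} {K : Submodule ℚ V}
    (hadd : ∀ v w, Pos v → Pos w → Pos (v + w))
    (hsmul : ∀ (c : ℚ) v, 0 < c → Pos v → Pos (c • v)) (hK : ∀ v, Pos v → v ∉ K) (l : List V)
    (hl : ∀ v ∈ l, Pos v) :
    ∃ f : V →ₗ[ℚ] ℚ, (∀ v ∈ K, f v = 0) ∧ ∀ v ∈ l, 0 < f v := by
  induction hn : l.length generalizing l with
  | zero =>
    rw [List.length_eq_zero_iff] at hn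
    subst hn
    exact ⟨0, by simp, by simp⟩
  | succ n ih =>
    obtain ⟨q, l, rfl⟩ := List.exists_cons_of_length_eq_add_one hn
    have hlen : l.length = n := by simpa using hn
    have hq := hl q List.mem_cons_self
    have hl' : ∀ v ∈ l, Pos v := fun v hv => hl v (List.mem_cons_of_mem _ hv)
    obtain ⟨f, hfK, hf⟩ := ih l hl' hlen
    rcases lt_trichotomy (f q) 0 with hneg | hzero | hpos
    -- Here `f` has the wrong sign at `q`. Move every `p` along `q` into the kernel of `f`: the
    -- coefficient `-(f p / f q)` is positive, so the moved vectors stay in the cone, and there is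
    -- one vector fewer.
    · obtain ⟨g, hgK, hg⟩ := ih (l.map fun p => p + (-(f p / f q)) • q) (by
        intro v hv
        obtain ⟨p, hp, rfl⟩ := List.mem_map.1 hv
        refine hadd _ _ (hl' p hp) (hsmul _ _ ?_ hq)
        have := div_neg_of_pos_of_neg (hf p hp) hneg
        linarith) (by simpa using hlen)
      -- This `h` kills `q`, and at `p` it takes the value of `g` at the moved vector, which is
      -- positive. A small multiple of `-f` then makes it positive at `q` as well.
      let h : V →ₗ[ℚ] ℚ := g - (g q / f q) • f
      have hh : ∀ p ∈ l, 0 < h p := fun p hp => by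
        have := hg _ (List.mem_map.2 ⟨p, hp, rfl⟩)
        simp only [map_add, map_smul, smul_eq_mul] at this
        simp only [h, LinearMap.sub_apply, LinearMap.smul_apply, smul_eq_mul]
        have e : f p / f q * g q = g q / f q * f p := by ring
        linarith
      have hhq : h q = 0 := by
        simp only [h, LinearMap.sub_apply, LinearMap.smul_apply, smul_eq_mul]
        rw [div_mul_cancel₀ _ hneg.ne, sub_self]
      obtain ⟨ε, hε, hs⟩ := exists_small l h (-f) hh
      refine ⟨h - ε • f, fun v hv => by simp [h, hfK v hv, hgK v hv], fun v hv => ?_⟩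
      simp only [LinearMap.sub_apply, LinearMap.smul_apply, smul_eq_mul]
      rcases List.mem_cons.1 hv with rfl | hv
      · rw [hhq]
        nlinarith
      · have := hs v hv
        simp only [Pi.neg_apply] at this
        linarith
    -- Here `f` vanishes at `q`. As `q ∉ K`, some functional that kills `K` does not kill `q`;
    -- normalised at `q`, a small multiple of it is added.
    · obtain ⟨g, hgq, hgK⟩ := Submodule.exists_le_ker_of_notMem (hK q hq)
      obtain ⟨ε, hε, hs⟩ := exists_small l f (fun v => (g q)⁻¹ * g v) hf
      refine ⟨f + ε • (g q)⁻¹ • g, fun v hv => ?_, fun v hv => ?_⟩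
      · have : g v = 0 := hgK hv
        simp [hfK v hv, this]
      · simp only [LinearMap.add_apply, LinearMap.smul_apply, smul_eq_mul]
        rcases List.mem_cons.1 hv with rfl | hv
        · rw [hzero, inv_mul_cancel₀ hgq]
          linarith
        · exact hs v hv
    · refine ⟨f, hfK, fun v hv => ?_⟩
      rcases List.mem_cons.1 hv with rfl | hv
      · exact hpos
      · exact hf v hv

end Functional

/-! ### Valuations on the lower sets of a finite order -/

/-- Remove a maximal point `s` from `U`. Then `U` is the union of the rest with `Iic s`, and these
two meet in `Iio s`, so modularity gives `s` the mass `ρ (Iic s) - ρ (Iio s)`, which does not depend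
on `U`. -/
theorem valuation_eq_sum {W : Type*} [PartialOrder W] [Fintype W] (ρ : LowerSet W → ℚ)
    (hbot : ρ ⊥ = 0) (hmod : ∀ U V, ρ (U ⊔ V) = ρ U + ρ V - ρ (U ⊓ V)) (U : LowerSet W) :
    (open scoped Classical in
    ρ U = ∑ s ∈ Finset.univ.filter (· ∈ U), (ρ (LowerSet.Iic s) - ρ (LowerSet.Iio s))) := by
  classical
  induction U using WellFoundedLT.induction with
  | _ U ih =>
    by_cases hU : U = ⊥
    · subst hU
      simp [hbot]
    obtain ⟨s, hs⟩ : ∃ s, Maximal (· ∈ U) s := by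
      have hne : (U : Set W).Nonempty := by
        rw [Set.nonempty_iff_ne_empty]
        intro h
        exact hU (SetLike.coe_injective (by simpa using h))
      exact (Set.toFinite (U : Set W)).exists_maximal hne
    have hmax : ∀ b ∈ U, s ≤ b → b = s := fun b hb hsb => (hs.eq_of_le hb hsb).symm
    have hlt : U.erase s < U := LowerSet.erase_lt.2 hs.prop
    have hmem : ∀ b, b ∈ U.erase s ↔ b ∈ U ∧ b ≠ s := fun b => by
      rw [← SetLike.mem_coe, LowerSet.coe_erase]
      constructor
      · rintro ⟨h1, h2⟩
        exact ⟨h1, fun h => h2 (by simp [h])⟩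
      · rintro ⟨h1, h2⟩
        exact ⟨h1, fun h => h2 (hmax b h1 (by simpa using h))⟩
    have hsup : U.erase s ⊔ LowerSet.Iic s = U := by
      ext b
      change b ∈ U.erase s ∨ b ≤ s ↔ b ∈ U
      rw [hmem]
      constructor
      · rintro (h | h)
        exacts [h.1, U.lower h hs.prop]
      · intro h
        by_cases hb : b = s
        exacts [Or.inr hb.le, Or.inl ⟨h, hb⟩]
    have hinf : U.erase s ⊓ LowerSet.Iic s = LowerSet.Iio s := by
      ext b
      change b ∈ U.erase s ∧ b ≤ s ↔ b < s
      rw [hmem]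
      constructor
      · rintro ⟨⟨-, h⟩, h'⟩
        exact lt_of_le_of_ne h' h
      · intro h
        exact ⟨⟨U.lower h.le hs.prop, h.ne⟩, h.le⟩
    have h1 := hmod (U.erase s) (LowerSet.Iic s)
    rw [hsup, hinf, ih _ hlt] at h1
    have h2 : Finset.univ.filter (· ∈ U) = insert s (Finset.univ.filter (· ∈ U.erase s)) := by
      ext b
      simp only [Finset.mem_filter, Finset.mem_univ, true_and, Finset.mem_insert, hmem]
      constructor
      · intro h
        by_cases hb : b = s
        exacts [Or.inl hb, Or.inr ⟨h, hb⟩]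
      · rintro (rfl | h)
        exacts [hs.prop, h.1]
    rw [h1, h2, Finset.sum_insert (by simp [hmem])]
    ring

/-! ### Prime filters -/

/-- The prime filters of a Heyting algebra. -/
structure PrimeFilter (L : Type*) [HeytingAlgebra L] where
  carrier : Set L
  top_mem : ⊤ ∈ carrier
  bot_notMem : ⊥ ∉ carrier
  mem_of_le : ∀ {x y}, x ≤ y → x ∈ carrier → y ∈ carrier
  inf_mem : ∀ {x y}, x ∈ carrier → y ∈ carrier → x ⊓ y ∈ carrier
  mem_or_mem : ∀ {x y}, x ⊔ y ∈ carrier → x ∈ carrier ∨ y ∈ carrier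

namespace PrimeFilter

variable {L : Type*} [HeytingAlgebra L]

instance : Membership L (PrimeFilter L) := ⟨fun T x => x ∈ T.carrier⟩

variable {T : PrimeFilter L} {x y : L}

theorem top : ⊤ ∈ T := T.top_mem

theorem bot : ⊥ ∉ T := T.bot_notMem

theorem of_le (h : x ≤ y) (hx : x ∈ T) : y ∈ T := T.mem_of_le h hx

theorem inf_iff : x ⊓ y ∈ T ↔ x ∈ T ∧ y ∈ T :=
  ⟨fun h => ⟨of_le inf_le_left h, of_le inf_le_right h⟩, fun h => T.inf_mem h.1 h.2⟩

theorem sup_iff : x ⊔ y ∈ T ↔ x ∈ T ∨ y ∈ T :=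
  ⟨T.mem_or_mem, fun h => h.elim (of_le le_sup_left) (of_le le_sup_right)⟩

theorem himp_mem (h : x ⇨ y ∈ T) (hx : x ∈ T) : y ∈ T :=
  of_le himp_inf_le (inf_iff.2 ⟨h, hx⟩)

theorem compl_iff (h : x ⊔ xᶜ = ⊤) : xᶜ ∈ T ↔ x ∉ T := by
  refine ⟨fun h1 h2 => bot (T := T) (of_le (inf_compl_self x).le (inf_iff.2 ⟨h2, h1⟩)),
    fun h1 => ?_⟩
  exact (sup_iff.1 (h ▸ top : x ⊔ xᶜ ∈ T)).resolve_left h1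

theorem finset_sup_iff {ι : Type*} {S : Finset ι} {f : ι → L} :
    S.sup f ∈ T ↔ ∃ k ∈ S, f k ∈ T := by
  classical
  induction S using Finset.induction_on with
  | empty => simpa using bot
  | insert k S _ ih => simp [sup_iff, ih]

theorem finset_inf_iff {ι : Type*} {S : Finset ι} {f : ι → L} :
    S.inf f ∈ T ↔ ∀ k ∈ S, f k ∈ T := by
  classical
  induction S using Finset.induction_on with
  | empty => simpa using top
  | insert k S _ ih => simp [inf_iff, ih]

/-- A filter that does not contain `y` extends to a prime filter that does not contain `y`. -/
theorem exists_of_notMem {S : Set L} (htop : ⊤ ∈ S) (hinf : ∀ x ∈ S, ∀ y ∈ S, x ⊓ y ∈ S)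
    (hle : ∀ {x y}, x ≤ y → x ∈ S → y ∈ S) (hy : y ∉ S) :
    ∃ T : PrimeFilter L, (∀ x ∈ S, x ∈ T) ∧ y ∉ T := by
  have hF : Order.IsPFilter S := Order.IsPFilter.of_def ⟨⊤, htop⟩
    (fun a ha b hb => ⟨a ⊓ b, hinf a ha b hb, inf_le_left, inf_le_right⟩) hle
  have hdis : Disjoint ((hF.toPFilter : Order.PFilter L) : Set L)
      (Order.Ideal.principal y : Set L) := by
    rw [Set.disjoint_left]
    intro a ha hay
    exact hy (hle hay ha)
  obtain ⟨J, hJ, hIJ, hFJ⟩ := DistribLattice.prime_ideal_of_disjoint_filter_ideal hdis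
  rw [Set.disjoint_left] at hFJ
  refine ⟨⟨{x | x ∉ J}, hFJ htop, fun h => h J.bot_mem, fun hxy hx h => hx (J.lower hxy h),
    fun hx hy h => (hJ.mem_or_mem h).elim hx hy, fun {a b} hab => ?_⟩, fun x hx => hFJ hx,
    fun h => h (hIJ (Order.Ideal.mem_principal.2 le_rfl))⟩
  by_contra! h
  exact hab (J.sup_mem (not_not.1 h.1) (not_not.1 h.2))

theorem le_of_forall (h : ∀ T : PrimeFilter L, x ∈ T → y ∈ T) : x ≤ y := by
  by_contra hxy
  obtain ⟨T, hT, hy⟩ := exists_of_notMem (S := {z | x ≤ z}) (le_top (a := x))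
    (fun a ha b hb => le_inf ha hb) (fun {a b} hab ha => le_trans ha hab) hxy
  exact hy (h T (hT x le_rfl))

theorem eq_of_forall (h : ∀ T : PrimeFilter L, x ∈ T ↔ y ∈ T) : x = y :=
  le_antisymm (le_of_forall fun T => (h T).1) (le_of_forall fun T => (h T).2)

/-- If `x ⇨ y` is not in `T`, some prime filter above `T` contains `x` and not `y`. -/
theorem exists_of_himp_notMem (h : x ⇨ y ∉ T) :
    ∃ T' : PrimeFilter L, (∀ z ∈ T, z ∈ T') ∧ x ∈ T' ∧ y ∉ T' := by
  -- The set `{z | x ⇨ z ∈ T}` is the filter generated by `T` and `x`.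
  obtain ⟨T', hT', hy⟩ := exists_of_notMem (S := {z | x ⇨ z ∈ T}) (y := y)
    (by simpa using top) (fun a ha b hb => by
      show x ⇨ (a ⊓ b) ∈ T
      rw [himp_inf_distrib]
      exact inf_iff.2 ⟨ha, hb⟩) (fun {a b} hab ha => of_le (himp_le_himp_left hab) ha) h
  exact ⟨T', fun z hz => hT' z (of_le le_himp hz), hT' x (by simpa using top), hy⟩

end PrimeFilter

/-! ### Linear inequalities in the Lindenbaum algebra -/

section Terms

variable {AtProp : Type u} {Ag : Type v}

namespace Lind

/-- A formula representing an element of the Lindenbaum algebra. -/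
def rep (x : Lind AtProp Ag) : Fml AtProp Ag := (cls_surj x).choose

theorem wf_rep (x : Lind AtProp Ag) : WF (rep x) := (cls_surj x).choose_spec.choose

theorem cls_rep (x : Lind AtProp Ag) : cls (rep x) (wf_rep x) = x :=
  (cls_surj x).choose_spec.choose_spec

/-- The term over formulas representing a term over the Lindenbaum algebra. -/
def repTerm (t : List (ℚ × Lind AtProp Ag)) : List (ℚ × Fml AtProp Ag) :=
  t.map fun x => (x.1, rep x.2)

theorem wf_ge {i : Ag} {t : List (ℚ × Fml AtProp Ag)} {β : ℚ} (h : ∀ x ∈ t, WF x.2) :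
    WF (ge i t β) := .prob fun k => h _ (List.get_mem t k)

theorem wf_repTerm (t : List (ℚ × Lind AtProp Ag)) : ∀ x ∈ repTerm t, WF x.2 := by
  intro x hx
  obtain ⟨y, -, rfl⟩ := List.mem_map.1 hx
  exact wf_rep _

theorem wf_ge_repTerm (i : Ag) (t : List (ℚ × Lind AtProp Ag)) (β : ℚ) :
    WF (ge i (repTerm t) β) := wf_ge (wf_repTerm t)

/-- The element `t ≥ β` of the Lindenbaum algebra. -/
def gel (i : Ag) (t : List (ℚ × Lind AtProp Ag)) (β : ℚ) : Lind AtProp Ag :=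
  cls (ge i (repTerm t) β) (wf_ge_repTerm i t β)

/-- `gel` is built from chosen representatives; this makes the choice immaterial, so that axioms
stated for concrete formulas transfer. -/
theorem cls_prob {i : Ag} {n : ℕ} {α : Fin n → ℚ} {φ : Fin n → Fml AtProp Ag} {β : ℚ}
    (hφ : ∀ k, WF (φ k)) : cls (prob i n α φ β) (.prob hφ) =
      gel i (List.ofFn fun k => (α k, cls (φ k) (hφ k))) β := by
  rw [cls_prob_congr hφ (fun k => wf_rep (cls (φ k) (hφ k))) fun k => (cls_rep _).symm]
  unfold gel
  congr 1
  rw [prob_eq_ge]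
  congr 1
  simp [repTerm, List.map_ofFn, Function.comp_def]

theorem cls_ge {i : Ag} (t : List (ℚ × WFml AtProp Ag)) (β : ℚ)
    (h : WF (ge i (t.map fun x => (x.1, x.2.1)) β)) :
    cls (ge i (t.map fun x => (x.1, x.2.1)) β) h =
      gel i (t.map fun x => (x.1, cls x.2.1 x.2.2)) β := by
  have h1 := cls_prob (i := i) (n := t.length) (α := fun k => (t.get k).1) (β := β)
    (φ := fun k => (t.get k).2.1) fun k => (t.get k).2.2
  have h2 : (List.ofFn fun k : Fin t.length => ((t.get k).1, cls (t.get k).2.1 (t.get k).2.2)) =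
      t.map fun x => (x.1, cls x.2.1 x.2.2) := by
    conv_rhs => rw [← List.ofFn_get t, List.map_ofFn]
    rfl
  rw [h2] at h1
  rw [← h1]
  congr 1
  rw [prob_eq_ge]
  congr 1
  conv_lhs => rw [← List.ofFn_get t, List.map_ofFn]
  rfl

theorem repTerm_append (t t' : List (ℚ × Lind AtProp Ag)) :
    repTerm (t ++ t') = repTerm t ++ repTerm t' := List.map_append

/-- The term `d · t`. -/
def smulL (d : ℚ) (t : List (ℚ × Lind AtProp Ag)) : List (ℚ × Lind AtProp Ag) :=
  t.map fun x => (d * x.1, x.2)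

theorem repTerm_smulL (d : ℚ) (t : List (ℚ × Lind AtProp Ag)) :
    repTerm (smulL d t) = smulTerm d (repTerm t) := by
  simp [repTerm, smulL, smulTerm]

-- The axioms for inequalities in the Lindenbaum algebra

variable (i : Ag)

theorem gel_sub_self (t : List (ℚ × Lind AtProp Ag)) : gel i (t ++ smulL (-1) t) 0 = ⊤ := by
  refine cls_eq_top_iff.2 (.ax (wf_ge_repTerm i _ _) ?_)
  rw [repTerm_append, repTerm_smulL]
  exact .N0 i (repTerm t)

theorem gel_append_zero (t : List (ℚ × Lind AtProp Ag)) (β : ℚ) (x : Lind AtProp Ag) :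
    gel i (t ++ [(0, x)]) β = gel i t β := by
  refine (cls_eq_iff.2 (.ax (.iff (wf_ge_repTerm i _ _) (wf_ge_repTerm i _ _)) ?_)).symm
  rw [repTerm_append]
  exact .N1 i (repTerm t) β (rep x)

theorem gel_perm {t t' : List (ℚ × Lind AtProp Ag)} (h : t.Perm t') (β : ℚ) :
    gel i t β = gel i t' β := by
  have key : ∀ {t t' : List (ℚ × Lind AtProp Ag)}, t.Perm t' → gel i t β ≤ gel i t' β :=
    fun h => .ax (.impl (wf_ge_repTerm i _ _) (wf_ge_repTerm i _ _)) (.N2 _ _ _ _ (h.map _))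
  exact le_antisymm (key h) (key h.symm)

theorem gel_add (l : List (ℚ × ℚ × Lind AtProp Ag)) (β β' : ℚ) :
    gel i (l.map fun x => (x.1, x.2.2)) β ⊓ gel i (l.map fun x => (x.2.1, x.2.2)) β' ≤
      gel i (l.map fun x => (x.1 + x.2.1, x.2.2)) (β + β') := by
  refine cls_le_iff (hφ := .conj (wf_ge_repTerm i _ _) (wf_ge_repTerm i _ _)).2
    (.ax (.impl (.conj (wf_ge_repTerm i _ _) (wf_ge_repTerm i _ _)) (wf_ge_repTerm i _ _)) ?_)
  have := Ax.N3 i (l.map fun x => (x.1, x.2.1, rep x.2.2)) β β'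
  simpa [repTerm, Function.comp_def] using this

theorem gel_smul (t : List (ℚ × Lind AtProp Ag)) (β : ℚ) {d : ℚ} (hd : 0 ≤ d) :
    gel i t β ≤ gel i (smulL d t) (d * β) := by
  refine cls_le_iff.2 (.ax (.impl (wf_ge_repTerm i _ _) (wf_ge_repTerm i _ _)) ?_)
  rw [repTerm_smulL]
  exact .N4 i _ _ _ hd

theorem gel_total (t : List (ℚ × Lind AtProp Ag)) (β : ℚ) :
    gel i t β ⊔ gel i (smulL (-1) t) (-β) = ⊤ := by
  refine cls_eq_top_iff (hφ := .disj (wf_ge_repTerm i _ _) (wf_ge_repTerm i _ _)).2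
    (.ax (.disj (wf_ge_repTerm i _ _) (wf_ge_repTerm i _ _)) ?_)
  rw [repTerm_smulL]
  exact .N5 i _ _

theorem gel_strict (t : List (ℚ × Lind AtProp Ag)) {β γ : ℚ} (h : γ < β) :
    gel i t β ≤ (gel i (smulL (-1) t) (-γ))ᶜ := by
  refine cls_le_iff (hψ := .neg (wf_ge_repTerm i _ _)).2
    (.ax (.impl (wf_ge_repTerm i _ _) (.neg (wf_ge_repTerm i _ _))) ?_)
  rw [repTerm_smulL]
  exact .N6 i _ _ _ h

theorem gel_append_zeros (t : List (ℚ × Lind AtProp Ag)) (β : ℚ) {ι : Type*} (r : List ι)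
    (f : ι → Lind AtProp Ag) : gel i (t ++ r.map fun y => (0, f y)) β = gel i t β := by
  induction r generalizing t with
  | nil => simp
  | cons y r ih =>
    have : (t ++ (y :: r).map fun y => ((0 : ℚ), f y)) =
        (t ++ [(0, f y)]) ++ r.map fun y => (0, f y) := by simp
    rw [this, ih, gel_append_zero]

theorem gel_cons_zero (t : List (ℚ × Lind AtProp Ag)) (β : ℚ) (x : Lind AtProp Ag) :
    gel i ((0, x) :: t) β = gel i t β := by
  rw [← gel_append_zero i t β x]
  exact gel_perm i (List.perm_append_singleton _ _).symm β

/-- The addition axiom needs both terms to run over the same formulas, so each is padded with zero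
coefficients on the entries of the other. -/
theorem gel_append (t t' : List (ℚ × Lind AtProp Ag)) (β β' : ℚ) :
    gel i t β ⊓ gel i t' β' ≤ gel i (t ++ t') (β + β') := by
  have h := gel_add i (t.map (fun x => (x.1, (0 : ℚ), x.2)) ++
    t'.map fun x => ((0 : ℚ), x.1, x.2)) β β'
  simp only [List.map_append, List.map_map, Function.comp_def, add_zero, zero_add] at h
  rw [gel_append_zeros i _ β t' Prod.snd,
    gel_perm i (t' := t' ++ t.map fun x => (0, x.2)) (by simpa using List.perm_append_comm) β',
    gel_append_zeros] at h
  simpa using h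

/-- In both directions a coefficient is moved between two equal entries by adding the theorem `c·x -
c·x ≥ 0`. -/
theorem gel_merge (a b : ℚ) (x : Lind AtProp Ag) (r : List (ℚ × Lind AtProp Ag)) (β : ℚ) :
    gel i ((a, x) :: (b, x) :: r) β = gel i ((a + b, x) :: r) β := by
  -- The zero coefficients over `r` give this theorem the shape that the addition axiom requires.
  have hz : ∀ c : ℚ, gel i ((c, x) :: (-c, x) :: r.map fun y => (0, y.2)) 0 = ⊤ := fun c => by
    have h := gel_sub_self i [(c, x)]
    rw [← gel_append_zeros i _ 0 r Prod.snd] at h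
    simpa [smulL] using h
  have hswap : gel i ((0, x) :: (a + b, x) :: r) β = gel i ((a + b, x) :: (0, x) :: r) β :=
    gel_perm i (List.Perm.swap _ _ _) β
  rw [gel_cons_zero] at hswap
  rw [hswap]
  apply le_antisymm
  · have h := gel_add i ((a, b, x) :: (b, -b, x) :: r.map fun y => (y.1, 0, y.2)) β 0
    simp only [List.map_cons, List.map_map, Function.comp_def, add_zero, add_neg_cancel, hz,
      inf_top_eq] at h
    simpa using h
  · have h := gel_add i ((a + b, -b, x) :: (0, b, x) :: r.map fun y => (y.1, 0, y.2)) β 0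
    have hz' := hz (-b)
    rw [neg_neg] at hz'
    simp only [List.map_cons, List.map_map, Function.comp_def, add_zero, hz', inf_top_eq] at h
    simpa using h

/-- The vector of a term. -/
def vec (t : List (ℚ × Lind AtProp Ag)) : Lind AtProp Ag →₀ ℚ :=
  (t.map fun x => Finsupp.single x.2 x.1).sum

theorem vec_cons (c : ℚ) (x : Lind AtProp Ag) (t : List (ℚ × Lind AtProp Ag)) :
    vec ((c, x) :: t) = Finsupp.single x c + vec t := by simp [vec]

theorem vec_nil : vec ([] : List (ℚ × Lind AtProp Ag)) = 0 := rfl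

theorem vec_append (t t' : List (ℚ × Lind AtProp Ag)) : vec (t ++ t') = vec t + vec t' := by
  simp [vec]

theorem vec_perm {t t' : List (ℚ × Lind AtProp Ag)} (h : t.Perm t') : vec t = vec t' :=
  (h.map _).sum_eq

theorem vec_smulL (d : ℚ) (t : List (ℚ × Lind AtProp Ag)) : vec (smulL d t) = d • vec t := by
  induction t with
  | nil => simp [vec, smulL]
  | cons x t ih =>
    have : smulL d (x :: t) = (d * x.1, x.2) :: smulL d t := rfl
    rw [this, vec_cons, ih, vec_cons x.1 x.2, smul_add, Finsupp.smul_single, smul_eq_mul]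

theorem vec_apply_eq_zero {t : List (ℚ × Lind AtProp Ag)} {x : Lind AtProp Ag}
    (h : ∀ y ∈ t, y.2 ≠ x) : vec t x = 0 := by
  induction t with
  | nil => rfl
  | cons y t ih =>
    rw [vec_cons y.1 y.2, Finsupp.add_apply, ih fun z hz => h z (List.mem_cons_of_mem _ hz),
      Finsupp.single_eq_of_ne (h y List.mem_cons_self).symm, add_zero]

/-- Look at the first entry. If its element does not recur in `s`, its coefficient is zero and it
can be dropped; otherwise it is merged with another occurrence. Either way `s` becomes shorter. -/
theorem gel_append_of_vec_eq_zero (s r : List (ℚ × Lind AtProp Ag)) (hs : vec s = 0) (β : ℚ) :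
    gel i (s ++ r) β = gel i r β := by
  induction hn : s.length using Nat.strong_induction_on generalizing s with
  | _ n ih =>
    match s, hs, hn with
    | [], _, _ => rfl
    | (c, x) :: s, hs, hn =>
      by_cases hx : ∀ y ∈ s, y.2 ≠ x
      · have h0 := DFunLike.congr_fun hs x
        rw [vec_cons, Finsupp.add_apply, vec_apply_eq_zero hx] at h0
        simp only [Finsupp.single_eq_same, add_zero, Finsupp.coe_zero, Pi.zero_apply] at h0
        subst h0
        rw [vec_cons, Finsupp.single_zero, zero_add] at hs
        rw [List.cons_append, gel_cons_zero]
        exact ih s.length (by simp [← hn]) s hs rfl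
      · push Not at hx
        obtain ⟨⟨c', x'⟩, hy, rfl⟩ := hx
        obtain ⟨s', hs'⟩ : ∃ s', s.Perm ((c', x') :: s') := by
          classical exact ⟨_, List.perm_cons_erase hy⟩
        rw [gel_perm i ((hs'.cons _).append_right r)]
        simp only [List.cons_append]
        rw [gel_merge, ← List.cons_append]
        refine ih (s'.length + 1) ?_ _ ?_ rfl
        · have := hs'.length_eq
          simp only [List.length_cons] at this hn
          omega
        · rw [vec_cons, vec_perm hs', vec_cons] at hs
          rw [vec_cons, Finsupp.single_add, add_assoc]
          exact hs

/-- Prepending `-t' + t'` to `t` and `-t' + t` to `t'` changes nothing, as both have vector zero,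
and the results are permutations of each other. Inequalities thus depend only on a vector, and
linear algebra becomes applicable. -/
theorem gel_congr {t t' : List (ℚ × Lind AtProp Ag)} (h : vec t = vec t') (β : ℚ) :
    gel i t β = gel i t' β := by
  rw [← gel_append_of_vec_eq_zero i (smulL (-1) t' ++ t') t (by
      rw [vec_append, vec_smulL]; simp) β,
    ← gel_append_of_vec_eq_zero i (smulL (-1) t' ++ t) t' (by
      rw [vec_append, vec_smulL, h]; simp) β]
  refine gel_perm i ?_ β
  rw [List.append_assoc, List.append_assoc]
  exact List.perm_append_comm.append_left _

/-- The element `v ≥ 0` of the Lindenbaum algebra. -/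
def nonneg (v : Lind AtProp Ag →₀ ℚ) : Lind AtProp Ag :=
  gel i (v.support.toList.map fun x => (v x, x)) 0

theorem vec_toList (v : Lind AtProp Ag →₀ ℚ) :
    vec (v.support.toList.map fun x => (v x, x)) = v := by
  conv_rhs => rw [← Finsupp.sum_single v]
  rw [vec, List.map_map, Finset.sum_map_toList]
  rfl

theorem gel_zero_eq (t : List (ℚ × Lind AtProp Ag)) : gel i t 0 = nonneg i (vec t) :=
  gel_congr i (vec_toList _).symm 0

theorem exists_term (v : Lind AtProp Ag →₀ ℚ) : ∃ t, vec t = v := ⟨_, vec_toList v⟩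

theorem nonneg_add (v w : Lind AtProp Ag →₀ ℚ) :
    nonneg i v ⊓ nonneg i w ≤ nonneg i (v + w) := by
  obtain ⟨t, rfl⟩ := exists_term v
  obtain ⟨t', rfl⟩ := exists_term w
  rw [← vec_append, ← gel_zero_eq, ← gel_zero_eq, ← gel_zero_eq]
  simpa using gel_append i t t' 0 0

theorem nonneg_smul (v : Lind AtProp Ag →₀ ℚ) {d : ℚ} (hd : 0 ≤ d) :
    nonneg i v ≤ nonneg i (d • v) := by
  obtain ⟨t, rfl⟩ := exists_term v
  rw [← vec_smulL, ← gel_zero_eq, ← gel_zero_eq]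
  simpa using gel_smul i t 0 hd

theorem nonneg_total (v : Lind AtProp Ag →₀ ℚ) : nonneg i v ⊔ nonneg i (-v) = ⊤ := by
  obtain ⟨t, rfl⟩ := exists_term v
  have h := gel_total i t 0
  rw [neg_zero, gel_zero_eq, gel_zero_eq, vec_smulL, neg_one_smul] at h
  exact h

theorem nonneg_zero : nonneg i (0 : Lind AtProp Ag →₀ ℚ) = ⊤ := by
  have h := nonneg_total i (0 : Lind AtProp Ag →₀ ℚ)
  rwa [neg_zero, sup_idem] at h

theorem gel_top_one : gel i [((1 : ℚ), (⊤ : Lind AtProp Ag))] 1 = ⊤ ∧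
    gel i [((-1 : ℚ), (⊤ : Lind AtProp Ag))] (-1) = ⊤ := by
  have hax : Ax (Fml.eq i [(1, (top : Fml AtProp Ag))] 1) := .P2 i
  have h1 : WF (ge i [((1 : ℚ), (top : Fml AtProp Ag))] 1) := wf_ge (by simpa using WF.top)
  have h2 : WF (ge i [((-1 : ℚ), (top : Fml AtProp Ag))] (-1)) := wf_ge (by simpa using WF.top)
  have hle : Fml.le i [((1 : ℚ), (top : Fml AtProp Ag))] 1 =
      ge i [((-1 : ℚ), (top : Fml AtProp Ag))] (-1) := by simp [Fml.le, smulTerm]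
  rw [Fml.eq, hle] at hax
  have h := cls_eq_top_iff (hφ := .conj h1 h2).2 (.ax (.conj h1 h2) hax)
  rw [cls_conj h1 h2, inf_eq_top_iff] at h
  exact ⟨(cls_ge [((1 : ℚ), (⟨top, .top⟩ : WFml AtProp Ag))] 1 h1).symm.trans h.1,
    (cls_ge [((-1 : ℚ), (⟨top, .top⟩ : WFml AtProp Ag))] (-1) h2).symm.trans h.2⟩

theorem gel_top (c : ℚ) : gel i [(c, (⊤ : Lind AtProp Ag))] c = ⊤ := by
  rcases le_total 0 c with hc | hc
  · have h := gel_smul i [((1 : ℚ), (⊤ : Lind AtProp Ag))] 1 hc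
    rw [(gel_top_one i).1, top_le_iff] at h
    simpa [smulL] using h
  · have h := gel_smul i [((-1 : ℚ), (⊤ : Lind AtProp Ag))] (-1) (neg_nonneg.2 hc)
    rw [(gel_top_one i).2, top_le_iff] at h
    simpa [smulL] using h

/-- Since `μ(⊤) = 1`, the bound `β` can be absorbed as the summand `-β · μ(⊤)`. -/
theorem gel_eq_nonneg (t : List (ℚ × Lind AtProp Ag)) (β : ℚ) :
    gel i t β = nonneg i (vec t - β • Finsupp.single ⊤ 1) := by
  have hv : vec t - β • Finsupp.single ⊤ 1 = vec (t ++ [(-β, ⊤)]) := by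
    rw [vec_append, vec_cons, vec_nil, add_zero, Finsupp.smul_single, smul_eq_mul, mul_one,
      Finsupp.single_neg, sub_eq_add_neg]
  rw [hv, ← gel_zero_eq]
  apply le_antisymm
  · have h := gel_append i t [(-β, ⊤)] β (-β)
    rwa [gel_top, inf_top_eq, add_neg_cancel] at h
  · have h := gel_append i (t ++ [(-β, ⊤)]) [(β, ⊤)] 0 β
    rw [gel_top, inf_top_eq, zero_add] at h
    refine h.trans (gel_congr i ?_ β).le
    rw [vec_append, ← hv, vec_cons, vec_nil, add_zero, Finsupp.smul_single, smul_eq_mul, mul_one,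
      sub_add_cancel]

/-- The axiom N6 with `0 < 1`. It later forces the functional of a prime filter to be positive at
`⊤`, so that it can be normalised. -/
theorem nonneg_neg_top : nonneg i (-Finsupp.single (⊤ : Lind AtProp Ag) 1) = ⊥ := by
  have h := gel_strict i [((1 : ℚ), (⊤ : Lind AtProp Ag))] (zero_lt_one (α := ℚ))
  rw [(gel_top_one i).1, top_le_iff, neg_zero, gel_zero_eq, vec_smulL, vec_cons, vec_nil, add_zero,
    neg_one_smul] at h
  exact top_disjoint.1 (le_compl_iff_disjoint_right.1 h.ge)

theorem nonneg_bot : nonneg i (Finsupp.single (⊥ : Lind AtProp Ag) 1) = ⊤ ∧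
    nonneg i (-Finsupp.single (⊥ : Lind AtProp Ag) 1) = ⊤ := by
  have hax : Ax (Fml.eq i [(1, (bot : Fml AtProp Ag))] 0) := .P1 i
  have h1 : WF (ge i [((1 : ℚ), (bot : Fml AtProp Ag))] 0) := wf_ge (by simpa using WF.bot)
  have h2 : WF (ge i [((-1 : ℚ), (bot : Fml AtProp Ag))] 0) := wf_ge (by simpa using WF.bot)
  have hle : Fml.le i [((1 : ℚ), (bot : Fml AtProp Ag))] 0 =
      ge i [((-1 : ℚ), (bot : Fml AtProp Ag))] 0 := by simp [Fml.le, smulTerm]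
  rw [Fml.eq, hle] at hax
  have h := cls_eq_top_iff (hφ := .conj h1 h2).2 (.ax (.conj h1 h2) hax)
  rw [cls_conj h1 h2, inf_eq_top_iff] at h
  have e1 := (cls_ge [((1 : ℚ), (⟨bot, .bot⟩ : WFml AtProp Ag))] 0 h1).symm.trans h.1
  have e2 := (cls_ge [((-1 : ℚ), (⟨bot, .bot⟩ : WFml AtProp Ag))] 0 h2).symm.trans h.2
  rw [gel_zero_eq] at e1 e2
  simp only [List.map_cons, List.map_nil, vec_cons, vec_nil, add_zero, cls_bot,
    Finsupp.single_neg] at e1 e2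
  exact ⟨e1, e2⟩

-- Modularity, monotonicity and strictness of measures in the Lindenbaum algebra

variable (x y : Lind AtProp Ag)

theorem nonneg_modular :
    nonneg i (Finsupp.single x 1 + Finsupp.single y 1 -
      (Finsupp.single (x ⊔ y) 1 + Finsupp.single (x ⊓ y) 1)) = ⊤ ∧
    nonneg i (Finsupp.single (x ⊔ y) 1 + Finsupp.single (x ⊓ y) 1 -
      (Finsupp.single x 1 + Finsupp.single y 1)) = ⊤ := by
  obtain ⟨φ, hφ, rfl⟩ := cls_surj x
  obtain ⟨ψ, hψ, rfl⟩ := cls_surj y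
  have hax : Ax (eqTerm i [(1, φ), (1, ψ)] [(1, disj φ ψ), (1, conj φ ψ)]) := .P3 i φ ψ
  simp only [eqTerm, geTerm, smulTerm, List.map_cons, List.map_nil, List.cons_append,
    List.nil_append, mul_one] at hax
  have h1 : WF (ge i [(1, φ), (1, ψ), (-1, disj φ ψ), (-1, conj φ ψ)] 0) :=
    wf_ge (by simp [hφ, hψ, WF.disj hφ hψ, WF.conj hφ hψ])
  have h2 : WF (ge i [(1, disj φ ψ), (1, conj φ ψ), (-1, φ), (-1, ψ)] 0) :=
    wf_ge (by simp [hφ, hψ, WF.disj hφ hψ, WF.conj hφ hψ])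
  have h := cls_eq_top_iff (hφ := .conj h1 h2).2 (.ax (.conj h1 h2) hax)
  rw [cls_conj h1 h2, inf_eq_top_iff] at h
  have e1 := (cls_ge [((1 : ℚ), (⟨φ, hφ⟩ : WFml AtProp Ag)), (1, ⟨ψ, hψ⟩),
    (-1, ⟨disj φ ψ, .disj hφ hψ⟩), (-1, ⟨conj φ ψ, .conj hφ hψ⟩)] 0 h1).symm.trans h.1
  have e2 := (cls_ge [((1 : ℚ), (⟨disj φ ψ, .disj hφ hψ⟩ : WFml AtProp Ag)),
    (1, ⟨conj φ ψ, .conj hφ hψ⟩), (-1, ⟨φ, hφ⟩), (-1, ⟨ψ, hψ⟩)] 0 h2).symm.trans h.2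
  rw [gel_zero_eq] at e1 e2
  simp only [List.map_cons, List.map_nil, vec_cons, vec_nil, add_zero, cls_disj hφ hψ,
    cls_conj hφ hψ, Finsupp.single_neg] at e1 e2
  constructor
  · rw [← e1]
    congr 1
    abel
  · rw [← e2]
    congr 1
    abel

theorem cls_geTerm {φ ψ : Fml AtProp Ag} (hφ : WF φ) (hψ : WF ψ)
    (h : WF (geTerm i [(1, φ)] [(1, ψ)])) : cls (geTerm i [(1, φ)] [(1, ψ)]) h =
      nonneg i (Finsupp.single (cls φ hφ) 1 - Finsupp.single (cls ψ hψ) 1) := by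
  have e0 : geTerm i [(1, φ)] [(1, ψ)] = ge i [(1, φ), (-1, ψ)] 0 := by
    simp [geTerm, smulTerm]
  have h1 : WF (ge i [(1, φ), (-1, ψ)] 0) := e0 ▸ h
  have e1 := cls_ge [((1 : ℚ), (⟨φ, hφ⟩ : WFml AtProp Ag)), (-1, ⟨ψ, hψ⟩)] 0 h1
  rw [gel_zero_eq] at e1
  simp only [List.map_cons, List.map_nil, vec_cons, vec_nil, add_zero, Finsupp.single_neg,
    ← sub_eq_add_neg] at e1
  rw [← e1]
  congr 1

theorem wf_geTerm {φ ψ : Fml AtProp Ag} (hφ : WF φ) (hψ : WF ψ) :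
    WF (geTerm i [(1, φ)] [(1, ψ)]) := wf_ge (by simp [smulTerm, hφ, hψ])

variable {x y}

theorem nonneg_mono (h : x ≤ y) :
    nonneg i (Finsupp.single y 1 - Finsupp.single x 1) = ⊤ := by
  obtain ⟨φ, hφ, rfl⟩ := cls_surj x
  obtain ⟨ψ, hψ, rfl⟩ := cls_surj y
  rw [← cls_geTerm i hψ hφ (wf_geTerm i hψ hφ)]
  exact cls_eq_top_iff.2 (.subMu i h)

theorem box_inf_nonneg : box i (x ⇨ y) ⊓
    (nonneg i (Finsupp.single x 1 - Finsupp.single y 1) ⊓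
      nonneg i (Finsupp.single y 1 - Finsupp.single x 1)) = box i ((y ⇨ x) ⊓ (x ⇨ y)) := by
  obtain ⟨φ, hφ, rfl⟩ := cls_surj x
  obtain ⟨ψ, hψ, rfl⟩ := cls_surj y
  rw [← cls_geTerm i hψ hφ (wf_geTerm i hψ hφ), ← cls_geTerm i hφ hψ (wf_geTerm i hφ hψ)]
  have h1 : WF (conj (Fml.box i (impl φ ψ)) (eqTerm i [(1, φ)] [(1, ψ)])) :=
    .conj (.box (.impl hφ hψ)) (.conj (wf_geTerm i hφ hψ) (wf_geTerm i hψ hφ))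
  have h2 : WF (Fml.box i (iff ψ φ)) := .box (.iff hψ hφ)
  exact cls_eq_iff (hφ := h1) (hψ := h2).2 (.ax (.iff h1 h2) (.P4 i φ ψ))

theorem nonneg_le_box (v : Lind AtProp Ag →₀ ℚ) : nonneg i v ≤ box i (nonneg i v) :=
  .ax (.impl (wf_ge_repTerm i _ _) (.box (wf_ge_repTerm i _ _))) (.P5 i _ _)

/-! The modal fixed points. -/

theorem box_mono (h : x ≤ y) : box i x ≤ box i y := by
  have := box_himp_le i x y
  rw [himp_eq_top_iff.2 h, box_top, top_le_iff, himp_eq_top_iff] at this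
  exact this

theorem dia_mono (h : x ≤ y) : dia i x ≤ dia i y := by
  have := box_himp_le_dia i x y
  rw [himp_eq_top_iff.2 h, box_top, top_le_iff, himp_eq_top_iff] at this
  exact this

theorem box_inf : box i (x ⊓ y) = box i x ⊓ box i y := by
  apply le_antisymm (le_inf (box_mono i inf_le_left) (box_mono i inf_le_right))
  rw [← le_himp_iff]
  refine le_trans (box_mono i ?_) (box_himp_le i _ _)
  rw [le_himp_iff]

theorem dia_bot : dia i (⊥ : Lind AtProp Ag) = ⊥ := by
  rw [← le_bot_iff]
  exact (dia_mono i bot_le).trans ((dia_box_le i ⊥).trans (box_le i ⊥))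

theorem box_dia (x : Lind AtProp Ag) : box i (dia i x) = dia i x :=
  le_antisymm (box_le i _) (dia_le_box_dia i x)

theorem dia_of_box (hx : box i x = x) : dia i x = x := by
  refine le_antisymm ?_ (le_dia i x)
  conv_lhs => rw [← hx]
  exact (dia_box_le i x).trans hx.le

/-- Fixed elements of `□` are fixed by `◇`, and the axiom `E` applies to those; prime filters
therefore decide them classically. -/
theorem sup_compl_of_box (hx : box i x = x) : x ⊔ xᶜ = ⊤ := by
  have h := dia_sup_compl i x
  rwa [dia_of_box i hx] at h

theorem box_box (x : Lind AtProp Ag) : box i (box i x) = box i x := by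
  have h := box_dia i (box i x)
  have h' : dia i (box i x) = box i x := le_antisymm (dia_box_le i x) (le_dia i _)
  rwa [h'] at h

theorem box_compl (hx : box i x = x) : box i xᶜ = xᶜ := by
  have h : dia i xᶜ ≤ xᶜ := by
    have h1 := box_himp_le_dia i xᶜ ⊥
    rw [dia_bot, himp_bot, himp_bot] at h1
    rw [le_compl_comm]
    exact hx.ge.trans ((box_mono i le_compl_compl).trans h1)
  have h2 : dia i xᶜ = xᶜ := le_antisymm h (le_dia i _)
  rw [← h2, box_dia]

theorem box_nonneg (v : Lind AtProp Ag →₀ ℚ) : box i (nonneg i v) = nonneg i v :=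
  le_antisymm (box_le i _) (nonneg_le_box i v)

end Lind

end Terms

/-! ### Models on finite orders -/

section Kripke

open scoped Classical in
/-- A finite order with equivalence relations that contain the order, and positive weights that add
up to one on each class. -/
structure Kripke (AtProp : Type u) (Ag : Type v) (W : Type) [PartialOrder W] [Fintype W] where
  rel : Ag → Setoid W
  rel_of_le : ∀ i {w w'}, w ≤ w' → (rel i).r w w'
  wt : Ag → W → ℝ
  wt_pos : ∀ i w, 0 < wt i w
  wt_sum : ∀ i w, ∑ w' ∈ Finset.univ.filter (fun w' => (rel i).r w' w), wt i w' = 1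
  val : AtProp → LowerSet W

theorem mem_himp_iff {W : Type*} [PartialOrder W] {U V : LowerSet W} {w : W} :
    w ∈ U ⇨ V ↔ ∀ w' ≤ w, w' ∈ U → w' ∈ V := by
  rw [← LowerSet.Iic_le, le_himp_iff]
  exact ⟨fun h w' hw hU => h ⟨hw, hU⟩, fun h w' hw => h w' hw.1 hw.2⟩

theorem exists_mem_of_ne_bot {W : Type*} [PartialOrder W] {U : LowerSet W} (h : U ≠ ⊥) : ∃ w, w ∈ U := by
  by_contra! h'
  exact h (le_bot_iff.1 fun w hw => h' w hw)

namespace Kripke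

variable {AtProp : Type u} {Ag : Type v} {W : Type} [PartialOrder W] [Fintype W]
  (K : Kripke AtProp Ag W)

/-- The diamond of agent `i`. -/
def dia (i : Ag) (U : LowerSet W) : LowerSet W where
  carrier := {w | ∃ w', (K.rel i).r w' w ∧ w' ∈ U}
  lower' := fun _ _ h ⟨w', h', hU⟩ => ⟨w', (K.rel i).trans h' ((K.rel i).symm (K.rel_of_le i h)), hU⟩

/-- The box of agent `i`. -/
def box (i : Ag) (U : LowerSet W) : LowerSet W where
  carrier := {w | ∀ w', (K.rel i).r w' w → w' ∈ U}
  lower' := fun _ _ h hU w' h' => hU w' ((K.rel i).trans h' (K.rel_of_le i h))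

open scoped Classical in
/-- The measure of agent `i`. -/
def mu (i : Ag) (U : LowerSet W) : ℝ := ∑ w ∈ Finset.univ.filter (· ∈ U), K.wt i w

/-- The algebraic model of lower sets. -/
def model : PreModel AtProp Ag where
  carrier := LowerSet W
  dia := K.dia
  box := K.box
  mu := K.mu
  val := K.val

theorem isMonadic (i : Ag) : IsMonadic (K.dia i) (K.box i) where
  dia_mono _ _ h _ := fun ⟨w', h', hU⟩ => ⟨w', h', h hU⟩
  box_mono _ _ h _ hU := fun w' h' => h (hU w' h')
  M1 _ w hw := ⟨w, (K.rel i).refl w, hw⟩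
  M2 _ w hw := hw w ((K.rel i).refl w)
  M3 U V w := by
    rintro ⟨w', h, hU | hV⟩
    · exact Or.inl ⟨w', h, hU⟩
    · exact Or.inr ⟨w', h, hV⟩
  M4 U V := by
    rw [le_himp_iff]
    rintro w ⟨h1, h2⟩ w' h'
    exact mem_himp_iff.1 (h1 w' h') w' le_rfl (h2 w' h')
  M5 U w := fun ⟨w', h, hU⟩ w'' h' =>
    ⟨w', (K.rel i).trans h ((K.rel i).symm h'), hU⟩
  M6 U w := fun ⟨w', h, hU⟩ w'' h' => hU w'' ((K.rel i).trans h' ((K.rel i).symm h))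
  M7 U V := by
    rw [le_himp_iff]
    rintro w ⟨h1, w', h', hU⟩
    exact ⟨w', h', mem_himp_iff.1 (h1 w' h') w' le_rfl hU⟩
  M8 := fun _ ⟨_, _, h⟩ => h
  M9 := fun _ _ _ _ => trivial

theorem epistemic (i : Ag) (U : LowerSet W) : K.dia i U ⊔ (K.dia i U)ᶜ = ⊤ := by
  refine top_le_iff.1 fun w _ => ?_
  by_cases h : w ∈ K.dia i U
  · exact Or.inl h
  · right
    rw [← himp_bot]
    exact mem_himp_iff.2 fun w' hw ⟨w'', h', hU⟩ =>
      h ⟨w'', (K.rel i).trans h' (K.rel_of_le i hw), hU⟩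

/-- The class of `w`. -/
def clsOf (i : Ag) (w : W) : LowerSet W where
  carrier := {w' | (K.rel i).r w' w}
  lower' := fun _ _ h h' => (K.rel i).trans (K.rel_of_le i h) h'

theorem clsOf_le {i : Ag} {U : LowerSet W} (hU : K.dia i U = U) {w : W} (hw : w ∈ U) :
    K.clsOf i w ≤ U := fun w' h => by
  have : w' ∈ K.dia i U := ⟨w, (K.rel i).symm h, hw⟩
  rwa [hU] at this

theorem dia_clsOf (i : Ag) (w : W) : K.dia i (K.clsOf i w) = K.clsOf i w :=
  le_antisymm (fun _ ⟨_, h, h'⟩ => (K.rel i).trans ((K.rel i).symm h) h') ((K.isMonadic i).M1 _)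

theorem clsOf_ne_bot (i : Ag) (w : W) : K.clsOf i w ≠ ⊥ := fun h => by
  have : w ∈ K.clsOf i w := (K.rel i).refl w
  rw [h] at this
  exact this

/-- A nonempty fixed lower set contains the class of each of its points, so the minimal ones are
single classes. -/
theorem isIMin_iff {i : Ag} {U : LowerSet W} :
    IsIMin (K.dia i) U ↔ ∃ w, U = K.clsOf i w := by
  constructor
  · rintro ⟨h0, h1, h2⟩
    obtain ⟨w, hw⟩ := exists_mem_of_ne_bot h0
    refine ⟨w, ?_⟩
    by_contra hne
    exact K.clsOf_ne_bot i w (h2 _ (lt_of_le_of_ne (K.clsOf_le h1 hw) (Ne.symm hne))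
      (K.dia_clsOf i w))
  · rintro ⟨w, rfl⟩
    refine ⟨K.clsOf_ne_bot i w, K.dia_clsOf i w, fun V hV hdV => ?_⟩
    by_contra h0
    obtain ⟨w', hw'⟩ := exists_mem_of_ne_bot h0
    refine not_le_of_gt hV fun w'' h => K.clsOf_le hdV hw' ?_
    have h' : w' ∈ K.clsOf i w := hV.le hw'
    exact (K.rel i).trans h ((K.rel i).symm h')

/-- Strictness holds because every point has positive weight, and blocks have measure one because
the weights of a class add up to one. -/
theorem isIMeasure (i : Ag) : IsIMeasure (K.dia i) (K.mu i) where
  nonneg _ _ _ _ := Finset.sum_nonneg fun w _ => (K.wt_pos i w).le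
  mono _ _ _ _ h _ := Finset.sum_le_sum_of_subset_of_nonneg
    (fun w hw => by simp only [Finset.mem_filter] at hw ⊢; exact ⟨hw.1, h hw.2⟩)
    fun w _ _ => (K.wt_pos i w).le
  modular _ U V _ _ _ := by
    classical
    have h := Finset.sum_union_inter (s₁ := Finset.univ.filter (· ∈ U))
      (s₂ := Finset.univ.filter (· ∈ V)) (f := K.wt i)
    rw [← Finset.filter_or, ← Finset.filter_and] at h
    unfold mu
    rw [← h]
    have e1 : Finset.univ.filter (· ∈ U ⊔ V) = Finset.univ.filter fun w => w ∈ U ∨ w ∈ V := by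
      ext w; simp
    have e2 : Finset.univ.filter (· ∈ U ⊓ V) = Finset.univ.filter fun w => w ∈ U ∧ w ∈ V := by
      ext w; simp
    rw [e1, e2]
    ring
  bot _ _ := by simp [mu]
  strict _ U V _ h _ := by
    classical
    obtain ⟨w, hV, hU⟩ := (show ∃ w, w ∈ V ∧ w ∉ U by
      by_contra! h'
      exact not_le_of_gt h fun w hw => h' w hw)
    refine Finset.sum_lt_sum_of_subset (i := w)
      (fun w hw => by simp only [Finset.mem_filter] at hw ⊢; exact ⟨hw.1, h.le hw.2⟩)
      (by simp [hV]) (by simp [hU]) (K.wt_pos i w) fun w _ _ => (K.wt_pos i w).le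
  one U hU := by
    obtain ⟨w, rfl⟩ := K.isIMin_iff.1 hU
    exact K.wt_sum i w

theorem isAPE : K.model.IsAPE where
  monadic := K.isMonadic
  epistemic := K.epistemic
  measure := K.isIMeasure

/-- The set of points where a formula holds. -/
def truth (φ : Fml AtProp Ag) : LowerSet W := eval φ K.model

variable {φ ψ : Fml AtProp Ag} {w : W}

theorem mem_truth_atom (p : AtProp) : w ∈ K.truth (atom p) ↔ w ∈ K.val p := by
  rw [truth, eval]; rfl

theorem mem_truth_bot : ¬ w ∈ K.truth bot := by
  rw [truth, eval]; exact id

theorem mem_truth_conj : w ∈ K.truth (conj φ ψ) ↔ w ∈ K.truth φ ∧ w ∈ K.truth ψ := by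
  rw [truth, eval]; rfl

theorem mem_truth_disj : w ∈ K.truth (disj φ ψ) ↔ w ∈ K.truth φ ∨ w ∈ K.truth ψ := by
  rw [truth, eval]; rfl

theorem mem_truth_impl : w ∈ K.truth (impl φ ψ) ↔ ∀ w' ≤ w, w' ∈ K.truth φ → w' ∈ K.truth ψ := by
  rw [truth, eval]; exact mem_himp_iff

theorem mem_truth_dia {i : Ag} :
    w ∈ K.truth (.dia i φ) ↔ ∃ w', (K.rel i).r w' w ∧ w' ∈ K.truth φ := by
  rw [truth, eval]; rfl

theorem mem_truth_box {i : Ag} :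
    w ∈ K.truth (.box i φ) ↔ ∀ w', (K.rel i).r w' w → w' ∈ K.truth φ := by
  rw [truth, eval]; rfl

theorem mem_finSup {S : Set (LowerSet W)} : w ∈ finSup S ↔ ∃ U ∈ S, w ∈ U := by
  constructor
  · have h : finSup S ≤ (⟨{w | ∃ U ∈ S, w ∈ U}, fun _ _ h ⟨U, hU, hw⟩ =>
        ⟨U, hU, U.lower h hw⟩⟩ : LowerSet W) := finSup_le fun U hU w hw => ⟨U, hU, hw⟩
    exact fun hw => h hw
  · rintro ⟨U, hU, hw⟩
    exact le_finSup hU hw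

open scoped Classical in
-- The only block containing `w` is its own class, so membership in the join of blocks is the
-- inequality on that class.
theorem mem_truth_prob {i : Ag} {n : ℕ} {α : Fin n → ℚ} {φ : Fin n → Fml AtProp Ag} {β : ℚ} :
    w ∈ K.truth (prob i n α φ β) ↔ (β : ℝ) ≤ ∑ k, (α k : ℝ) *
      ∑ w' ∈ Finset.univ.filter (fun w' => w' ∈ K.truth (φ k) ∧ (K.rel i).r w' w), K.wt i w' := by
  have hsum : ∀ w, ∑ k, (α k : ℝ) * K.mu i (K.truth (φ k) ⊓ K.clsOf i w) = ∑ k, (α k : ℝ) *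
      ∑ w' ∈ Finset.univ.filter (fun w' => w' ∈ K.truth (φ k) ∧ (K.rel i).r w' w), K.wt i w' := by
    intro w
    refine Finset.sum_congr rfl fun k _ => ?_
    congr 1
    exact Finset.sum_congr (Finset.filter_congr fun _ _ => Iff.rfl) fun _ _ => rfl
  rw [truth, eval]
  refine (mem_finSup (W := W)).trans ⟨?_, fun h => ?_⟩
  · rintro ⟨U, ⟨hU, hβ⟩, hw⟩
    obtain ⟨w', rfl⟩ := K.isIMin_iff.1 hU
    have e : K.clsOf i w' = K.clsOf i w := by
      ext w''
      exact ⟨fun h => (K.rel i).trans h ((K.rel i).symm hw), fun h => (K.rel i).trans h hw⟩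
    rw [← hsum, ← e]
    exact hβ
  · rw [← hsum] at h
    exact ⟨K.clsOf i w, ⟨K.isIMin_iff.2 ⟨w, rfl⟩, h⟩, (K.rel i).refl w⟩

end Kripke

end Kripke

/-! ### Types of prime filters -/

section World

variable {L : Type*} [HeytingAlgebra L] {n : ℕ}

/-- The subsets of the finite family `c` that are traces of prime filters. -/
def World (c : Fin n → L) : Type :=
  {s : Set (Fin n) // ∃ T : PrimeFilter L, s = {k | c k ∈ T}}

namespace World

variable {c : Fin n → L}

/-- Reverse inclusion: a point with more formulas is lower, so the points containing a given formula
form a lower set. -/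
instance : PartialOrder (World c) :=
  PartialOrder.lift (fun w => OrderDual.toDual w.1) fun _ _ h => Subtype.ext h

instance : Fintype (World c) :=
  have : Finite (World c) := Finite.of_injective (fun w => w.1) Subtype.val_injective
  Fintype.ofFinite _

/-- The trace of a prime filter. -/
def tp (c : Fin n → L) (T : PrimeFilter L) : World c := ⟨{k | c k ∈ T}, T, rfl⟩

theorem exists_tp (w : World c) : ∃ T, tp c T = w := by
  obtain ⟨s, T, rfl⟩ := w
  exact ⟨T, rfl⟩

theorem mem_tp {T : PrimeFilter L} {k : Fin n} : k ∈ (tp c T).1 ↔ c k ∈ T := Iff.rfl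

theorem tp_le_tp {T T' : PrimeFilter L} :
    tp c T ≤ tp c T' ↔ ∀ k, c k ∈ T' → c k ∈ T := Iff.rfl

open scoped Classical in
/-- The element of the algebra that defines a lower set of types. -/
def elt (U : LowerSet (World c)) : L :=
  (Finset.univ.filter (· ∈ U)).sup fun w => (Finset.univ.filter (· ∈ w.1)).inf c

/-- If `T` contains all of `w`, its trace is below `w` and hence in `U`. As prime filters separate
elements, this determines `elt U` and makes `elt` a lattice homomorphism. -/
theorem elt_mem {U : LowerSet (World c)} {T : PrimeFilter L} : elt U ∈ T ↔ tp c T ∈ U := by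
  classical
  rw [elt, PrimeFilter.finset_sup_iff]
  constructor
  · rintro ⟨w, hw, hT⟩
    obtain ⟨T', rfl⟩ := exists_tp w
    simp only [Finset.mem_filter, Finset.mem_univ, true_and] at hw
    rw [PrimeFilter.finset_inf_iff] at hT
    exact U.lower (tp_le_tp.2 fun k hk => hT k
      (Finset.mem_filter.2 ⟨Finset.mem_univ _, hk⟩)) hw
  · intro h
    refine ⟨tp c T, by simpa using h, PrimeFilter.finset_inf_iff.2 fun k hk => ?_⟩
    exact (Finset.mem_filter.1 hk).2

theorem elt_sup (U V : LowerSet (World c)) : elt (U ⊔ V) = elt U ⊔ elt V :=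
  PrimeFilter.eq_of_forall fun T => by
    rw [PrimeFilter.sup_iff, elt_mem, elt_mem, elt_mem]; rfl

theorem elt_inf (U V : LowerSet (World c)) : elt (U ⊓ V) = elt U ⊓ elt V :=
  PrimeFilter.eq_of_forall fun T => by
    rw [PrimeFilter.inf_iff, elt_mem, elt_mem, elt_mem]; rfl

theorem elt_bot : elt (⊥ : LowerSet (World c)) = ⊥ :=
  PrimeFilter.eq_of_forall fun T => by
    rw [elt_mem]; exact ⟨fun h => h.elim, fun h => (PrimeFilter.bot h).elim⟩

theorem elt_top : elt (⊤ : LowerSet (World c)) = ⊤ :=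
  PrimeFilter.eq_of_forall fun T => by
    rw [elt_mem]; exact ⟨fun _ => PrimeFilter.top, fun _ => trivial⟩

theorem elt_mono {U V : LowerSet (World c)} (h : U ≤ V) : elt U ≤ elt V :=
  PrimeFilter.le_of_forall fun T => by
    rw [elt_mem, elt_mem]; exact fun h' => h h'

end World

end World

section Canonical

variable {AtProp : Type u} {Ag : Type v}

open Lind

/-! ### Functionals induced by a prime filter -/

/-- The vectors that are null according to the prime filter `T`. -/
def nullSpace (T : PrimeFilter (Lind AtProp Ag)) (i : Ag) :
    Submodule ℚ (Lind AtProp Ag →₀ ℚ) where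
  carrier := {v | nonneg i v ∈ T ∧ nonneg i (-v) ∈ T}
  zero_mem' := by
    simp only [Set.mem_ofPred_eq, neg_zero, nonneg_zero, and_self]
    exact PrimeFilter.top
  add_mem' {v w} hv hw := ⟨PrimeFilter.of_le (nonneg_add i v w) (PrimeFilter.inf_iff.2 ⟨hv.1, hw.1⟩),
    by
      rw [neg_add]
      exact PrimeFilter.of_le (nonneg_add i _ _) (PrimeFilter.inf_iff.2 ⟨hv.2, hw.2⟩)⟩
  smul_mem' d v hv := by
    rcases le_total 0 d with hd | hd
    · refine ⟨PrimeFilter.of_le (nonneg_smul i v hd) hv.1, ?_⟩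
      rw [← smul_neg]
      exact PrimeFilter.of_le (nonneg_smul i _ hd) hv.2
    · have h1 := PrimeFilter.of_le (nonneg_smul i _ (neg_nonneg.2 hd)) hv.2
      have h2 := PrimeFilter.of_le (nonneg_smul i _ (neg_nonneg.2 hd)) hv.1
      rw [neg_smul_neg] at h1
      rw [neg_smul] at h2
      exact ⟨h1, h2⟩

theorem nonneg_mem_or (T : PrimeFilter (Lind AtProp Ag)) (i : Ag) (v : Lind AtProp Ag →₀ ℚ) :
    nonneg i v ∈ T ∨ nonneg i (-v) ∈ T :=
  PrimeFilter.sup_iff.1 (nonneg_total i v ▸ PrimeFilter.top)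

/-- The signs of finitely many vectors according to a prime filter are the signs of their values
under a functional. -/
theorem exists_functional_sign (T : PrimeFilter (Lind AtProp Ag)) (i : Ag)
    {Q : Set (Lind AtProp Ag →₀ ℚ)} (hQ : Q.Finite) :
    ∃ f : (Lind AtProp Ag →₀ ℚ) →ₗ[ℚ] ℚ, (∀ v ∈ nullSpace T i, f v = 0) ∧
      ∀ v ∈ Q, nonneg i v ∈ T ↔ 0 ≤ f v := by
  classical
  have hfin : {v | v ∈ Q ∪ -Q ∧ nonneg i (-v) ∉ T}.Finite :=
    (hQ.union hQ.neg).subset fun v hv => hv.1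
  -- The vectors `v` with `-v ≥ 0` not in `T` are the strictly positive ones; they form a convex
  -- cone that avoids the null space.
  obtain ⟨f, hK, hf⟩ := exists_functional_pos (Pos := fun v => nonneg i (-v) ∉ T)
    (K := nullSpace T i) (by
      intro v w hv hw h
      have hv' := (nonneg_mem_or T i v).resolve_right hv
      have := PrimeFilter.of_le (nonneg_add i _ _) (PrimeFilter.inf_iff.2 ⟨h, hv'⟩)
      rw [neg_add, add_right_comm, neg_add_cancel, zero_add] at this
      exact hw this) (by
      intro d v hd hv h
      have := PrimeFilter.of_le (nonneg_smul i _ (inv_nonneg.2 hd.le)) h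
      rw [smul_neg, smul_smul, inv_mul_cancel₀ hd.ne', one_smul] at this
      exact hv this) (fun v hv h => hv h.2) hfin.toFinset.toList (by
      intro v hv
      rw [Finset.mem_toList, Set.Finite.mem_toFinset] at hv
      exact hv.2)
  simp only [Finset.mem_toList, Set.Finite.mem_toFinset, Set.mem_ofPred_eq] at hf
  -- A vector of `Q` is null, strictly positive, or the negative of a strictly positive one. The
  -- last case is why `-Q` was included.
  refine ⟨f, hK, fun v hv => ⟨fun h => ?_, fun h => ?_⟩⟩
  · by_cases h' : nonneg i (-v) ∈ T
    · exact (hK v ⟨h, h'⟩).ge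
    · exact (hf v ⟨Or.inl hv, h'⟩).le
  · by_contra h'
    have := hf (-v) ⟨Or.inr (by simpa using hv), by rwa [neg_neg]⟩
    rw [map_neg] at this
    linarith

/-! ### Finite closed sets of formulas -/

/-- The closure conditions on a set of formulas at a formula. -/
def ClosedAt (S : Set (Fml AtProp Ag)) : Fml AtProp Ag → Prop
  | atom _ => True
  | bot => True
  | conj φ ψ => φ ∈ S ∧ ψ ∈ S
  | disj φ ψ => φ ∈ S ∧ ψ ∈ S
  | impl φ ψ => φ ∈ S ∧ ψ ∈ S
  | .dia i φ => φ ∈ S ∧ neg (.dia i φ) ∈ S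
  | .box i φ => φ ∈ S ∧ neg (.box i φ) ∈ S
  | upDia _ _ _ _ _ => False
  | upBox _ _ _ _ _ => False
  | prob i n α φ β => (∀ k, φ k ∈ S) ∧ neg (prob i n α φ β) ∈ S

theorem ClosedAt.mono {S S' : Set (Fml AtProp Ag)} (h : S ⊆ S') {φ : Fml AtProp Ag}
    (hφ : ClosedAt S φ) : ClosedAt S' φ := by
  cases φ with
  | atom => trivial
  | bot => trivial
  | upDia => exact hφ
  | upBox => exact hφ
  | prob => exact ⟨fun k => h (hφ.1 k), h hφ.2⟩
  | _ => exact ⟨h hφ.1, h hφ.2⟩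

/-- Sets of formulas without updates that are closed under subformulas and contain the negations
of their modal members. -/
structure ClosedSet (S : Set (Fml AtProp Ag)) : Prop where
  bot : bot ∈ S
  wf : ∀ φ ∈ S, WF φ
  closedAt : ∀ φ ∈ S, ClosedAt S φ

theorem ClosedSet.union {S S' : Set (Fml AtProp Ag)} (h : ClosedSet S) (h' : ClosedSet S') :
    ClosedSet (S ∪ S') where
  bot := Or.inl h.bot
  wf φ hφ := hφ.elim (h.wf φ) (h'.wf φ)
  closedAt φ hφ := hφ.elim (fun hφ => (h.closedAt φ hφ).mono Set.subset_union_left)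
    fun hφ => (h'.closedAt φ hφ).mono Set.subset_union_right

theorem ClosedSet.insert {S : Set (Fml AtProp Ag)} (h : ClosedSet S) {φ : Fml AtProp Ag}
    (hφ : WF φ) (hc : ClosedAt (insert φ S) φ) : ClosedSet (insert φ S) where
  bot := Or.inr h.bot
  wf ψ hψ := hψ.elim (fun e => e ▸ hφ) (h.wf ψ)
  closedAt ψ hψ := hψ.elim (fun e => e ▸ hc)
    fun hψ => (h.closedAt ψ hψ).mono (Set.subset_insert _ _)

theorem ClosedSet.insert_neg {S : Set (Fml AtProp Ag)} (h : ClosedSet S) {φ : Fml AtProp Ag}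
    (hφ : WF φ) (hc : neg φ ∈ Insert.insert (neg φ) (Insert.insert φ S) →
      ClosedAt (Insert.insert (neg φ) (Insert.insert φ S)) φ) :
    ClosedSet (Insert.insert (neg φ) (Insert.insert φ S)) where
  bot := Or.inr (Or.inr h.bot)
  wf ψ hψ := by
    rcases hψ with rfl | rfl | hψ
    exacts [hφ.neg, hφ, h.wf _ hψ]
  closedAt ψ hψ := by
    rcases hψ with rfl | rfl | hψ
    · exact ⟨Or.inr (Or.inl rfl), Or.inr (Or.inr h.bot)⟩
    · exact hc (Or.inl rfl)
    · exact (h.closedAt _ hψ).mono ((Set.subset_insert _ _).trans (Set.subset_insert _ _))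

theorem closedSet_singleton_bot : ClosedSet ({bot} : Set (Fml AtProp Ag)) where
  bot := rfl
  wf φ hφ := by
    rw [Set.mem_singleton_iff] at hφ
    exact hφ ▸ .bot
  closedAt φ hφ := by
    rw [Set.mem_singleton_iff] at hφ
    rw [hφ]
    trivial

theorem exists_closedSet {φ : Fml AtProp Ag} (hφ : WF φ) (hs : Static φ) :
    ∃ S, S.Finite ∧ ClosedSet S ∧ φ ∈ S := by
  induction φ with
  | atom p =>
    exact ⟨_, (Set.finite_singleton bot).insert (atom p),
      closedSet_singleton_bot.insert hφ trivial, Or.inl rfl⟩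
  | bot => exact ⟨_, Set.finite_singleton bot, closedSet_singleton_bot, rfl⟩
  | conj φ ψ ih ih' =>
    obtain ⟨h1, h2⟩ : WF φ ∧ WF ψ := by cases hφ; constructor <;> assumption
    obtain ⟨S, hf, hc, hm⟩ := ih h1 hs.1
    obtain ⟨S', hf', hc', hm'⟩ := ih' h2 hs.2
    exact ⟨_, (hf.union hf').insert _, (hc.union hc').insert hφ
      ⟨Or.inr (Or.inl hm), Or.inr (Or.inr hm')⟩, Or.inl rfl⟩
  | disj φ ψ ih ih' =>
    obtain ⟨h1, h2⟩ : WF φ ∧ WF ψ := by cases hφ; constructor <;> assumption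
    obtain ⟨S, hf, hc, hm⟩ := ih h1 hs.1
    obtain ⟨S', hf', hc', hm'⟩ := ih' h2 hs.2
    exact ⟨_, (hf.union hf').insert _, (hc.union hc').insert hφ
      ⟨Or.inr (Or.inl hm), Or.inr (Or.inr hm')⟩, Or.inl rfl⟩
  | impl φ ψ ih ih' =>
    obtain ⟨h1, h2⟩ : WF φ ∧ WF ψ := by cases hφ; constructor <;> assumption
    obtain ⟨S, hf, hc, hm⟩ := ih h1 hs.1
    obtain ⟨S', hf', hc', hm'⟩ := ih' h2 hs.2
    exact ⟨_, (hf.union hf').insert _, (hc.union hc').insert hφ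
      ⟨Or.inr (Or.inl hm), Or.inr (Or.inr hm')⟩, Or.inl rfl⟩
  | dia i φ ih =>
    have h1 : WF φ := by cases hφ; assumption
    obtain ⟨S, hf, hc, hm⟩ := ih h1 hs
    exact ⟨_, (hf.insert _).insert _, hc.insert_neg hφ fun h => ⟨Or.inr (Or.inr hm), h⟩,
      Or.inr (Or.inl rfl)⟩
  | box i φ ih =>
    have h1 : WF φ := by cases hφ; assumption
    obtain ⟨S, hf, hc, hm⟩ := ih h1 hs
    exact ⟨_, (hf.insert _).insert _, hc.insert_neg hφ fun h => ⟨Or.inr (Or.inr hm), h⟩,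
      Or.inr (Or.inl rfl)⟩
  | upDia => exact hs.elim
  | upBox => exact hs.elim
  | prob i n α φ β ih =>
    have h1 : ∀ k, WF (φ k) := by cases hφ; assumption
    choose S hf hc hm using fun k => ih k (h1 k) (hs k)
    have hu : ClosedSet ({bot} ∪ ⋃ k, S k) := by
      refine ⟨Or.inl rfl, fun ψ hψ => ?_, fun ψ hψ => ?_⟩
      · rcases hψ with hψ | hψ
        · exact closedSet_singleton_bot.wf ψ hψ
        · obtain ⟨k, hk⟩ := Set.mem_iUnion.1 hψ
          exact (hc k).wf ψ hk
      · rcases hψ with hψ | hψ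
        · exact (closedSet_singleton_bot.closedAt ψ hψ).mono Set.subset_union_left
        · obtain ⟨k, hk⟩ := Set.mem_iUnion.1 hψ
          exact ((hc k).closedAt ψ hk).mono
            ((Set.subset_iUnion S k).trans Set.subset_union_right)
    exact ⟨_, (((Set.finite_singleton _).union (Set.finite_iUnion hf)).insert _).insert _,
      hu.insert_neg hφ fun h =>
        ⟨fun k => Or.inr (Or.inr (Or.inr (Set.mem_iUnion.2 ⟨k, hm k⟩))), h⟩, Or.inr (Or.inl rfl)⟩

/-- The formulas that start with a modality or an inequality of agent `i`. -/
def IsModal (i : Ag) : Fml AtProp Ag → Prop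
  | .dia j _ => j = i
  | .box j _ => j = i
  | prob j _ _ _ _ => j = i
  | _ => False

/-- By the S5-like axioms and P5 these classes are fixed by `□_i`, hence complemented and constant
along the accessibility given by `□_i`. -/
theorem IsModal.box_cls {i : Ag} {φ : Fml AtProp Ag} (h : IsModal i φ) (hφ : WF φ) :
    Lind.box i (cls φ hφ) = cls φ hφ := by
  cases φ with
  | dia j φ =>
    obtain rfl : j = i := h
    have h1 : WF φ := by cases hφ; assumption
    exact box_dia j (cls φ h1)
  | box j φ =>
    obtain rfl : j = i := h
    have h1 : WF φ := by cases hφ; assumption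
    exact box_box j (cls φ h1)
  | prob j n α φ β =>
    obtain rfl : j = i := h
    have h1 : ∀ k, WF (φ k) := by cases hφ; assumption
    rw [cls_prob h1, gel_eq_nonneg, box_nonneg]
  | _ => exact h.elim

theorem ClosedSet.neg_mem {S : Set (Fml AtProp Ag)} (h : ClosedSet S) {i : Ag}
    {φ : Fml AtProp Ag} (hm : IsModal i φ) (hφ : φ ∈ S) : neg φ ∈ S := by
  have hc := h.closedAt φ hφ
  cases φ with
  | dia => exact hc.2
  | box => exact hc.2
  | prob => exact hc.2
  | _ => exact hm.elim

end Canonical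

/-! ### The canonical model -/

section CanonicalModel

variable {AtProp : Type u} {Ag : Type v}

open Lind World

/-- A finite closed set of formulas, with an enumeration. -/
structure ClosedFamily (AtProp : Type u) (Ag : Type v) where
  n : ℕ
  fml : Fin n → Fml AtProp Ag
  closed : ClosedSet (Set.range fml)

namespace ClosedFamily

variable (Γ : ClosedFamily AtProp Ag)

theorem wf (k : Fin Γ.n) : WF (Γ.fml k) := Γ.closed.wf _ ⟨k, rfl⟩

/-- The classes of the members of the family. -/
def cl (k : Fin Γ.n) : Lind AtProp Ag := cls (Γ.fml k) (Γ.wf k)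

/-- The points of the canonical model. -/
abbrev Pt : Type := World Γ.cl

variable {Γ} {T T' : PrimeFilter (Lind AtProp Ag)} {i : Ag}

/-- The points that contain `φ`. -/
def hold (Γ : ClosedFamily AtProp Ag) (φ : Fml AtProp Ag) : LowerSet Γ.Pt where
  carrier := {w | ∃ k, Γ.fml k = φ ∧ k ∈ w.1}
  lower' := fun _ _ h ⟨k, hk, hw⟩ => ⟨k, hk, h hw⟩

theorem tp_mem_hold {φ : Fml AtProp Ag} (hφ : φ ∈ Set.range Γ.fml) (h : WF φ) :
    tp Γ.cl T ∈ Γ.hold φ ↔ cls φ h ∈ T := by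
  constructor
  · rintro ⟨k, rfl, hk⟩
    exact hk
  · obtain ⟨k, rfl⟩ := hφ
    exact fun h => ⟨k, rfl, h⟩

theorem elt_hold {φ : Fml AtProp Ag} (hφ : φ ∈ Set.range Γ.fml) (h : WF φ) :
    elt (Γ.hold φ) = cls φ h :=
  PrimeFilter.eq_of_forall fun T => by rw [elt_mem, tp_mem_hold hφ h]

theorem cls_mem_of_tp_le {φ : Fml AtProp Ag} (hφ : φ ∈ Set.range Γ.fml) (h : WF φ)
    (hle : tp Γ.cl T ≤ tp Γ.cl T') : cls φ h ∈ T' → cls φ h ∈ T := by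
  rw [← tp_mem_hold hφ, ← tp_mem_hold hφ]
  exact (Γ.hold φ).lower hle

/-- Two points are related if they agree on the modal formulas of agent `i`. -/
def rel (Γ : ClosedFamily AtProp Ag) (i : Ag) : Setoid Γ.Pt where
  r w w' := ∀ k, IsModal i (Γ.fml k) → (k ∈ w.1 ↔ k ∈ w'.1)
  iseqv := ⟨fun _ _ _ => Iff.rfl, fun h k hk => (h k hk).symm,
    fun h h' k hk => (h k hk).trans (h' k hk)⟩

theorem cl_compl_mem_iff {k : Fin Γ.n} (hk : IsModal i (Γ.fml k)) : (Γ.cl k)ᶜ ∈ T ↔ Γ.cl k ∉ T :=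
  PrimeFilter.compl_iff (sup_compl_of_box i (hk.box_cls (Γ.wf k)))

/-- A modal formula missing from `w'` has its negation there, and the negation, being in the family,
passes down to `w`. This is why the family contains negations of modal members. -/
theorem rel_of_le {w w' : Γ.Pt} (h : w ≤ w') : (Γ.rel i).r w w' := by
  intro k hk
  refine ⟨fun hw => ?_, fun hw => h hw⟩
  obtain ⟨T, rfl⟩ := exists_tp w
  obtain ⟨T', rfl⟩ := exists_tp w'
  by_contra hne
  have h1 : cls (neg (Γ.fml k)) (Γ.wf k).neg ∈ T' := (cl_compl_mem_iff hk).2 hne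
  have h2 := cls_mem_of_tp_le (Γ.closed.neg_mem hk ⟨k, rfl⟩) _ h h1
  exact (cl_compl_mem_iff hk).1 h2 hw

/-- A modal formula and its complement are both `□_i`-fixed, so membership of either in `T` carries
over to `T'`. -/
theorem rel_of_box (h : ∀ z, Lind.box i z ∈ T → z ∈ T') :
    (Γ.rel i).r (tp Γ.cl T') (tp Γ.cl T) := by
  intro k hk
  have hb : Lind.box i (Γ.cl k) = Γ.cl k := hk.box_cls (Γ.wf k)
  rw [mem_tp, mem_tp]
  constructor
  · intro h'
    by_contra hne
    refine (cl_compl_mem_iff hk).1 (h _ ?_) h'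
    rw [box_compl i hb]
    exact (cl_compl_mem_iff hk).2 hne
  · exact fun h' => h _ (by rwa [hb])

/-- Some modal formula distinguishes `s` from the trace of `T`. It, or its complement, is above `elt
(Iic s)`, is false in `T`, and is fixed by `□_i`; so `T` contains the boxed negation. Points outside
the class therefore get weight zero. -/
theorem box_compl_elt_mem {s : Γ.Pt} (h : ¬ (Γ.rel i).r s (tp Γ.cl T)) :
    Lind.box i (elt (LowerSet.Iic s))ᶜ ∈ T := by
  change ¬ ∀ k, IsModal i (Γ.fml k) → (k ∈ s.1 ↔ k ∈ (tp Γ.cl T).1) at h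
  push Not at h
  obtain ⟨k, hk, h⟩ := h
  have hb : Lind.box i (Γ.cl k) = Γ.cl k := hk.box_cls (Γ.wf k)
  rcases h with ⟨hs, hT⟩ | ⟨hs, hT⟩
  · have hle : elt (LowerSet.Iic s) ≤ Γ.cl k := PrimeFilter.le_of_forall fun T' hT' => by
      rw [elt_mem] at hT'
      exact (show tp Γ.cl T' ≤ s from hT') hs
    refine PrimeFilter.of_le (Lind.box_mono i (compl_le_compl hle)) ?_
    rw [box_compl i hb]
    exact (cl_compl_mem_iff hk).2 hT
  · have hle : elt (LowerSet.Iic s) ≤ (Γ.cl k)ᶜ := PrimeFilter.le_of_forall fun T' hT' => by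
      rw [elt_mem] at hT'
      have h1 := rel_of_le (i := i) (show tp Γ.cl T' ≤ s from hT') k hk
      rw [cl_compl_mem_iff hk]
      exact fun h2 => hs (h1.1 h2)
    refine PrimeFilter.of_le (Lind.box_mono i (le_compl_comm.1 hle)) ?_
    rw [hb]
    exact hT

/-! The weights of the canonical model. -/

open scoped Classical in
/-- The vector `t - β` of an inequality `t ≥ β`. -/
def probVec : Fml AtProp Ag → (Lind AtProp Ag →₀ ℚ)
  | prob _ _ α φ β => (∑ k, α k • Finsupp.single (if h : WF (φ k) then cls (φ k) h else ⊥) 1) -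
      β • Finsupp.single ⊤ 1
  | _ => 0

theorem probVec_prob {n : ℕ} {α : Fin n → ℚ} {φ : Fin n → Fml AtProp Ag} {β : ℚ}
    (hφ : ∀ k, WF (φ k)) : probVec (prob i n α φ β) =
      (∑ k, α k • Finsupp.single (cls (φ k) (hφ k)) 1) - β • Finsupp.single ⊤ 1 := by
  simp [probVec, hφ]

theorem cls_prob_eq {n : ℕ} {α : Fin n → ℚ} {φ : Fin n → Fml AtProp Ag} {β : ℚ}
    (hφ : ∀ k, WF (φ k)) :
    cls (prob i n α φ β) (.prob hφ) = nonneg i (probVec (prob i n α φ β)) := by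
  rw [cls_prob hφ, gel_eq_nonneg, probVec_prob hφ]
  congr 2
  rw [vec, List.map_ofFn, List.sum_ofFn]
  simp

/-- The vector whose value is the weight of the point `s`. -/
def ptVec (s : Γ.Pt) : Lind AtProp Ag →₀ ℚ :=
  Finsupp.single (elt (LowerSet.Iic s)) 1 - Finsupp.single (elt (LowerSet.Iio s)) 1

theorem elt_Iio_le (s : Γ.Pt) : elt (LowerSet.Iio s) ≤ elt (LowerSet.Iic s) :=
  elt_mono fun _ h => le_of_lt (show _ < s from h)

theorem nonneg_ptVec (s : Γ.Pt) : nonneg i (ptVec s) = ⊤ := nonneg_mono i (elt_Iio_le s)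

/-- The axiom P4 for `elt (Iio s) ≤ elt (Iic s)`: equal measures mean that the two are
`□_i`-equivalent. -/
theorem nonneg_neg_ptVec_mem_iff {s : Γ.Pt} : nonneg i (-ptVec s) ∈ T ↔
    Lind.box i (elt (LowerSet.Iic s) ⇨ elt (LowerSet.Iio s)) ∈ T := by
  have h := box_inf_nonneg i (x := elt (LowerSet.Iio s)) (y := elt (LowerSet.Iic s))
  have h1 : nonneg i (Finsupp.single (elt (LowerSet.Iic s)) 1 -
    Finsupp.single (elt (LowerSet.Iio s)) 1) = ⊤ := nonneg_ptVec s
  rw [himp_eq_top_iff.2 (elt_Iio_le s), box_top, top_inf_eq, h1, inf_top_eq, inf_top_eq] at h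
  rw [← h, ptVec, neg_sub]

open scoped Classical in
/-- Weights on the class of the point `t` that are positive at `t` and satisfy the inequalities of
agent `i` that belong to `t`, and no others. -/
structure IsWeight (i : Ag) (t : Γ.Pt) (m : Γ.Pt → ℚ) : Prop where
  nonneg : ∀ s, 0 ≤ m s
  eq_zero : ∀ s, ¬ (Γ.rel i).r s t → m s = 0
  sum_eq : ∑ s, m s = 1
  pos : 0 < m t
  prob_iff : ∀ (n : ℕ) (α : Fin n → ℚ) (φ : Fin n → Fml AtProp Ag) (β : ℚ),
    prob i n α φ β ∈ Set.range Γ.fml → (t ∈ Γ.hold (prob i n α φ β) ↔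
      β ≤ ∑ k, α k * ∑ s ∈ Finset.univ.filter (· ∈ Γ.hold (φ k)), m s)

/-- The functional realising the signs of `T` is a valuation on lower sets, and the weights are its
point masses divided by its value at `⊤`. Positivity is claimed at `t` only: another point of the
class agrees with `T` just on the modal members of the family, and `T` may give it mass zero. -/
theorem exists_isWeight (i : Ag) (t : Γ.Pt) : ∃ m, IsWeight i t m := by
  obtain ⟨T, rfl⟩ := exists_tp t
  classical
  -- All vectors whose sign is needed: the point masses, their negatives (for positivity at `t`),
  -- the inequalities of the family, and `-⊤` (for the normalisation).
  have hQ : (Set.range (ptVec (Γ := Γ)) ∪ Set.range (fun s => -ptVec (Γ := Γ) s) ∪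
      Set.range (fun k => probVec (Γ.fml k)) ∪
      {-Finsupp.single (⊤ : Lind AtProp Ag) (1 : ℚ)}).Finite :=
    (((Set.finite_range _).union (Set.finite_range _)).union (Set.finite_range _)).union
      (Set.finite_singleton _)
  obtain ⟨f, hK, hf⟩ := exists_functional_sign T i hQ
  have hN : 0 < f (Finsupp.single ⊤ 1) := by
    have h := hf (-Finsupp.single ⊤ 1) (Or.inr rfl)
    rw [nonneg_neg_top, map_neg] at h
    by_contra hle
    exact PrimeFilter.bot (h.2 (by linarith))
  set N := f (Finsupp.single ⊤ 1) with hN_def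
  -- Modularity is provable in both directions, so the difference is null for `T` and `f` kills it.
  have hmod : ∀ U V : LowerSet Γ.Pt, f (Finsupp.single (elt (U ⊔ V)) 1) =
      f (Finsupp.single (elt U) 1) + f (Finsupp.single (elt V) 1) -
        f (Finsupp.single (elt (U ⊓ V)) 1) := fun U V => by
    have h := nonneg_modular i (elt U) (elt V)
    have h0 := hK _ (show _ ∈ nullSpace T i from ⟨h.1 ▸ PrimeFilter.top, by
      rw [neg_sub, h.2]; exact PrimeFilter.top⟩)
    rw [elt_sup, elt_inf]
    simp only [map_sub, map_add] at h0
    linarith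
  have hbot : f (Finsupp.single (elt (⊥ : LowerSet Γ.Pt)) 1) = 0 := by
    rw [elt_bot]
    exact hK _ ⟨(nonneg_bot i).1 ▸ PrimeFilter.top, (nonneg_bot i).2 ▸ PrimeFilter.top⟩
  have hval := valuation_eq_sum (fun U : LowerSet Γ.Pt => f (Finsupp.single (elt U) 1)) hbot hmod
  have hpt : ∀ s : Γ.Pt, f (Finsupp.single (elt (LowerSet.Iic s)) 1) -
      f (Finsupp.single (elt (LowerSet.Iio s)) 1) = f (ptVec s) := fun s => (map_sub f _ _).symm
  simp only [hpt] at hval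
  have hsum : ∀ U : LowerSet Γ.Pt, ∑ s ∈ Finset.univ.filter (· ∈ U), f (ptVec s) / N =
      f (Finsupp.single (elt U) 1) / N := fun U => by rw [hval U, Finset.sum_div]
  refine ⟨fun s => f (ptVec s) / N, fun s => ?_, fun s hs => ?_, ?_, ?_, ?_⟩
  · refine div_nonneg ((hf _ (Or.inl (Or.inl (Or.inl ⟨s, rfl⟩)))).1 ?_) hN.le
    rw [nonneg_ptVec]
    exact PrimeFilter.top
  · rw [hK (ptVec s), zero_div]
    refine ⟨nonneg_ptVec (i := i) s ▸ PrimeFilter.top, nonneg_neg_ptVec_mem_iff.2 ?_⟩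
    refine PrimeFilter.of_le (Lind.box_mono i ?_) (box_compl_elt_mem hs)
    rw [← himp_bot]
    exact himp_le_himp_left bot_le
  · have h := hsum ⊤
    rw [elt_top, ← hN_def, div_self hN.ne'] at h
    rw [← h]
    exact Finset.sum_congr (by ext; simp) fun _ _ => rfl
  · refine div_pos ?_ hN
    have h := hf (-ptVec (tp Γ.cl T)) (Or.inl (Or.inl (Or.inr ⟨_, rfl⟩)))
    rw [map_neg] at h
    by_contra hle
    -- If the mass at the trace of `T` were zero, `T` would contain `elt (Iic t) ⇨ elt (Iio t)` and
    -- hence `elt (Iio t)`, which says `t < t`.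
    have h1 := nonneg_neg_ptVec_mem_iff.1 (h.2 (by linarith))
    have h2 : elt (LowerSet.Iic (tp Γ.cl T)) ∈ T :=
      elt_mem.2 (show tp Γ.cl T ≤ tp Γ.cl T from le_rfl)
    have h3 := PrimeFilter.himp_mem (PrimeFilter.of_le (box_le i _) h1) h2
    rw [elt_mem] at h3
    exact lt_irrefl _ (show tp Γ.cl T < tp Γ.cl T from h3)
  · intro n α φ β hmem
    obtain ⟨hφ, -⟩ := Γ.closed.closedAt _ hmem
    have hwf : ∀ k, WF (φ k) := fun k => Γ.closed.wf _ (hφ k)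
    rw [tp_mem_hold hmem (.prob hwf), cls_prob_eq hwf]
    obtain ⟨k₀, hk₀⟩ := hmem
    rw [hf _ (Or.inl (Or.inr ⟨k₀, congrArg probVec hk₀⟩)), probVec_prob hwf]
    simp only [hsum, elt_hold (hφ _) (hwf _), map_sub, map_sum, map_smul, smul_eq_mul]
    rw [← hN_def, sub_nonneg, ← le_div_iff₀ hN, Finset.sum_div]
    simp only [mul_div_assoc]

/-- The weights given by the point `t`. -/
def ptWt (i : Ag) (t : Γ.Pt) : Γ.Pt → ℚ := (exists_isWeight i t).choose

theorem ptWt_spec (i : Ag) (t : Γ.Pt) : IsWeight i t (ptWt i t) :=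
  (exists_isWeight i t).choose_spec

open scoped Classical in
/-- The class of a point. -/
def block (i : Ag) (s : Γ.Pt) : Finset Γ.Pt := Finset.univ.filter fun t => (Γ.rel i).r t s

theorem mem_block {s t : Γ.Pt} : t ∈ block i s ↔ (Γ.rel i).r t s := by simp [block]

theorem block_congr {s t : Γ.Pt} (h : (Γ.rel i).r t s) : block i t = block i s := by
  ext w
  rw [mem_block, mem_block]
  exact ⟨fun h' => (Γ.rel i).trans h' h, fun h' => (Γ.rel i).trans h' ((Γ.rel i).symm h)⟩

theorem self_mem_block (s : Γ.Pt) : s ∈ block i s := mem_block.2 ((Γ.rel i).refl s)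

theorem block_card_pos (s : Γ.Pt) : (0 : ℚ) < (block i s).card := by
  exact_mod_cast Finset.card_pos.2 ⟨s, self_mem_block s⟩

/-- The average of the weights given by the points of a class. -/
def avgWt (i : Ag) (s : Γ.Pt) : ℚ := (∑ t ∈ block i s, ptWt i t s) / (block i s).card

/-- Each point of the class contributes a nonnegative weight, and `s` itself a positive one. -/
theorem avgWt_pos (i : Ag) (s : Γ.Pt) : 0 < avgWt i s :=
  div_pos (Finset.sum_pos' (fun t _ => (ptWt_spec i t).nonneg s)
    ⟨s, self_mem_block s, (ptWt_spec i s).pos⟩) (block_card_pos s)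

open scoped Classical in
-- Exchange the sums; the restriction to the class can be dropped because the weights given by its
-- points vanish elsewhere.
theorem sum_avgWt (i : Ag) (w : Γ.Pt) (p : Γ.Pt → Prop) :
    ∑ s ∈ Finset.univ.filter (fun s => p s ∧ (Γ.rel i).r s w), avgWt i s =
      (∑ t ∈ block i w, ∑ s ∈ Finset.univ.filter p, ptWt i t s) / (block i w).card := by
  have h1 : ∀ s ∈ Finset.univ.filter (fun s => p s ∧ (Γ.rel i).r s w),
      avgWt i s = (∑ t ∈ block i w, ptWt i t s) / (block i w).card := fun s hs => by
    rw [avgWt, block_congr (Finset.mem_filter.1 hs).2.2]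
  rw [Finset.sum_congr rfl h1, ← Finset.sum_div, Finset.sum_comm]
  congr 1
  refine Finset.sum_congr rfl fun t ht => ?_
  refine Finset.sum_subset (fun s hs => ?_) fun s hs hns => ?_
  · exact Finset.mem_filter.2 ⟨Finset.mem_univ _, (Finset.mem_filter.1 hs).2.1⟩
  · refine (ptWt_spec i t).eq_zero s fun hst => hns (Finset.mem_filter.2 ⟨Finset.mem_univ _,
      (Finset.mem_filter.1 hs).2, (Γ.rel i).trans hst (mem_block.1 ht)⟩)

/-- The canonical model of a closed family. -/
def canon (Γ : ClosedFamily AtProp Ag) : Kripke AtProp Ag Γ.Pt where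
  rel := Γ.rel
  rel_of_le _ _ _ := rel_of_le
  wt i s := (avgWt i s : ℝ)
  wt_pos i s := by exact_mod_cast avgWt_pos i s
  wt_sum i w := by
    classical
    have h := sum_avgWt i w fun _ => True
    simp only [true_and, Finset.filter_true, (ptWt_spec i _).sum_eq, Finset.sum_const, nsmul_eq_mul,
      mul_one, div_self (block_card_pos (i := i) w).ne'] at h
    exact_mod_cast h
  val p := Γ.hold (atom p)

/-- All points of a class agree on the inequality, so either all their weights satisfy it or all
violate it; the average then does the same. -/
theorem mem_hold_prob_iff {n : ℕ} {α : Fin n → ℚ} {φ : Fin n → Fml AtProp Ag} {β : ℚ}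
    (hmem : prob i n α φ β ∈ Set.range Γ.fml) (w : Γ.Pt) : (open scoped Classical in
    w ∈ Γ.hold (prob i n α φ β) ↔ β ≤ ∑ k, α k *
      ∑ s ∈ Finset.univ.filter (fun s => s ∈ Γ.hold (φ k) ∧ (Γ.rel i).r s w), avgWt i s) := by
  classical
  have hX : ∀ t ∈ block i w, (w ∈ Γ.hold (prob i n α φ β) ↔
      β ≤ ∑ k, α k * ∑ s ∈ Finset.univ.filter (· ∈ Γ.hold (φ k)), ptWt i t s) := fun t ht => by
    rw [← (ptWt_spec i t).prob_iff n α φ β hmem]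
    have h : ∀ k, Γ.fml k = prob i n α φ β → (k ∈ w.1 ↔ k ∈ t.1) := fun k hk =>
      (mem_block.1 ht k (by rw [hk]; exact rfl)).symm
    exact exists_congr fun k => and_congr_right fun hk => h k hk
  have hsum : ∑ k, α k *
      ∑ s ∈ Finset.univ.filter (fun s => s ∈ Γ.hold (φ k) ∧ (Γ.rel i).r s w), avgWt i s =
      (∑ t ∈ block i w, ∑ k, α k * ∑ s ∈ Finset.univ.filter (· ∈ Γ.hold (φ k)), ptWt i t s) /
        (block i w).card := by
    simp only [sum_avgWt]
    rw [Finset.sum_comm, Finset.sum_div]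
    simp only [← Finset.mul_sum, mul_div_assoc]
  rw [hsum, le_div_iff₀ (block_card_pos w), mul_comm, ← nsmul_eq_mul]
  constructor
  · exact fun h => Finset.card_nsmul_le_sum _ _ _ fun t ht => (hX t ht).1 h
  · intro h
    by_contra hne
    refine absurd h (not_le_of_gt ?_)
    rw [← Finset.sum_const]
    exact Finset.sum_lt_sum_of_nonempty ⟨w, self_mem_block w⟩ fun t ht =>
      not_le.1 fun h' => hne ((hX t ht).2 h')

/-- Extend the filter `{z | □(x ⇨ z) ∈ T}` to a prime one. It is proper because M7 would otherwise
put `◇⊥ = ⊥` into `T`. -/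
theorem exists_rel_of_dia_mem {x : Lind AtProp Ag} (h : Lind.dia i x ∈ T) :
    ∃ T', (Γ.rel i).r (tp Γ.cl T') (tp Γ.cl T) ∧ x ∈ T' := by
  obtain ⟨T', hT', -⟩ := PrimeFilter.exists_of_notMem (S := {z | Lind.box i (x ⇨ z) ∈ T}) (y := ⊥)
    (by simp only [Set.mem_ofPred_eq, himp_top, box_top]; exact PrimeFilter.top)
    (fun a ha b hb => by
      simp only [Set.mem_ofPred_eq, himp_inf_distrib, box_inf]
      exact PrimeFilter.inf_iff.2 ⟨ha, hb⟩)
    (fun {a b} hab ha => PrimeFilter.of_le (Lind.box_mono i (himp_le_himp_left hab)) ha)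
    (fun hb => by
      have := PrimeFilter.himp_mem (PrimeFilter.of_le (box_himp_le_dia i x ⊥) hb) h
      rw [dia_bot] at this
      exact PrimeFilter.bot this)
  refine ⟨T', rel_of_box fun z hz => hT' z (PrimeFilter.of_le (Lind.box_mono i le_himp) hz),
    hT' x ?_⟩
  simp only [Set.mem_ofPred_eq, himp_self, box_top]
  exact PrimeFilter.top

/-- Extend the filter `{z | □z ∈ T}` to a prime filter avoiding `x`. -/
theorem exists_rel_of_box_notMem {x : Lind AtProp Ag} (h : Lind.box i x ∉ T) :
    ∃ T', (Γ.rel i).r (tp Γ.cl T') (tp Γ.cl T) ∧ x ∉ T' := by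
  obtain ⟨T', hT', hx⟩ := PrimeFilter.exists_of_notMem (S := {z | Lind.box i z ∈ T}) (y := x)
    (by simp only [Set.mem_ofPred_eq, box_top]; exact PrimeFilter.top)
    (fun a ha b hb => by
      simp only [Set.mem_ofPred_eq, box_inf]
      exact PrimeFilter.inf_iff.2 ⟨ha, hb⟩)
    (fun {a b} hab ha => PrimeFilter.of_le (Lind.box_mono i hab) ha) h
  exact ⟨T', rel_of_box fun z hz => hT' z hz, hx⟩

/-- In the canonical model a member of the family holds at the points that contain it. -/
theorem truth_eq_hold {φ : Fml AtProp Ag} (hφ : φ ∈ Set.range Γ.fml) :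
    Γ.canon.truth φ = Γ.hold φ := by
  have hwf := Γ.closed.wf φ hφ
  have hcl := Γ.closed.closedAt φ hφ
  ext w
  rw [SetLike.mem_coe, SetLike.mem_coe]
  obtain ⟨T, rfl⟩ := exists_tp w
  induction φ generalizing T with
  | atom p => exact Γ.canon.mem_truth_atom p
  | bot =>
    rw [tp_mem_hold hφ hwf]
    exact ⟨fun h => (Γ.canon.mem_truth_bot h).elim, fun h => (PrimeFilter.bot h).elim⟩
  | conj φ ψ ih ih' =>
    have h1 := Γ.closed.wf _ hcl.1
    have h2 := Γ.closed.wf _ hcl.2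
    rw [Γ.canon.mem_truth_conj, ih hcl.1 h1 (Γ.closed.closedAt _ hcl.1),
      ih' hcl.2 h2 (Γ.closed.closedAt _ hcl.2), tp_mem_hold hcl.1 h1, tp_mem_hold hcl.2 h2,
      tp_mem_hold hφ hwf]
    exact PrimeFilter.inf_iff.symm
  | disj φ ψ ih ih' =>
    have h1 := Γ.closed.wf _ hcl.1
    have h2 := Γ.closed.wf _ hcl.2
    rw [Γ.canon.mem_truth_disj, ih hcl.1 h1 (Γ.closed.closedAt _ hcl.1),
      ih' hcl.2 h2 (Γ.closed.closedAt _ hcl.2), tp_mem_hold hcl.1 h1, tp_mem_hold hcl.2 h2,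
      tp_mem_hold hφ hwf]
    exact PrimeFilter.sup_iff.symm
  | impl φ ψ ih ih' =>
    have h1 := Γ.closed.wf _ hcl.1
    have h2 := Γ.closed.wf _ hcl.2
    rw [Γ.canon.mem_truth_impl, tp_mem_hold hφ hwf]
    constructor
    · intro h
      by_contra hne
      obtain ⟨T', hT', hx, hy⟩ := PrimeFilter.exists_of_himp_notMem
        (x := cls φ h1) (y := cls ψ h2) hne
      have h3 := h (tp Γ.cl T') (tp_le_tp.2 fun k hk => hT' _ hk)
      rw [ih hcl.1 h1 (Γ.closed.closedAt _ hcl.1), ih' hcl.2 h2 (Γ.closed.closedAt _ hcl.2),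
        tp_mem_hold hcl.1 h1, tp_mem_hold hcl.2 h2] at h3
      exact hy (h3 hx)
    · intro h w' hw'
      obtain ⟨T', rfl⟩ := exists_tp w'
      rw [ih hcl.1 h1 (Γ.closed.closedAt _ hcl.1), ih' hcl.2 h2 (Γ.closed.closedAt _ hcl.2),
        tp_mem_hold hcl.1 h1, tp_mem_hold hcl.2 h2]
      have h3 := cls_mem_of_tp_le hφ hwf hw' h
      exact PrimeFilter.himp_mem (x := cls φ h1) (y := cls ψ h2) h3
  | dia i φ ih =>
    have h1 := Γ.closed.wf _ hcl.1
    rw [Γ.canon.mem_truth_dia]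
    constructor
    · rintro ⟨w', hr, hw'⟩
      obtain ⟨T', rfl⟩ := exists_tp w'
      rw [ih hcl.1 h1 (Γ.closed.closedAt _ hcl.1), tp_mem_hold hcl.1 h1] at hw'
      have h2 : tp Γ.cl T' ∈ Γ.hold (.dia i φ) :=
        (tp_mem_hold hφ hwf).2 (PrimeFilter.of_le (le_dia i (cls φ h1)) hw')
      obtain ⟨k, hk, h3⟩ := h2
      -- The formula `◇_i φ` is itself modal, so related points agree on it.
      exact ⟨k, hk, (hr k (by rw [hk]; exact rfl)).1 h3⟩
    · intro h
      rw [tp_mem_hold hφ hwf] at h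
      obtain ⟨T', hr, hx⟩ := exists_rel_of_dia_mem (Γ := Γ) (x := cls φ h1) h
      refine ⟨tp Γ.cl T', hr, ?_⟩
      rwa [ih hcl.1 h1 (Γ.closed.closedAt _ hcl.1), tp_mem_hold hcl.1 h1]
  | box i φ ih =>
    have h1 := Γ.closed.wf _ hcl.1
    rw [Γ.canon.mem_truth_box]
    constructor
    · intro h
      rw [tp_mem_hold hφ hwf]
      by_contra hne
      obtain ⟨T', hr, hx⟩ := exists_rel_of_box_notMem (Γ := Γ) (x := cls φ h1) hne
      have h2 := h (tp Γ.cl T') hr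
      rw [ih hcl.1 h1 (Γ.closed.closedAt _ hcl.1), tp_mem_hold hcl.1 h1] at h2
      exact hx h2
    · rintro ⟨k, hk, h3⟩ w' hr
      obtain ⟨T', rfl⟩ := exists_tp w'
      have h2 : tp Γ.cl T' ∈ Γ.hold (.box i φ) :=
        ⟨k, hk, (hr k (by rw [hk]; exact rfl)).2 h3⟩
      rw [tp_mem_hold hφ hwf] at h2
      rw [ih hcl.1 h1 (Γ.closed.closedAt _ hcl.1), tp_mem_hold hcl.1 h1]
      exact PrimeFilter.of_le (box_le i (cls φ h1)) h2
  | upDia => exact hcl.elim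
  | upBox => exact hcl.elim
  | prob i n α φ β ih =>
    classical
    have heq : ∀ k, Γ.canon.truth (φ k) = Γ.hold (φ k) := fun k => by
      ext w
      obtain ⟨T', rfl⟩ := exists_tp w
      exact ih k (hcl.1 k) (Γ.closed.wf _ (hcl.1 k)) (Γ.closed.closedAt _ (hcl.1 k)) T'
    rw [Γ.canon.mem_truth_prob, mem_hold_prob_iff hφ]
    simp only [heq]
    rw [← Rat.cast_le (K := ℝ)]
    push_cast
    exact Iff.rfl

end ClosedFamily

/-- Completeness for formulas without updates. -/
theorem provable_of_valid_of_static {φ : Fml AtProp Ag} (hφ : WF φ) (hs : Static φ)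
    (hv : Valid φ) : Provable φ := by
  obtain ⟨S, hfin, hS, hmem⟩ := exists_closedSet hφ hs
  obtain ⟨n, g, -, rfl⟩ := hfin.fin_param
  let Γ : ClosedFamily AtProp Ag := ⟨n, g, hS⟩
  rw [← cls_eq_top_iff (hφ := hφ), ← top_le_iff]
  -- A formula in every prime filter is a theorem. The trace of each prime filter is a point of the
  -- canonical model, where validity makes `φ` true.
  refine PrimeFilter.le_of_forall fun T _ => ?_
  rw [← ClosedFamily.tp_mem_hold (Γ := Γ) hmem hφ, ← ClosedFamily.truth_eq_hold (Γ := Γ) hmem]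
  have h : Γ.canon.truth φ = ⊤ := hv _ Γ.canon.isAPE
  rw [h]
  trivial

end CanonicalModel

end

end IPDEL

theorem mainTheorem1 {AtProp : Type*} {Ag : Type*} (φ : IPDEL.Fml AtProp Ag)
    (hφ : IPDEL.WF φ) (hvalid : IPDEL.Valid φ) : IPDEL.Provable φ := by
  obtain ⟨_, ψ, hψ, hs, he⟩ := IPDEL.HasStatic.of_wf hφ
  -- Soundness of the provable equivalence carries validity from `φ` to its static form.
  have hv : IPDEL.Valid ψ := fun M hM => by
    rw [← IPDEL.eval_iff_eq_top.1 ((IPDEL.Lind.cls_eq_iff.1 he).sound M hM)]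
    exact hvalid M hM
  rw [← IPDEL.Lind.cls_eq_top_iff (hφ := hφ), he, IPDEL.Lind.cls_eq_top_iff]
  exact IPDEL.provable_of_valid_of_static hψ hs hv
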